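/- **Lemma 4.1 (Decomposition Lemma).** Setting. Let $B_r(x)\subset\mathbb R^n$ be the open Euclidean ball, and let $N=N^m$ be a smooth complete Riemannian manifold with Riemannian distance $\mathrm{dist}$ ($=\infty$ between different components), realized by a smooth isometric embedding $\iota:N\to\mathbb R^L$ as a closed submanifold. A map $f:B_2(0)\to N$ is *stationary harmonic* if $u=\iota\circ f\in W^{1,2}(B_2(0);\mathbb R^L)$ and the first variation of the Dirichlet energy vanishes in the target and in the domain, i.e. $$\int_{B_2(0)}\sum_i\big\langle\partial_i u,\partial_i\big(X(x,u(x))\big)\big\rangle\,dx=0$$ for all $X\in C_c^\infty(B_2(0)\times\mathbb R^L;\mathbb R^L)$ with $X(x,\iota(p))$ tangent to $\iota(N)$ at $\iota(p)$ for all $x$ and all $p\in N$, and $$\int_{B_2(0)}\Big(|\nabla u|^2\,\mathrm{div}\,\xi-2\sum_{i,j}\langle\partial_iu,\partial_ju\rangle\,\partial_i\xi^j\Big)dx=0\qquad\text{for all }\xi\in C_c^\infty(B_2(0);\mathbb R^n).$$ A measurable map $h:\mathbb R^n\to N$ is *$k$-homogeneous* if $h(\lambda z)=h(z)$ for all $\lambda>0$,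 $z\in\mathbb R^n$, and if there is a $k$-dimensional linear subspace $V$ with $h(z+v)=h(z)$ for all $z\in\mathbb R^n$, $v\in V$. For $\eta>0$ and $0<r<1$, the *$k$-th effective singular stratum* $\mathcal S^k_{\eta,r}(f)$ is the set of points $y$ such that $$\frac1{|B_1(0)|}\int_{B_1(0)}\mathrm{dist}\big(f(y+sz),h(z)\big)^2\,dz>\eta\quad\text{for all } r\le s\le1\text{ and all }(k+1)\text{-homogeneous } h$$ (only its part in $B_1(0)$ is used below). Statement. For every $n$ there are constants $c_1=c_1(n)>0$ and $c_0=c_0(n)>0$ such that, for every $N$ as above and all $\Lambda>0$, $\eta>0$, $0<\gamma<1$, there are $K=K(n,\Lambda,\eta,\gamma,N)>0$ and $Q=Q(n,\Lambda,\eta,\gamma,N)>0$ (not depending on $\iota$) with the following property. Let $f:B_2(0)\to N$ be a stationary harmonic map with $\int_{B_2(0)}|\nabla f|^2<\Lambda$, let $0\le k\le n-1$, and let $j\ge1$ be an integer. Then: 1. $\mathcal S^k_{\eta,\gamma^j}(f)\cap B_1(0)$ is contained in the union of at most $j^K$ nonempty sets $\mathcal C^k_{\eta,\gamma^j}$. 2.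 Each set $\mathcal C^k_{\eta,\gamma^j}$ is the union of at most $(c_1\gamma^{-n})^Q\,(c_0\gamma^{-k})^{j-Q}$ balls of radius $\gamma^j$. -/

import Mathlib

open MeasureTheory Metric Set Topology Bundle Manifold
open scoped ENNReal ContDiff

noncomputable section

namespace HarmonicStrat

/-- Euclidean space `ℝⁿ`. -/
abbrev Euc (n : ℕ) : Type := EuclideanSpace ℝ (Fin n)

/-- The `i`-th standard basis vector of `ℝⁿ`. -/
def stdVec {n : ℕ} (i : Fin n) : Euc n := EuclideanSpace.single i 1

/-! ### Sobolev maps and stationary harmonic maps -/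

/-- `u` is of class `W^{1,2}(Ω; ℝᴸ)` and `Du` is its weak derivative on `Ω` (`Du x v = ∂ᵥu(x)`). -/
structure IsW12 {n L : ℕ} (Ω : Set (Euc n)) (u : Euc n → Euc L)
    (Du : Euc n → Euc n →L[ℝ] Euc L) : Prop where
  memLp : MemLp u 2 (volume.restrict Ω)
  memLp_deriv : ∀ v : Euc n, MemLp (fun x => Du x v) 2 (volume.restrict Ω)
  weak : ∀ φ : Euc n → ℝ, ContDiff ℝ ∞ φ → HasCompactSupport φ → tsupport φ ⊆ Ω →
    ∀ v : Euc n, ∫ x in Ω, (fderiv ℝ φ x v) • u x = -∫ x in Ω, φ x • Du x v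

/-- The energy density `|∇f|² = ∑ᵢ |∂ᵢ f|²`. -/
def energyDensity {n L : ℕ} (Du : Euc n → Euc n →L[ℝ] Euc L) (x : Euc n) : ℝ :=
  ∑ i, ‖Du x (stdVec i)‖ ^ 2

section Target

variable {m : ℕ} {N : Type*} [EMetricSpace N] [ChartedSpace (Euc m) N]

/-- `ι` is a smooth isometric embedding (in the sense of Riemannian geometry) of the Riemannian
manifold `N` onto a closed subset of `ℝᴸ`. -/
structure IsIsometricEmbedding [RiemannianBundle (fun p : N => TangentSpace (𝓡 m) p)] {L : ℕ}
    (ι : N → Euc L) : Prop where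
  contMDiff : ContMDiff (𝓡 m) (𝓡 L) ∞ ι
  isClosedEmbedding : IsClosedEmbedding ι
  norm_mfderiv : ∀ (p : N) (v : TangentSpace (𝓡 m) p), ‖mfderiv (𝓡 m) (𝓡 L) ι p v‖ = ‖v‖

/-- `f : Ω ⊆ ℝⁿ → N` is a stationary harmonic map, where `N` is embedded into `ℝᴸ` by `ι` and
`Du` is the weak derivative of `u = ι ∘ f`: the map is of class `W^{1,2}`, and the first variation
of the Dirichlet energy vanishes both for variations in the target and for variations of
the domain. -/
structure IsStationaryHarmonic {n L : ℕ} (Ω : Set (Euc n)) (ι : N → Euc L) (f : Euc n → N)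
    (Du : Euc n → Euc n →L[ℝ] Euc L) : Prop where
  isW12 : IsW12 Ω (ι ∘ f) Du
  /-- `f` is weakly harmonic: `∫ ⟨∇u, ∇(X(x, u(x)))⟩ = 0` for all smooth compactly supported
  `X(x, y)` which are tangent to `N` at the points `y` of `N`. -/
  weaklyHarmonic : ∀ X : Euc n × Euc L → Euc L, ContDiff ℝ ∞ X → HasCompactSupport X →
    tsupport X ⊆ Ω ×ˢ univ →
    (∀ (x : Euc n) (p : N), ∃ w : TangentSpace (𝓡 m) p,
      X (x, ι p) = mfderiv (𝓡 m) (𝓡 L) ι p w) →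
    ∫ x in Ω, ∑ i, inner ℝ (Du x (stdVec i))
      (fderiv ℝ X (x, ι (f x)) (stdVec i, Du x (stdVec i))) = 0
  /-- `f` is critical with respect to variations `f (x + t ξ(x))` of the domain:
  `∫ |∇u|² div ξ - 2 ∑ᵢ ⟨∂ᵢ u, Du (∂ᵢ ξ)⟩ = 0`. -/
  stationary : ∀ ξ : Euc n → Euc n, ContDiff ℝ ∞ ξ → HasCompactSupport ξ → tsupport ξ ⊆ Ω →
    ∫ x in Ω, (energyDensity Du x * ∑ i, fderiv ℝ ξ x (stdVec i) i
      - 2 * ∑ i, inner ℝ (Du x (stdVec i)) (Du x (fderiv ℝ ξ x (stdVec i)))) = 0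

end Target

/-! ### Homogeneous maps and the effective strata -/

section Strata

variable {N : Type*} [EMetricSpace N] [MeasurableSpace N]

/-- The measurable map `h : ℝⁿ → N` is `k`-homogeneous (at the origin) with respect to some
`k`-plane `V`. -/
def IsHomogeneousMap {n : ℕ} (k : ℕ) (h : Euc n → N) : Prop :=
  Measurable h ∧ ∃ V : Submodule ℝ (Euc n), Module.finrank ℝ V = k ∧
    (∀ (c : ℝ) (z : Euc n), 0 < c → h (c • z) = h z) ∧
    (∀ z : Euc n, ∀ v ∈ V, h (z + v) = h z)

/-- The rescaled map `T_{y,s} f (z) = f (y + s z)`. -/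
def rescale {n : ℕ} (y : Euc n) (s : ℝ) (f : Euc n → N) (z : Euc n) : N := f (y + s • z)

/-- The `k`-th effective singular stratum: the points `y` such that for all `r ≤ s ≤ 1` and all
`(k+1)`-homogeneous `h`, the average over the unit ball of `dist (T_{y,s} f, h)²` exceeds `η`.
The average is taken in `[0, ∞]`. For maps defined on `ball 0 2`, this is meaningful for `y`
in `ball 0 1`, since then only values of `f` on `ball 0 2` enter. -/
def effStratum {n : ℕ} (k : ℕ) (η r : ℝ) (f : Euc n → N) : Set (Euc n) :=
  {y | ∀ s : ℝ, r ≤ s → s ≤ 1 → ∀ h : Euc n → N, IsHomogeneousMap (k + 1) h →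
    ENNReal.ofReal η < ⨍⁻ z in ball (0 : Euc n) 1, edist (rescale y s f z) (h z) ^ 2 ∂volume}

end Strata

end HarmonicStrat

end

/-! Write `Du` for the weak derivative of `u = ι ∘ f`. Testing the inner variation with the field
`g(|x - y|²)(x - y)`, where `g(t)` is a cutoff times `(t + ε)^(-(n-2)/2)`, gives the monotonicity
formula as a bound of `∫ (|x - y|² + ε)^(-n/2) |Du(x)(x - y)|²` by the total energy
(`exists_weighted_radial_energy_le`). With `ε = γ^(2j)` and a geometric series, all but a bounded
number `Q` of the scales `γ^i`, `i < j`, have small normalized radial energy at a given point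
(`exists_card_badIndices_le`). The stratum is split according to the exact set of bad scales of its
points. These sets are nonempty subsets of `{0, …, j-1}` with at most `Q` elements, so at most `j^Q`
of them occur.

One class is covered scale by scale. Refining a ball of radius `γ^i` into balls of radius `γ^(i+1)`
costs about `γ^(-n)` at a bad scale, which happens at most `Q` times. At a good scale it costs about
`γ^(-k)`, by quantitative cone splitting: `Du(z) a = Du(z) z - Du(z)(z - a)`, so small radial energy
at `0` and at `a` makes the derivative in the direction `a` small. Diagonalize `v ↦ ∫ |Du v|²`. If
more than `k` eigenvalues were small, `f` would be almost radially constant and almost invariant in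
`k + 1` directions, hence `L²`-close to a `(k+1)`-homogeneous map, which membership in the stratum
forbids. So at most `k` eigenvalues are small, and the other coordinates of `a` are small
(`exists_basis_of_radial_small`).

Closeness to a homogeneous map is proved without compactness
(`exists_isHomogeneousMap_lintegral_le`). The comparison map is `f` read off on a slice at fixed
distance from the spine, the slice being chosen by averaging. Away from the spine, `f` and this map
are compared along segments; near the spine, repeated doubling of the distance to the spine gives a
contraction. The distances are those of `N` itself. Along almost every segment `u` is absolutely
continuous and stays in the closed set `ι(N)`, so the distance in `N` is at most twice the Euclidean
length (`IsIsometricEmbedding.edist_le_lintegral`). The factor 2 is universal, so `Q` does not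
depend on `ι`. -/

noncomputable section

namespace HarmonicStrat

/-! ### Intrinsic distance in `N` against Euclidean length of curves. -/

section Riemannian

variable {m L : ℕ} {N : Type*} [EMetricSpace N] [ChartedSpace (Euc m) N] [IsManifold (𝓡 m) ∞ N]
  [RiemannianBundle (fun p : N => TangentSpace (𝓡 m) p)]
  [IsRiemannianManifold (𝓡 m) N]

/-- An isometric embedding in the Riemannian sense is locally bi-Lipschitz, with a uniform
constant. -/
theorem IsIsometricEmbedding.eventually_edist_le {ι : N → Euc L}
    (hι : IsIsometricEmbedding (m := m) ι) (x : N) :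
    ∃ s ∈ 𝓝 x, ∀ y ∈ s, ∀ z ∈ s, edist y z ≤ 2 * edist (ι y) (ι z) := by
  set φ := extChartAt (𝓡 m) x with hφ
  set G : Euc m → Euc L := ι ∘ φ.symm with hG
  have htarget : IsOpen φ.target := isOpen_extChartAt_target x
  have hGmd : ContMDiffOn (𝓡 m) (𝓡 L) ∞ G φ.target :=
    hι.contMDiff.comp_contMDiffOn (contMDiffOn_extChartAt_symm x)
  have hGs : ContDiffOn ℝ ∞ G φ.target := contMDiffOn_iff_contDiffOn.1 hGmd
  have hxt : φ x ∈ φ.target := mem_extChartAt_target x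
  have hGat : ∀ w ∈ φ.target, HasFDerivAt G (fderiv ℝ G w) w := fun w hw =>
    ((hGs.contDiffAt (htarget.mem_nhds hw)).differentiableAt (by simp)).hasFDerivAt
  have hsymm : ∀ w ∈ φ.target, MDifferentiableAt (𝓡 m) (𝓡 m) φ.symm w := fun w hw =>
    (contMDiffOn_extChartAt_symm (n := ∞) (I := 𝓡 m) x).contMDiffAt (htarget.mem_nhds hw)
      |>.mdifferentiableAt (by simp)
  have hnorm : ∀ w ∈ φ.target, ∀ v : Euc m,
      ‖(mfderiv (𝓡 m) (𝓡 m) φ.symm w v : TangentSpace (𝓡 m) (φ.symm w))‖ = ‖fderiv ℝ G w v‖ := by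
    intro w hw v
    rw [← hι.norm_mfderiv]
    have h1 : mfderiv (𝓡 m) (𝓡 L) G w =
        (mfderiv (𝓡 m) (𝓡 L) ι (φ.symm w)).comp (mfderiv (𝓡 m) (𝓡 m) φ.symm w) :=
      mfderiv_comp w (hι.contMDiff.mdifferentiableAt (by simp)) (hsymm w hw)
    have h2 : (fderiv ℝ G w v : Euc L) = mfderiv (𝓡 m) (𝓡 L) ι (φ.symm w)
        (mfderiv (𝓡 m) (𝓡 m) φ.symm w v) := by
      rw [← mfderiv_eq_fderiv, h1]
      rfl
    rw [norm_tangentSpace_vectorSpace]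
    exact (congrArg (fun a : Euc L => ‖a‖) h2).symm
  set A := fderiv ℝ G (φ x) with hA
  -- A null vector of `A` would be a null vector of the derivative of the inverse chart, which is
  -- invertible.
  have hinj : Function.Injective A := by
    rw [injective_iff_map_eq_zero]
    intro v hv
    have h := hnorm _ hxt v
    rw [← hA, hv, norm_zero, norm_eq_zero] at h
    have hinv := isInvertible_mfderivWithin_extChartAt_symm (I := 𝓡 m) (x := x) hxt
    rw [ModelWithCorners.Boundaryless.range_eq_univ, mfderivWithin_univ] at hinv
    obtain ⟨e, he⟩ := hinv
    have : e v = e 0 := by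
      rw [map_zero]
      exact (congrArg (fun B => B v) he).trans h
    exact e.injective this
  obtain ⟨c, hc, hcA⟩ : ∃ c > 0, ∀ v, c * ‖v‖ ≤ ‖A v‖ := by
    obtain ⟨K, hK, h⟩ := A.toLinearMap.exists_antilipschitzWith (LinearMap.ker_eq_bot.2 hinj)
    refine ⟨(K : ℝ)⁻¹, by positivity, fun v => ?_⟩
    have := h.le_mul_dist v 0
    simp only [map_zero, dist_zero_right] at this
    rw [inv_mul_le_iff₀ (by positivity)]
    exact this
  have hcont : ContinuousAt (fderiv ℝ G) (φ x) :=
    (hGs.contDiffAt (htarget.mem_nhds hxt)).continuousAt_fderiv (by simp)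
  -- The tolerance `c / 4` gives the factor 2: `|DG_w v| ≤ |Av| + c|v|/4`, while `2|G(φ z) - G(φ y)|
  -- ≥ 2|Av| - c|v|/2 ≥ |Av| + c|v|/2`.
  have hev : ∀ᶠ w in 𝓝 (φ x), w ∈ φ.target ∧ ‖fderiv ℝ G w - A‖ ≤ c / 4 := by
    refine (htarget.eventually_mem hxt).and ?_
    filter_upwards [hcont (Metric.closedBall_mem_nhds A (show 0 < c / 4 by positivity))] with w hw
    simpa [dist_eq_norm] using hw
  obtain ⟨r, hr, hball⟩ := Metric.eventually_nhds_iff_ball.1 hev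
  refine ⟨φ ⁻¹' ball (φ x) r ∩ φ.source, Filter.inter_mem
    ((continuousAt_extChartAt x).preimage_mem_nhds (ball_mem_nhds _ hr))
    (extChartAt_source_mem_nhds x), ?_⟩
  rintro y ⟨hy, hys⟩ z ⟨hz, hzs⟩
  set v := φ z - φ y with hv
  let η := ContinuousAffineMap.lineMap (R := ℝ) (φ y) (φ z)
  have hηb : ∀ t ∈ Icc (0 : ℝ) 1, η t ∈ ball (φ x) r := by
    intro t ht
    refine (convex_ball (φ x) r).segment_subset hy hz ?_
    rw [segment_eq_image_lineMap]
    exact ⟨t, ht, by simp [η, ContinuousAffineMap.coe_lineMap_eq]⟩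
  have hηd : ∀ t, HasDerivAt η v t := by
    intro t
    have := AffineMap.hasDerivAt_lineMap (a := φ y) (b := φ z) (x := t)
    simpa [η, ContinuousAffineMap.coe_lineMap_eq, hv] using this
  have hbd : ‖G (φ z) - G (φ y) - A v‖ ≤ c / 4 * ‖v‖ :=
    (convex_ball (φ x) r).norm_image_sub_le_of_norm_hasFDerivWithin_le'
      (fun w hw => (hGat w (hball w hw).1).hasFDerivWithinAt) (fun w hw => (hball w hw).2) hy hz
  have hlow : ‖A v‖ - c / 4 * ‖v‖ ≤ ‖G (φ z) - G (φ y)‖ := by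
    have := norm_sub_norm_le (A v) (A v - (G (φ z) - G (φ y)))
    rw [sub_sub_cancel, norm_sub_rev] at this
    linarith
  have hup : ∀ w ∈ ball (φ x) r, ‖fderiv ℝ G w v‖ ≤ 2 * ‖G (φ z) - G (φ y)‖ := by
    intro w hw
    have h1 : ‖fderiv ℝ G w v - A v‖ ≤ c / 4 * ‖v‖ :=
      ((fderiv ℝ G w - A).le_opNorm v).trans (by gcongr; exact (hball w hw).2)
    have h2 := norm_sub_norm_le (fderiv ℝ G w v) (A v)
    have h3 := hcA v
    have h4 : 0 ≤ c * ‖v‖ := by positivity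
    linarith
  have hGy : G (φ y) = ι y := by simp [hG, φ.left_inv hys]
  have hGz : G (φ z) = ι z := by simp [hG, φ.left_inv hzs]
  rw [hGy, hGz] at hup
  have hηs : ContMDiffOn 𝓘(ℝ, ℝ) (𝓡 m) 1 η (Icc 0 1) := by
    apply ContMDiff.contMDiffOn
    rw [contMDiff_iff_contDiff]
    exact ContinuousAffineMap.contDiff _
  rw [IsRiemannianManifold.out (I := 𝓡 m) y z]
  -- The straight segment in the chart, pulled back to `N`, is the competitor for the Riemannian
  -- distance.
  refine (Manifold.riemannianEDist_le_pathELength (γ := φ.symm ∘ η) (a := 0) (b := 1)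
    ((contMDiffOn_extChartAt_symm x).comp hηs fun t ht => (hball _ (hηb t ht)).1)
    (by simp [η, ContinuousAffineMap.coe_lineMap_eq, φ.left_inv hys])
    (by simp [η, ContinuousAffineMap.coe_lineMap_eq, φ.left_inv hzs]) zero_le_one).trans ?_
  rw [Manifold.pathELength_eq_lintegral_mfderiv_Ioo]
  calc ∫⁻ t in Ioo (0 : ℝ) 1, ‖mfderiv 𝓘(ℝ, ℝ) (𝓡 m) (φ.symm ∘ η) t 1‖ₑ
      ≤ ∫⁻ t in Ioo (0 : ℝ) 1, 2 * edist (ι y) (ι z) := by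
        refine setLIntegral_mono' measurableSet_Ioo fun t ht => ?_
        have htt := hηb t (Ioo_subset_Icc_self ht)
        have h1 : mfderiv 𝓘(ℝ, ℝ) (𝓡 m) (φ.symm ∘ η) t =
            (mfderiv (𝓡 m) (𝓡 m) φ.symm (η t)).comp (mfderiv 𝓘(ℝ, ℝ) (𝓡 m) η t) :=
          mfderiv_comp t (hsymm _ (hball _ htt).1)
            ((hηd t).differentiableAt.mdifferentiableAt)
        have h2 : mfderiv 𝓘(ℝ, ℝ) (𝓡 m) (φ.symm ∘ η) t 1 =
            mfderiv (𝓡 m) (𝓡 m) φ.symm (η t) v := by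
          rw [h1, mfderiv_eq_fderiv]
          have : fderiv ℝ η t 1 = v := by rw [(hηd t).hasFDerivAt.fderiv]; simp
          exact congrArg _ this
        rw [h2, ← ofReal_norm, edist_dist, dist_eq_norm, norm_sub_rev]
        refine (ENNReal.ofReal_le_ofReal
          ((hnorm _ (hball _ htt).1 v).le.trans (hup _ htt))).trans_eq ?_
        rw [ENNReal.ofReal_mul zero_le_two, ENNReal.ofReal_ofNat]
    _ = 2 * edist (ι y) (ι z) := by simp

/-- A curve in `N` whose image in Euclidean space is absolutely continuous joins two points at
distance at most twice its length. -/
theorem IsIsometricEmbedding.edist_le_lintegral {ι : N → Euc L}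
    (hι : IsIsometricEmbedding (m := m) ι) {U g : ℝ → Euc L} (hg : IntegrableOn g (Icc 0 1))
    (hU : ∀ t ∈ Icc (0 : ℝ) 1, U t = U 0 + ∫ s in (0 : ℝ)..t, g s)
    (hr : ∀ t ∈ Icc (0 : ℝ) 1, U t ∈ range ι) {p q : N} (hp : ι p = U 0) (hq : ι q = U 1) :
    edist p q ≤ 2 * ∫⁻ t in Icc (0 : ℝ) 1, ‖g t‖ₑ := by
  have hgi : IntervalIntegrable g volume 0 1 :=
    (intervalIntegrable_iff_integrableOn_Icc_of_le zero_le_one).2 hg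
  have hUc : ContinuousOn U (Icc 0 1) := by
    have h := intervalIntegral.continuousOn_primitive_interval (μ := volume) (a := 0) (b := 1)
      (f := g) (by rwa [uIcc_of_le zero_le_one])
    rw [uIcc_of_le zero_le_one] at h
    exact (continuousOn_const.add h).congr hU
  have : ∀ t : ℝ, ∃ y : N, t ∈ Icc (0 : ℝ) 1 → ι y = U t := fun t => by
    by_cases ht : t ∈ Icc (0 : ℝ) 1
    · obtain ⟨y, hy⟩ := hr t ht
      exact ⟨y, fun _ => hy⟩
    · exact ⟨p, fun h => absurd h ht⟩
  choose γ hγ using this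
  have hγc : ContinuousOn γ (Icc 0 1) := by
    rw [hι.isClosedEmbedding.isEmbedding.continuousOn_iff]
    exact hUc.congr hγ
  set ℓ : ℝ → ℝ≥0∞ := fun t => ∫⁻ s in Icc 0 t, ‖g s‖ₑ with hℓ
  have hadd : ∀ s t, 0 ≤ s → s ≤ t → t ≤ 1 → ℓ t = ℓ s + ∫⁻ r in Ioc s t, ‖g r‖ₑ := by
    intro s t hs hst ht
    rw [hℓ, ← lintegral_union measurableSet_Ioc, Icc_union_Ioc_eq_Icc hs hst]
    exact Set.disjoint_left.2 fun r hr hr' => absurd hr.2 (not_le.2 hr'.1)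
  have hUed : ∀ s t, 0 ≤ s → s ≤ t → t ≤ 1 → edist (U s) (U t) ≤ ∫⁻ r in Ioc s t, ‖g r‖ₑ := by
    intro s t hs hst ht
    have h1 : IntervalIntegrable g volume 0 s := hgi.mono_set (by
      rw [uIcc_of_le hs, uIcc_of_le zero_le_one]; exact Icc_subset_Icc_right (hst.trans ht))
    have h2 : IntervalIntegrable g volume 0 t := hgi.mono_set (by
      rw [uIcc_of_le (hs.trans hst), uIcc_of_le zero_le_one]; exact Icc_subset_Icc_right ht)
    rw [edist_comm, hU s ⟨hs, hst.trans ht⟩, hU t ⟨hs.trans hst, ht⟩, edist_eq_enorm_sub,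
      add_sub_add_left_eq_sub, intervalIntegral.integral_interval_sub_left h2 h1,
      intervalIntegral.integral_of_le hst]
    exact enorm_integral_le_lintegral_enorm _
  set S : Set ℝ := {t | edist (γ 0) (γ t) ≤ 2 * ℓ t} with hS
  have hℓc : ContinuousOn ℓ (Icc 0 1) := by
    have h := intervalIntegral.continuousOn_primitive_interval (μ := volume) (a := 0) (b := 1)
      (f := fun s => ‖g s‖) (by rw [uIcc_of_le zero_le_one]; exact hg.norm)
    rw [uIcc_of_le zero_le_one] at h
    refine (ENNReal.continuous_ofReal.comp_continuousOn h).congr fun t ht => ?_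
    have hgt : IntegrableOn g (Icc 0 t) := hg.mono_set (Icc_subset_Icc_right ht.2)
    rw [Function.comp_apply, intervalIntegral.integral_of_le ht.1,
      ← integral_Icc_eq_integral_Ioc, ofReal_integral_norm_eq_lintegral_enorm hgt]
  have hclosed : IsClosed (S ∩ Icc 0 1) := by
    have h1 : ContinuousOn (fun t => edist (γ 0) (γ t)) (Icc 0 1) :=
      (continuous_const.edist continuous_id).comp_continuousOn hγc
    have h2 : ContinuousOn (fun t => 2 * ℓ t) (Icc 0 1) :=
      (ENNReal.continuous_const_mul (by simp)).comp_continuousOn hℓc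
    have := isClosed_Icc.isClosed_le h1 h2
    convert this using 1
    ext t
    simp [hS, and_comm]
  -- Continuous induction: the set is closed, and the local comparison extends it to the right of
  -- each of its points. Additivity of `ℓ` keeps the factor equal to 2.
  have key : Icc (0 : ℝ) 1 ⊆ S := by
    refine hclosed.Icc_subset_of_forall_mem_nhdsWithin (by simp [hS]) ?_
    rintro t ⟨htS, ht0, ht1⟩
    obtain ⟨V, hV, hVd⟩ := hι.eventually_edist_le (γ t)
    have hct : γ ⁻¹' V ∈ 𝓝[>] t := by
      have h1 := (hγc t ⟨ht0, ht1.le⟩).preimage_mem_nhdsWithin hV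
      refine nhdsWithin_le_of_mem ?_ h1
      exact Filter.mem_of_superset (Ioc_mem_nhdsGT ht1) fun r hr => ⟨ht0.trans hr.1.le, hr.2⟩
    filter_upwards [hct, Ioc_mem_nhdsGT ht1] with r hr hr'
    have h3 := hVd (γ t) (mem_of_mem_nhds hV) (γ r) hr
    rw [hγ t ⟨ht0, ht1.le⟩, hγ r ⟨ht0.trans hr'.1.le, hr'.2⟩] at h3
    calc edist (γ 0) (γ r) ≤ edist (γ 0) (γ t) + edist (γ t) (γ r) := edist_triangle _ _ _
      _ ≤ 2 * ℓ t + 2 * ∫⁻ r in Ioc t r, ‖g r‖ₑ :=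
        add_le_add htS (h3.trans (by gcongr; exact hUed t r ht0 hr'.1.le hr'.2))
      _ = 2 * ℓ r := by rw [hadd t r ht0 hr'.1.le hr'.2, mul_add]
  have h01 := key (right_mem_Icc.2 zero_le_one)
  have e0 : γ 0 = p := hι.isClosedEmbedding.injective ((hγ 0 (by simp)).trans hp.symm)
  have e1 : γ 1 = q := hι.isClosedEmbedding.injective ((hγ 1 (by simp)).trans hq.symm)
  rwa [hS, mem_ofPred_eq, e0, e1] at h01

end Riemannian

/-! ### Smooth approximation of `W^{1,2}` maps in `L¹`. -/

section Mollification

open ContinuousLinearMap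

/-- Tonelli, translation invariance and the unit mass of the kernel. -/
theorem lintegral_enorm_convolution_le {n : ℕ} {F : Type*} [NormedAddCommGroup F]
    [NormedSpace ℝ F] (φ : ContDiffBump (0 : Euc n)) {g : Euc n → F}
    (hg : AEStronglyMeasurable g) :
    ∫⁻ x, ‖convolution (φ.normed volume) g (lsmul ℝ ℝ) volume x‖ₑ ≤ ∫⁻ x, ‖g x‖ₑ := by
  have hφ : Measurable fun t => ‖φ.normed volume t‖ₑ := φ.continuous_normed.measurable.enorm
  have hone : ∫⁻ t, ‖φ.normed volume t‖ₑ = 1 := by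
    rw [← ofReal_integral_norm_eq_lintegral_enorm φ.integrable_normed]
    have : ∀ t, ‖φ.normed volume t‖ = φ.normed volume t := fun t =>
      Real.norm_of_nonneg (φ.nonneg_normed t)
    simp_rw [this, φ.integral_normed, ENNReal.ofReal_one]
  calc ∫⁻ x, ‖convolution (φ.normed volume) g (lsmul ℝ ℝ) volume x‖ₑ
      ≤ ∫⁻ x, ∫⁻ t, ‖φ.normed volume t‖ₑ * ‖g (x - t)‖ₑ := by
        refine lintegral_mono fun x => (enorm_integral_le_lintegral_enorm _).trans_eq ?_
        simp [enorm_smul]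
    _ = ∫⁻ t, ∫⁻ x, ‖φ.normed volume t‖ₑ * ‖g (x - t)‖ₑ := by
        apply lintegral_lintegral_swap
        have h1 : AEStronglyMeasurable (fun p : Euc n × Euc n => g (p.1 - p.2))
            (volume.prod volume) := hg.comp_quasiMeasurePreserving
              (quasiMeasurePreserving_sub_of_right_invariant volume volume)
        exact (hφ.comp measurable_snd).aemeasurable.mul h1.enorm
    _ = ∫⁻ t, ‖φ.normed volume t‖ₑ * ∫⁻ x, ‖g x‖ₑ := by
        refine lintegral_congr fun t => ?_
        rw [lintegral_const_mul' _ _ (by simp), lintegral_sub_right_eq_self (fun x => ‖g x‖ₑ) t]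
    _ = ∫⁻ x, ‖g x‖ₑ := by rw [lintegral_mul_const _ hφ, hone, one_mul]

/-- Replace `g` by a compactly supported continuous function, use its uniform continuity, and
control the rest by the `L¹` contraction. The threshold `δ` works for every bump of smaller radius,
so one bump can serve a map and its derivative together. -/
theorem exists_lintegral_enorm_convolution_sub_le {n : ℕ} {F : Type*} [NormedAddCommGroup F]
    [NormedSpace ℝ F] [CompleteSpace F] {g : Euc n → F} (hg : Integrable g) {ε : ℝ≥0∞}
    (hε : ε ≠ 0) : ∃ δ > 0, ∀ φ : ContDiffBump (0 : Euc n), φ.rOut < δ →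
      ∫⁻ x, ‖convolution (φ.normed volume) g (lsmul ℝ ℝ) volume x - g x‖ₑ ≤ ε := by
  have hε3 : ε / 3 ≠ 0 := by simp [hε]
  obtain ⟨k, hkc, hk, hkcont, hki⟩ := hg.exists_hasCompactSupport_lintegral_sub_le hε3
  set K := cthickening 1 (tsupport k) with hK
  have hKc : IsCompact K := hkc.isCompact.cthickening
  obtain ⟨η, hη, hηK⟩ : ∃ η : ℝ, 0 < η ∧ ENNReal.ofReal η * volume K ≤ ε / 3 := by
    obtain ⟨η', h0, h1⟩ := ENNReal.exists_nnreal_pos_mul_lt (hKc.measure_lt_top (μ := volume)).ne hε3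
    exact ⟨η', h0, by simpa using h1.le⟩
  obtain ⟨δ, hδ, hδk⟩ := Metric.uniformContinuous_iff.1
    (hkc.uniformContinuous_of_continuous hkcont) η hη
  refine ⟨min δ 1, by positivity, fun φ hφ => ?_⟩
  have hmid : ∀ x, ‖convolution (φ.normed volume) k (lsmul ℝ ℝ) volume x - k x‖ₑ ≤
      K.indicator (fun _ => ENNReal.ofReal η) x := by
    intro x
    by_cases hx : x ∈ K
    · rw [indicator_of_mem hx, ← ofReal_norm, ← dist_eq_norm]
      refine ENNReal.ofReal_le_ofReal (φ.dist_normed_convolution_le hkcont.aestronglyMeasurable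
        fun y hy => (hδk ?_).le)
      exact (mem_ball.1 hy).trans (hφ.trans_le (min_le_left _ _))
    · have hz : ∀ y ∈ ball x φ.rOut, k y = k x := by
        have hx0 : ∀ y ∈ ball x φ.rOut, k y = 0 := by
          intro y hy
          by_contra hne
          refine hx (mem_cthickening_of_dist_le x y 1 _ (subset_tsupport k hne) ?_)
          rw [dist_comm]
          exact ((mem_ball.1 hy).trans (hφ.trans_le (min_le_right _ _))).le
        intro y hy
        rw [hx0 y hy, hx0 x (mem_ball_self φ.rOut_pos)]
      rw [φ.normed_convolution_eq_right hz]
      simp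
  have hci : ∀ f : Euc n → F, LocallyIntegrable f volume → ConvolutionExists (φ.normed volume) f
      (lsmul ℝ ℝ) volume := fun f hf =>
    φ.hasCompactSupport_normed.convolutionExists_left _ φ.continuous_normed hf
  have hsplit : ∀ x, convolution (φ.normed volume) g (lsmul ℝ ℝ) volume x - g x =
      convolution (φ.normed volume) (g - k) (lsmul ℝ ℝ) volume x +
        (convolution (φ.normed volume) k (lsmul ℝ ℝ) volume x - k x) + (k x - g x) := by
    intro x
    have h := congrFun ((hci (g - k) (hg.sub hki).locallyIntegrable).distrib_add
      (hci k hki.locallyIntegrable)) x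
    rw [sub_add_cancel, Pi.add_apply] at h
    rw [h]
    abel
  calc ∫⁻ x, ‖convolution (φ.normed volume) g (lsmul ℝ ℝ) volume x - g x‖ₑ
      ≤ ∫⁻ x, (‖convolution (φ.normed volume) (g - k) (lsmul ℝ ℝ) volume x‖ₑ +
          K.indicator (fun _ => ENNReal.ofReal η) x + ‖g x - k x‖ₑ) := by
        refine lintegral_mono fun x => ?_
        rw [hsplit x, enorm_sub_rev (g x)]
        refine (enorm_add_le _ _).trans (add_le_add_left ((enorm_add_le _ _).trans ?_) _)
        exact add_le_add_right (hmid x) _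
    _ = (∫⁻ x, ‖convolution (φ.normed volume) (g - k) (lsmul ℝ ℝ) volume x‖ₑ) +
          (∫⁻ x, K.indicator (fun _ => ENNReal.ofReal η) x) + ∫⁻ x, ‖g x - k x‖ₑ := by
        have hm : Measurable (K.indicator (fun _ : Euc n => ENNReal.ofReal η)) :=
          measurable_const.indicator isClosed_cthickening.measurableSet
        rw [lintegral_add_right' _ (show AEMeasurable (fun x => ‖g x - k x‖ₑ) volume from
          (hg.sub hki).aestronglyMeasurable.enorm),
          lintegral_add_right _ hm]
    _ ≤ ε / 3 + ε / 3 + ε / 3 := by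
        gcongr
        · exact (lintegral_enorm_convolution_le φ (hg.sub hki).aestronglyMeasurable).trans hk
        · rwa [lintegral_indicator isClosed_cthickening.measurableSet, setLIntegral_const]
    _ = ε := ENNReal.add_thirds ε

theorem sum_coord_smul_stdVec {n : ℕ} (v : Euc n) : ∑ i, v i • stdVec (n := n) i = v := by
  simpa [stdVec] using (EuclideanSpace.basisFun (Fin n) ℝ).sum_repr v

theorem clm_eq_sum_smulRight {n L : ℕ} (A : Euc n →L[ℝ] Euc L) :
    A = ∑ i, (EuclideanSpace.proj (𝕜 := ℝ) i : Euc n →L[ℝ] ℝ).smulRight (A (stdVec i)) := by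
  refine ContinuousLinearMap.ext fun v => ?_
  conv_lhs => rw [← sum_coord_smul_stdVec v]
  rw [map_sum, _root_.sum_apply]
  refine Finset.sum_congr rfl fun i _ => ?_
  rw [map_smul]
  rfl

theorem memLp_univ_sum {α E ι : Type*} [MeasurableSpace α] [NormedAddCommGroup E] [Fintype ι]
    {p : ℝ≥0∞} {μ : Measure α} {f : ι → α → E} (hf : ∀ i, MemLp (f i) p μ) :
    MemLp (fun x => ∑ i, f i x) p μ :=
  memLp_finsetSum _ fun i _ => hf i

theorem memLp_proj_smulRight {n L : ℕ} {μ : Measure (Euc n)} {p : ℝ≥0∞} {g : Euc n → Euc L}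
    (i : Fin n) (h : MemLp g p μ) :
    MemLp (fun x => (EuclideanSpace.proj (𝕜 := ℝ) i : Euc n →L[ℝ] ℝ).smulRight (g x)) p μ :=
  (smulRightL ℝ (Euc n) (Euc L) (EuclideanSpace.proj i)).comp_memLp' h

theorem IsW12.memLp_fun {n L : ℕ} {Ω : Set (Euc n)} {u : Euc n → Euc L}
    {D : Euc n → Euc n →L[ℝ] Euc L} (h : IsW12 Ω u D) : MemLp D 2 (volume.restrict Ω) := by
  rw [show D = _ from funext fun x => clm_eq_sum_smulRight (D x)]
  exact memLp_univ_sum (f := fun i x =>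
    (EuclideanSpace.proj (𝕜 := ℝ) i : Euc n →L[ℝ] ℝ).smulRight (D x (stdVec i)))
    fun i => memLp_proj_smulRight i (h.memLp_deriv (stdVec i))

theorem IsW12.congr {n L : ℕ} {Ω : Set (Euc n)} {u u' : Euc n → Euc L}
    {D D' : Euc n → Euc n →L[ℝ] Euc L} (h : IsW12 Ω u D) (hu : u =ᵐ[volume.restrict Ω] u')
    (hD : D =ᵐ[volume.restrict Ω] D') : IsW12 Ω u' D' where
  memLp := (memLp_congr_ae hu).1 h.memLp
  memLp_deriv v := (memLp_congr_ae (hD.mono fun x hx => by simp only [hx])).1 (h.memLp_deriv v)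
  weak φ h1 h2 h3 v := by
    rw [integral_congr_ae (g := fun x => fderiv ℝ φ x v • u x)
      (hu.mono fun x hx => by simp only [hx]),
      integral_congr_ae (μ := volume.restrict Ω) (f := fun x => φ x • D' x v)
        (g := fun x => φ x • D x v) (hD.mono fun x hx => by simp only [hx])]
    exact h.weak φ h1 h2 h3 v

theorem convolution_normed_apply {n : ℕ} {E F : Type*} [NormedAddCommGroup E] [NormedSpace ℝ E]
    [NormedAddCommGroup F] [NormedSpace ℝ F] [CompleteSpace F] (φ : ContDiffBump (0 : Euc n))
    {g : Euc n → E →L[ℝ] F} (hg : Integrable g) (x : Euc n) (v : E) :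
    convolution (φ.normed volume) g (lsmul ℝ ℝ) volume x v =
      ∫ t, φ.normed volume (x - t) • g t v := by
  have hce : ConvolutionExistsAt (φ.normed volume) g x (lsmul ℝ ℝ) volume :=
    φ.hasCompactSupport_normed.convolutionExists_left _ φ.continuous_normed
      hg.locallyIntegrable x
  rw [convolution_eq_swap, ContinuousLinearMap.integral_apply hce.integrable_swap]
  rfl

theorem fderiv_convolution_normed_apply {n : ℕ} {F : Type*} [NormedAddCommGroup F]
    [NormedSpace ℝ F] [CompleteSpace F] (φ : ContDiffBump (0 : Euc n)) {g : Euc n → F}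
    (hg : Integrable g) (x v : Euc n) :
    fderiv ℝ (convolution (φ.normed volume) g (lsmul ℝ ℝ) volume) x v =
      -∫ t, fderiv ℝ (fun t => φ.normed volume (x - t)) t v • g t := by
  have hφs : ContDiff ℝ ∞ (φ.normed volume) := φ.contDiff_normed
  have hce : ConvolutionExistsAt (fderiv ℝ (φ.normed volume)) g x
      (precompL (Euc n) (lsmul ℝ ℝ)) volume :=
    (φ.hasCompactSupport_normed.fderiv ℝ).convolutionExists_left _
      (hφs.continuous_fderiv (by simp)) hg.locallyIntegrable x
  rw [(φ.hasCompactSupport_normed (μ := volume)).hasFDerivAt_convolution_left (lsmul ℝ ℝ)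
    (hφs.of_le (by simp)) hg.locallyIntegrable x |>.fderiv, convolution_eq_swap,
    ContinuousLinearMap.integral_apply hce.integrable_swap, ← integral_neg]
  refine integral_congr_ae (.of_forall fun t => ?_)
  have h0 : HasFDerivAt (φ.normed volume) (fderiv ℝ (φ.normed volume) (x - t)) (x - t) :=
    (hφs.differentiable (by simp) _).hasFDerivAt
  have h1 : fderiv ℝ (fun t => φ.normed volume (x - t)) t v =
      -fderiv ℝ (φ.normed volume) (x - t) v := by
    have := (h0.comp t ((hasFDerivAt_id t).const_sub x)).fderiv
    simp only [Function.comp_def] at this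
    rw [this]
    simp
  simp only [h1, neg_smul, neg_neg]
  rfl

/-- The weak equation is tested with `t ↦ φ(x - t)`, which is supported in the large ball because
the kernel has radius less than `R - r`. -/
theorem IsW12.fderiv_convolution {n L : ℕ} {R r : ℝ} {u : Euc n → Euc L}
    {D : Euc n → Euc n →L[ℝ] Euc L} (h : IsW12 (ball 0 R) u D)
    (hu : Integrable ((ball (0 : Euc n) R).indicator u))
    (hD : Integrable ((ball (0 : Euc n) R).indicator D)) (φ : ContDiffBump (0 : Euc n))
    (hφ : φ.rOut < R - r) {x : Euc n} (hx : x ∈ ball 0 r) :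
    fderiv ℝ (convolution (φ.normed volume) ((ball 0 R).indicator u) (lsmul ℝ ℝ) volume) x =
      convolution (φ.normed volume) ((ball 0 R).indicator D) (lsmul ℝ ℝ) volume x := by
  have hφs : ContDiff ℝ ∞ (φ.normed volume) := φ.contDiff_normed
  refine ContinuousLinearMap.ext fun v => ?_
  rw [convolution_normed_apply φ hD, fderiv_convolution_normed_apply φ hu]
  set ψ : Euc n → ℝ := fun t => φ.normed volume (x - t) with hψ
  have hψsupp : tsupport ψ ⊆ closedBall x φ.rOut := by
    refine closure_minimal (fun t ht => ?_) isClosed_closedBall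
    have : x - t ∈ Function.support (φ.normed volume) := ht
    rw [φ.support_normed_eq, mem_ball_zero_iff] at this
    rw [mem_closedBall, dist_eq_norm, norm_sub_rev]
    exact this.le
  have hw := h.weak ψ (hφs.comp (contDiff_const.sub contDiff_id))
    (HasCompactSupport.of_support_subset_isCompact (isCompact_closedBall x φ.rOut)
      (subset_closure.trans hψsupp))
    (hψsupp.trans fun t ht => by
      rw [mem_closedBall, dist_eq_norm] at ht
      rw [mem_ball_zero_iff] at hx ⊢
      have := norm_sub_norm_le t x
      linarith) v
  have e1 : ∀ t, fderiv ℝ ψ t v • (ball (0 : Euc n) R).indicator u t =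
      (ball (0 : Euc n) R).indicator (fun t => fderiv ℝ ψ t v • u t) t := by
    intro t
    by_cases ht : t ∈ ball (0 : Euc n) R
    · rw [indicator_of_mem ht, indicator_of_mem ht]
    · rw [indicator_of_notMem ht, indicator_of_notMem ht, smul_zero]
  have e2 : ∀ t, ψ t • (ball (0 : Euc n) R).indicator D t v =
      (ball (0 : Euc n) R).indicator (fun t => ψ t • D t v) t := by
    intro t
    by_cases ht : t ∈ ball (0 : Euc n) R
    · rw [indicator_of_mem ht, indicator_of_mem ht]
    · rw [indicator_of_notMem ht, indicator_of_notMem ht, zero_apply, smul_zero]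
  rw [integral_congr_ae (.of_forall e1), integral_congr_ae (.of_forall e2),
    integral_indicator measurableSet_ball, integral_indicator measurableSet_ball, hw, neg_neg]

theorem integrable_indicator_ball {n : ℕ} {E : Type*} [NormedAddCommGroup E] {R : ℝ}
    {g : Euc n → E} (hg : MemLp g 2 (volume.restrict (ball 0 R))) :
    Integrable ((ball (0 : Euc n) R).indicator g) := by
  have : IsFiniteMeasure (volume.restrict (ball (0 : Euc n) R)) :=
    ⟨by simpa using measure_ball_lt_top⟩
  have h : IntegrableOn g (ball 0 R) := hg.integrable one_le_two
  exact h.integrable_indicator measurableSet_ball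

/-- Local approximation of `W^{1,2}` functions by smooth functions. -/
theorem IsW12.exists_contDiff_approx {n L : ℕ} {R r : ℝ} {u : Euc n → Euc L}
    {D : Euc n → Euc n →L[ℝ] Euc L} (h : IsW12 (ball 0 R) u D) (hr : r < R) {ε : ℝ≥0∞}
    (hε : ε ≠ 0) : ∃ w : Euc n → Euc L, ContDiff ℝ 1 w ∧
      ∫⁻ x in ball 0 r, ‖w x - u x‖ₑ ≤ ε ∧ ∫⁻ x in ball 0 r, ‖fderiv ℝ w x - D x‖ₑ ≤ ε := by
  have hui := integrable_indicator_ball h.memLp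
  have hDi := integrable_indicator_ball h.memLp_fun
  obtain ⟨δ₁, h1, h1'⟩ := exists_lintegral_enorm_convolution_sub_le hui hε
  obtain ⟨δ₂, h2, h2'⟩ := exists_lintegral_enorm_convolution_sub_le hDi hε
  obtain ⟨φ, hφ1, hφ2, hφ3⟩ : ∃ φ : ContDiffBump (0 : Euc n),
      φ.rOut < δ₁ ∧ φ.rOut < δ₂ ∧ φ.rOut < R - r := by
    have h3 := sub_pos.2 hr
    obtain ⟨δ, hδ, hδ'⟩ := exists_between (lt_min (lt_min h1 h2) h3)
    rw [lt_min_iff, lt_min_iff] at hδ'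
    exact ⟨⟨δ / 2, δ, by positivity, by linarith⟩, hδ'.1.1, hδ'.1.2, hδ'.2⟩
  have hφs : ContDiff ℝ ∞ (φ.normed volume) := φ.contDiff_normed
  have hsub : ball (0 : Euc n) r ⊆ ball 0 R := ball_subset_ball hr.le
  refine ⟨convolution (φ.normed volume) ((ball 0 R).indicator u) (lsmul ℝ ℝ) volume,
    φ.hasCompactSupport_normed.contDiff_convolution_left (n := 1) _ (hφs.of_le (by simp))
      hui.locallyIntegrable, ?_, ?_⟩
  · refine (setLIntegral_mono' measurableSet_ball fun x hx => ?_).trans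
      ((setLIntegral_le_lintegral (ball 0 r) _).trans (h1' φ hφ1))
    rw [indicator_of_mem (hsub hx)]
  · refine (setLIntegral_mono' measurableSet_ball fun x hx => ?_).trans
      ((setLIntegral_le_lintegral (ball 0 r) _).trans (h2' φ hφ2))
    rw [indicator_of_mem (hsub hx), h.fderiv_convolution hui hDi φ hφ3 hx]

end Mollification

/-! ### Absolute continuity along almost every segment. -/

section Segments

theorem stronglyMeasurable_apply_segment {n L : ℕ} {D : Euc n → Euc n →L[ℝ] Euc L}
    (hD : StronglyMeasurable D) {A : Euc n → Euc n} (hA : Continuous A) :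
    StronglyMeasurable fun p : Euc n × ℝ => D (p.1 + p.2 • A p.1) (A p.1) := by
  have h1 : Continuous fun p : Euc n × ℝ => p.1 + p.2 • A p.1 := by fun_prop
  have h2 : Continuous fun p : Euc n × ℝ => A p.1 := by fun_prop
  exact isBoundedBilinearMap_apply.continuous.comp_stronglyMeasurable
    ((hD.comp_measurable h1.measurable).prodMk h2.stronglyMeasurable)

theorem sq_lintegral_Icc_le {g : ℝ → ℝ≥0∞} (hg : AEMeasurable g (volume.restrict (Icc 0 1))) :
    (∫⁻ t in Icc (0 : ℝ) 1, g t) ^ 2 ≤ ∫⁻ t in Icc (0 : ℝ) 1, g t ^ 2 := by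
  have h := ENNReal.lintegral_mul_le_Lp_mul_Lq (volume.restrict (Icc (0 : ℝ) 1))
    (p := 2) (q := 2) ⟨by norm_num, by norm_num, by norm_num⟩ hg
    (aemeasurable_const (b := (1 : ℝ≥0∞)))
  simp only [Pi.mul_apply, mul_one, ENNReal.one_rpow, lintegral_const, Measure.restrict_apply_univ,
    Real.volume_Icc, sub_zero, ENNReal.ofReal_one] at h
  calc (∫⁻ t in Icc (0 : ℝ) 1, g t) ^ 2
      ≤ ((∫⁻ t in Icc (0 : ℝ) 1, g t ^ (2 : ℝ)) ^ (1 / 2 : ℝ)) ^ 2 := by gcongr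
    _ = ∫⁻ t in Icc (0 : ℝ) 1, g t ^ 2 := by
      rw [← ENNReal.rpow_natCast, ← ENNReal.rpow_mul]
      norm_num

/-- A family of segments `t ↦ x + t A(x)`, `x ∈ S`, along which integrals over `S` are controlled
by integrals over the ball of radius `r`. -/
structure IsSegmentFamily {n : ℕ} (A : Euc n → Euc n) (S : Set (Euc n)) (r : ℝ) (C : ℝ≥0∞) :
    Prop where
  continuous : Continuous A
  measurableSet : MeasurableSet S
  bounded : ∃ M : ℝ, ∀ x ∈ S, ‖A x‖ ≤ M
  ne_top : C ≠ ⊤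
  lintegral_le : ∀ t ∈ Icc (0 : ℝ) 1, ∀ g : Euc n → ℝ≥0∞, Measurable g →
    ∫⁻ x in S, g (x + t • A x) ≤ C * ∫⁻ x in ball 0 r, g x

variable {n L : ℕ} {R r : ℝ} {u : Euc n → Euc L} {D : Euc n → Euc n →L[ℝ] Euc L}
  {A : Euc n → Euc n} {S : Set (Euc n)} {C : ℝ≥0∞}

/-- By Tonelli and the sweeping bound, the total integral of `‖D‖` over all segments is finite,
hence so is almost every single one. -/
theorem IsW12.ae_integrable_segment (h : IsW12 (ball 0 R) u D) (hD : StronglyMeasurable D)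
    (hr : r < R) (hA : IsSegmentFamily A S r C) :
    ∀ᵐ x ∂volume.restrict S,
      IntegrableOn (fun t : ℝ => D (x + t • A x) (A x)) (Icc 0 1) := by
  have : IsFiniteMeasure (volume.restrict (ball (0 : Euc n) r)) :=
    ⟨by simpa using measure_ball_lt_top⟩
  obtain ⟨M, hM⟩ := hA.bounded
  have hDi : ∫⁻ x in ball 0 r, ‖D x‖ₑ < ⊤ :=
    ((h.memLp_fun.mono_measure (Measure.restrict_mono (ball_subset_ball hr.le) le_rfl)).integrable
      one_le_two).2
  have hA' := hA.continuous
  have hmeas : Measurable fun p : Euc n × ℝ => ‖D (p.1 + p.2 • A p.1)‖ₑ :=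
    (hD.comp_measurable (show Continuous fun p : Euc n × ℝ => p.1 + p.2 • A p.1 by
      fun_prop).measurable).enorm
  have hfin : ∫⁻ x in S, ∫⁻ t in Icc (0 : ℝ) 1, ‖D (x + t • A x)‖ₑ < ⊤ := by
    rw [lintegral_lintegral_swap hmeas.aemeasurable]
    calc ∫⁻ t in Icc (0 : ℝ) 1, ∫⁻ x in S, ‖D (x + t • A x)‖ₑ
        ≤ ∫⁻ t in Icc (0 : ℝ) 1, C * ∫⁻ x in ball 0 r, ‖D x‖ₑ :=
          setLIntegral_mono' measurableSet_Icc fun t ht =>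
            hA.lintegral_le t ht (fun x => ‖D x‖ₑ) hD.enorm
      _ < ⊤ := by simpa using ENNReal.mul_lt_top hA.ne_top.lt_top hDi
  filter_upwards [ae_lt_top' hmeas.lintegral_prod_right'.aemeasurable hfin.ne,
    ae_restrict_mem hA.measurableSet] with x hx hxS
  refine ⟨((stronglyMeasurable_apply_segment hD hA').comp_measurable
    (measurable_const.prodMk measurable_id)).aestronglyMeasurable, ?_⟩
  calc ∫⁻ t in Icc (0 : ℝ) 1, ‖D (x + t • A x) (A x)‖ₑ
      ≤ ∫⁻ t in Icc (0 : ℝ) 1, ‖D (x + t • A x)‖ₑ * ‖A x‖ₑ :=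
        lintegral_mono fun t => ContinuousLinearMap.le_opENorm _ _
    _ = (∫⁻ t in Icc (0 : ℝ) 1, ‖D (x + t • A x)‖ₑ) * ‖A x‖ₑ :=
        lintegral_mul_const' _ _ enorm_ne_top
    _ < ⊤ := ENNReal.mul_lt_top hx enorm_lt_top

/-- The fundamental theorem of calculus for the smooth map `w` leaves three error terms, each of
which has a small integral over `x` when `w` approximates `u` in `W^{1,1}`. -/
theorem enorm_segment_sub_le {w : Euc n → Euc L} (hw : ContDiff ℝ 1 w) (x a : Euc n) {M : ℝ}
    (hM : ‖a‖ ≤ M) (hi : IntegrableOn (fun t : ℝ => D (x + t • a) a) (Icc 0 1)) {t : ℝ}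
    (ht : t ∈ Icc (0 : ℝ) 1) :
    ‖u (x + t • a) - (u x + ∫ s in (0 : ℝ)..t, D (x + s • a) a)‖ₑ ≤
      ‖w (x + t • a) - u (x + t • a)‖ₑ + ‖w x - u x‖ₑ +
        ENNReal.ofReal M * ∫⁻ s in Icc (0 : ℝ) 1, ‖fderiv ℝ w (x + s • a) - D (x + s • a)‖ₑ := by
  have hcont : Continuous fun s : ℝ => fderiv ℝ w (x + s • a) a := by
    have := hw.continuous_fderiv (by simp)
    fun_prop
  have hftc : ∫ s in (0 : ℝ)..t, fderiv ℝ w (x + s • a) a = w (x + t • a) - w x := by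
    have hd : ∀ s : ℝ, HasDerivAt (fun s : ℝ => w (x + s • a)) (fderiv ℝ w (x + s • a) a) s := by
      intro s
      have h1 : HasDerivAt (fun s : ℝ => x + s • a) a s := by
        simpa using ((hasDerivAt_id s).smul_const a).const_add x
      exact ((hw.differentiable (by simp) _).hasFDerivAt).comp_hasDerivAt s h1
    have := intervalIntegral.integral_eq_sub_of_hasDerivAt (fun s _ => hd s)
      (hcont.intervalIntegrable 0 t)
    simpa using this
  have hDi : IntervalIntegrable (fun t : ℝ => D (x + t • a) a) volume 0 t := by
    rw [intervalIntegrable_iff_integrableOn_Icc_of_le ht.1]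
    exact hi.mono_set (Icc_subset_Icc_right ht.2)
  have hsub : u (x + t • a) - (u x + ∫ s in (0 : ℝ)..t, D (x + s • a) a) =
      -(w (x + t • a) - u (x + t • a)) + (w x - u x) +
        ∫ s in (0 : ℝ)..t, (fderiv ℝ w (x + s • a) - D (x + s • a)) a := by
    simp only [_root_.sub_apply]
    rw [intervalIntegral.integral_sub (hcont.intervalIntegrable 0 t) hDi, hftc]
    abel
  rw [hsub]
  refine (enorm_add_le _ _).trans (add_le_add ((enorm_add_le _ _).trans (by rw [enorm_neg])) ?_)
  rw [intervalIntegral.integral_of_le ht.1]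
  refine (enorm_integral_le_lintegral_enorm _).trans ?_
  calc ∫⁻ s in Ioc 0 t, ‖(fderiv ℝ w (x + s • a) - D (x + s • a)) a‖ₑ
      ≤ ∫⁻ s in Icc (0 : ℝ) 1, ‖(fderiv ℝ w (x + s • a) - D (x + s • a)) a‖ₑ :=
        lintegral_mono_set (Ioc_subset_Icc_self.trans (Icc_subset_Icc_right ht.2))
    _ ≤ ∫⁻ s in Icc (0 : ℝ) 1, ENNReal.ofReal M * ‖fderiv ℝ w (x + s • a) - D (x + s • a)‖ₑ := by
        refine lintegral_mono fun s => (ContinuousLinearMap.le_opENorm _ _).trans ?_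
        rw [mul_comm]
        gcongr
        rw [← ofReal_norm]
        exact ENNReal.ofReal_le_ofReal hM
    _ = _ := lintegral_const_mul' _ _ ENNReal.ofReal_ne_top

/-- Along almost every segment, a `W^{1,2}` function is the primitive of its derivative. -/
theorem IsW12.ae_eq_segment (h : IsW12 (ball 0 R) u D) (hu : StronglyMeasurable u)
    (hD : StronglyMeasurable D) (hr : r < R) (hA : IsSegmentFamily A S r C) {t : ℝ}
    (ht : t ∈ Icc (0 : ℝ) 1) :
    ∀ᵐ x ∂volume.restrict S,
      u (x + t • A x) = u x + ∫ s in (0 : ℝ)..t, D (x + s • A x) (A x) := by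
  obtain ⟨M, hM⟩ := hA.bounded
  have hA' := hA.continuous
  choose w hw hw1 hw2 using fun k : ℕ =>
    h.exists_contDiff_approx hr (ε := ((k : ℝ≥0∞) + 1)⁻¹) (by simp)
  set e : ℕ → Euc n → ℝ≥0∞ := fun k x => ‖w k (x + t • A x) - u (x + t • A x)‖ₑ +
    ‖w k x - u x‖ₑ + ENNReal.ofReal M *
      ∫⁻ s in Icc (0 : ℝ) 1, ‖fderiv ℝ (w k) (x + s • A x) - D (x + s • A x)‖ₑ with he
  have hm1 : ∀ k, Measurable fun x => ‖w k x - u x‖ₑ := fun k =>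
    ((hw k).continuous.stronglyMeasurable.sub hu).enorm
  have hm2 : ∀ k, Measurable fun x => ‖fderiv ℝ (w k) x - D x‖ₑ := fun k =>
    (((hw k).continuous_fderiv (by simp)).stronglyMeasurable.sub hD).enorm
  have hseg : Continuous fun x => x + t • A x := by fun_prop
  have hseg2 : Continuous fun p : Euc n × ℝ => p.1 + p.2 • A p.1 := by fun_prop
  have hm1' : ∀ k, Measurable fun x => ‖w k (x + t • A x) - u (x + t • A x)‖ₑ := fun k =>
    (hm1 k).comp hseg.measurable
  have hm3 : ∀ k, Measurable fun p : Euc n × ℝ =>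
      ‖fderiv ℝ (w k) (p.1 + p.2 • A p.1) - D (p.1 + p.2 • A p.1)‖ₑ := fun k =>
    (hm2 k).comp hseg2.measurable
  have hm4 : ∀ k, Measurable fun x =>
      ∫⁻ s in Icc (0 : ℝ) 1, ‖fderiv ℝ (w k) (x + s • A x) - D (x + s • A x)‖ₑ := fun k =>
    (hm3 k).lintegral_prod_right'
  have hem : ∀ k, Measurable (e k) := fun k =>
    ((hm1' k).add (hm1 k)).add ((hm4 k).const_mul _)
  have hint : ∀ k, ∫⁻ x in S, e k x ≤ (C + C + ENNReal.ofReal M * C) * ((k : ℝ≥0∞) + 1)⁻¹ := by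
    intro k
    rw [he]
    simp only
    rw [lintegral_add_right _ ((hm4 k).const_mul _), lintegral_add_right _ (hm1 k),
      lintegral_const_mul _ (hm4 k), add_mul, add_mul, mul_assoc (ENNReal.ofReal M)]
    refine add_le_add (add_le_add ?_ ?_) (mul_le_mul_right ?_ _)
    · exact (hA.lintegral_le t ht _ (hm1 k)).trans (by gcongr; exact hw1 k)
    · have := hA.lintegral_le 0 (by simp) _ (hm1 k)
      simp only [zero_smul, add_zero] at this
      exact this.trans (by gcongr; exact hw1 k)
    · rw [lintegral_lintegral_swap (hm3 k).aemeasurable]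
      calc ∫⁻ s in Icc (0 : ℝ) 1, ∫⁻ x in S,
            ‖fderiv ℝ (w k) (x + s • A x) - D (x + s • A x)‖ₑ
          ≤ ∫⁻ s in Icc (0 : ℝ) 1, C * ((k : ℝ≥0∞) + 1)⁻¹ :=
            setLIntegral_mono' measurableSet_Icc fun s hs =>
              (hA.lintegral_le s hs _ (hm2 k)).trans (by gcongr; exact hw2 k)
        _ = C * ((k : ℝ≥0∞) + 1)⁻¹ := by simp
  -- The infimum of the errors suffices, so no almost everywhere convergent subsequence is needed.
  have hinf : ∫⁻ x in S, ⨅ k, e k x = 0 := by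
    have hK : C + C + ENNReal.ofReal M * C ≠ ⊤ := by
      have := hA.ne_top
      finiteness
    have hlim : Filter.Tendsto (fun k : ℕ => (C + C + ENNReal.ofReal M * C) *
        ((k : ℝ≥0∞) + 1)⁻¹) Filter.atTop (𝓝 0) := by
      have h0 : Filter.Tendsto (fun k : ℕ => ((k : ℝ≥0∞) + 1)⁻¹) Filter.atTop (𝓝 0) := by
        have := (Filter.tendsto_add_atTop_iff_nat 1).2 ENNReal.tendsto_inv_nat_nhds_zero
        simpa using this
      simpa using ENNReal.Tendsto.const_mul h0 (Or.inr hK)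
    refine le_antisymm (ge_of_tendsto' hlim fun k => ?_) zero_le
    exact (lintegral_mono fun x => iInf_le _ k).trans (hint k)
  have hz := (lintegral_eq_zero_iff (Measurable.iInf hem)).1 hinf
  filter_upwards [hz, h.ae_integrable_segment hD hr hA, ae_restrict_mem hA.measurableSet]
    with x hx hxi hxS
  have : ‖u (x + t • A x) - (u x + ∫ s in (0 : ℝ)..t, D (x + s • A x) (A x))‖ₑ ≤ 0 := by
    rw [← show (⨅ k, e k x) = 0 from hx]
    exact le_iInf fun k => enorm_segment_sub_le (hw k) x (A x) (hM x hxS) hxi ht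
  exact sub_eq_zero.1 (enorm_eq_zero.1 (le_antisymm this zero_le))

variable {m : ℕ} {N : Type*} [EMetricSpace N] [ChartedSpace (Euc m) N] [IsManifold (𝓡 m) ∞ N]
  [RiemannianBundle (fun p : N => TangentSpace (𝓡 m) p)] [IsRiemannianManifold (𝓡 m) N]
  {ι : N → Euc L} {f : Euc n → N}

/-- The exceptional null set depends on the time, so the primitive is identified with `u` only at
rational times. The primitive is continuous and `ι(N)` is closed, so it takes values in `ι(N)` at
all times. -/
theorem IsW12.ae_edist_le (hι : IsIsometricEmbedding (m := m) ι)
    (h : IsW12 (ball 0 R) (ι ∘ f) D) (hu : StronglyMeasurable (ι ∘ f))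
    (hD : StronglyMeasurable D) (hr : r < R) (hA : IsSegmentFamily A S r C) :
    ∀ᵐ x ∂volume.restrict S,
      edist (f x) (f (x + A x)) ≤ 2 * ∫⁻ t in Icc (0 : ℝ) 1, ‖D (x + t • A x) (A x)‖ₑ := by
  have hq : ∀ᵐ x ∂volume.restrict S, ∀ q : ℚ, (q : ℝ) ∈ Icc (0 : ℝ) 1 →
      (ι ∘ f) (x + (q : ℝ) • A x) =
        (ι ∘ f) x + ∫ s in (0 : ℝ)..q, D (x + s • A x) (A x) := by
    rw [ae_all_iff]
    intro q
    by_cases hq : (q : ℝ) ∈ Icc (0 : ℝ) 1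
    · filter_upwards [h.ae_eq_segment hu hD hr hA hq] with x hx _ using hx
    · exact .of_forall fun x hx => absurd hx hq
  filter_upwards [hq, h.ae_integrable_segment hD hr hA] with x hx hxi
  set U : ℝ → Euc L := fun t => ι (f x) + ∫ s in (0 : ℝ)..t, D (x + s • A x) (A x) with hU
  have hUc : ContinuousOn U (Icc 0 1) := by
    have h := intervalIntegral.continuousOn_primitive_interval (μ := volume) (a := 0) (b := 1)
      (f := fun s => D (x + s • A x) (A x)) (by rwa [uIcc_of_le zero_le_one])
    rw [uIcc_of_le zero_le_one] at h
    exact continuousOn_const.add h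
  have hrange : ∀ t ∈ Icc (0 : ℝ) 1, U t ∈ range ι := by
    have hdense : Icc (0 : ℝ) 1 ⊆ closure (Ioo 0 1 ∩ range ((↑) : ℚ → ℝ)) := by
      rw [← closure_Ioo (zero_ne_one' ℝ)]
      exact closure_minimal (Rat.denseRange_cast.open_subset_closure_inter isOpen_Ioo)
        isClosed_closure
    intro t ht
    have h1 : t ∈ closure (Ioo 0 1 ∩ range ((↑) : ℚ → ℝ)) := hdense ht
    have h2 : ContinuousWithinAt U (Ioo 0 1 ∩ range ((↑) : ℚ → ℝ)) t :=
      (hUc t ht).mono (inter_subset_left.trans Ioo_subset_Icc_self)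
    have h3 := h2.mem_closure_image h1
    refine closure_minimal ?_ hι.isClosedEmbedding.isClosed_range h3
    rintro _ ⟨_, ⟨hs, q, rfl⟩, rfl⟩
    exact ⟨_, hx q (Ioo_subset_Icc_self hs)⟩
  refine hι.edist_le_lintegral (U := U) hxi (fun t _ => by simp [hU]) hrange (by simp [hU]) ?_
  have := hx 1 (by simp)
  simpa [hU] using this

/-- The `L²` distance between `f` and a deformation of `f` along segments is controlled by the
derivative in the direction of these segments. -/
theorem IsW12.lintegral_edist_sq_le (hι : IsIsometricEmbedding (m := m) ι)
    (h : IsW12 (ball 0 R) (ι ∘ f) D) (hu : StronglyMeasurable (ι ∘ f))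
    (hD : StronglyMeasurable D) (hr : r < R) (hA : IsSegmentFamily A S r C) :
    ∫⁻ x in S, edist (f x) (f (x + A x)) ^ 2 ≤
      4 * ∫⁻ t in Icc (0 : ℝ) 1, ∫⁻ x in S, ‖D (x + t • A x) (A x)‖ₑ ^ 2 := by
  have hm : Measurable fun p : Euc n × ℝ => ‖D (p.1 + p.2 • A p.1) (A p.1)‖ₑ :=
    (stronglyMeasurable_apply_segment hD hA.continuous).enorm
  rw [← lintegral_lintegral_swap (hm.pow_const 2).aemeasurable,
    ← lintegral_const_mul' _ _ (by simp)]
  refine lintegral_mono_ae ?_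
  filter_upwards [h.ae_edist_le hι hu hD hr hA] with x hx
  calc edist (f x) (f (x + A x)) ^ 2
      ≤ (2 * ∫⁻ t in Icc (0 : ℝ) 1, ‖D (x + t • A x) (A x)‖ₑ) ^ 2 := by gcongr
    _ = 4 * (∫⁻ t in Icc (0 : ℝ) 1, ‖D (x + t • A x) (A x)‖ₑ) ^ 2 := by
        rw [mul_pow]; norm_num
    _ ≤ _ := by
        gcongr
        exact sq_lintegral_Icc_le (hm.comp (measurable_const.prodMk measurable_id)).aemeasurable

end Segments

/-! ### Orthogonal projections attached to a subset of an orthonormal basis. -/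

section Projection

variable {n : ℕ} (b : OrthonormalBasis (Fin n) ℝ (Euc n)) (I : Finset (Fin n))

/-- The orthogonal projection onto the span of the basis vectors `b i`, `i ∈ I`. -/
def coordProj : Euc n →L[ℝ] Euc n := ∑ i ∈ I, (innerSL ℝ (b i)).smulRight (b i)

/-- The orthogonal projection onto the span of the basis vectors `b i`, `i ∉ I`. -/
def coordCoproj : Euc n →L[ℝ] Euc n := ContinuousLinearMap.id ℝ (Euc n) - coordProj b I

theorem coordProj_apply (x : Euc n) : coordProj b I x = ∑ i ∈ I, inner ℝ (b i) x • b i := by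
  simp [coordProj, _root_.sum_apply]

theorem coordCoproj_apply (x : Euc n) : coordCoproj b I x = x - coordProj b I x := rfl

theorem coordProj_add_coordCoproj (x : Euc n) : coordProj b I x + coordCoproj b I x = x := by
  rw [coordCoproj_apply, add_sub_cancel]

theorem coordProj_basis (i : Fin n) : coordProj b I (b i) = if i ∈ I then b i else 0 := by
  rw [coordProj_apply]
  simp [orthonormal_iff_ite.1 b.orthonormal, ite_smul, Finset.sum_ite_eq']

theorem coordProj_eq_self {x : Euc n} (hx : x ∈ Submodule.span ℝ (b '' (I : Set (Fin n)))) :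
    coordProj b I x = x := by
  induction hx using Submodule.span_induction with
  | mem x h =>
    obtain ⟨i, hi, rfl⟩ := h
    rw [coordProj_basis, if_pos (by simpa using hi)]
  | zero => simp
  | add x y _ _ hx hy => rw [map_add, hx, hy]
  | smul a x _ hx => rw [map_smul, hx]

theorem coordProj_mem (x : Euc n) :
    coordProj b I x ∈ Submodule.span ℝ (b '' (I : Set (Fin n))) := by
  rw [coordProj_apply]
  exact Submodule.sum_mem _ fun i hi => Submodule.smul_mem _ _
    (Submodule.subset_span ⟨i, by simpa using hi, rfl⟩)

theorem coordProj_coordProj (x : Euc n) : coordProj b I (coordProj b I x) = coordProj b I x :=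
  coordProj_eq_self b I (coordProj_mem b I x)

theorem coordProj_coordCoproj (x : Euc n) : coordProj b I (coordCoproj b I x) = 0 := by
  rw [coordCoproj_apply, map_sub, coordProj_coordProj, sub_self]

theorem coordCoproj_coordProj (x : Euc n) : coordCoproj b I (coordProj b I x) = 0 := by
  rw [coordCoproj_apply, coordProj_coordProj, sub_self]

theorem coordCoproj_coordCoproj (x : Euc n) :
    coordCoproj b I (coordCoproj b I x) = coordCoproj b I x := by
  rw [coordCoproj_apply, coordProj_coordCoproj, sub_zero]

theorem finrank_span_basis_image :
    Module.finrank ℝ (Submodule.span ℝ (b '' (I : Set (Fin n)))) = I.card := by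
  have h : LinearIndependent ℝ fun i : I => b i :=
    b.orthonormal.linearIndependent.comp _ Subtype.val_injective
  have := finrank_span_eq_card h
  rw [Fintype.card_coe] at this
  rwa [image_eq_range]

theorem inner_coordProj_coordCoproj (x : Euc n) :
    inner ℝ (coordProj b I x) (coordCoproj b I x) = 0 := by
  have h : ∀ i ∈ I, inner ℝ (b i) (coordCoproj b I x) = 0 := by
    intro i hi
    rw [coordCoproj_apply, inner_sub_right, coordProj_apply, inner_sum]
    simp [inner_smul_right, orthonormal_iff_ite.1 b.orthonormal, hi]
  rw [coordProj_apply, sum_inner]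
  exact Finset.sum_eq_zero fun i hi => by rw [inner_smul_left, h i hi, mul_zero]

theorem norm_sq_eq_coordProj (x : Euc n) :
    ‖x‖ ^ 2 = ‖coordProj b I x‖ ^ 2 + ‖coordCoproj b I x‖ ^ 2 := by
  have h := norm_add_sq_eq_norm_sq_add_norm_sq_of_inner_eq_zero (coordProj b I x)
    (coordCoproj b I x) (inner_coordProj_coordCoproj b I x)
  rw [coordProj_add_coordCoproj] at h
  nlinarith [h]

theorem norm_coordProj_le (x : Euc n) : ‖coordProj b I x‖ ≤ ‖x‖ := by
  have := norm_sq_eq_coordProj b I x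
  exact (sq_le_sq₀ (norm_nonneg _) (norm_nonneg _)).1
    (by nlinarith [sq_nonneg ‖coordCoproj b I x‖])

theorem norm_coordCoproj_le (x : Euc n) : ‖coordCoproj b I x‖ ≤ ‖x‖ := by
  have := norm_sq_eq_coordProj b I x
  exact (sq_le_sq₀ (norm_nonneg _) (norm_nonneg _)).1
    (by nlinarith [sq_nonneg ‖coordProj b I x‖])

theorem det_id_add_smul_coordCoproj (c : ℝ) :
    LinearMap.det ((LinearMap.id : Euc n →ₗ[ℝ] Euc n) + c • (coordCoproj b I).toLinearMap) =
      (1 + c) ^ (Iᶜ).card := by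
  have h : LinearMap.toMatrix b.toBasis b.toBasis
      ((LinearMap.id : Euc n →ₗ[ℝ] Euc n) + c • (coordCoproj b I).toLinearMap) =
      Matrix.diagonal fun i => if i ∈ I then 1 else 1 + c := by
    ext i j
    rw [LinearMap.toMatrix_apply]
    by_cases hj : j ∈ I
    · simp [coordCoproj_apply, coordProj_basis, hj, Matrix.diagonal_apply]
      aesop
    · simp [coordCoproj_apply, coordProj_basis, hj, Matrix.diagonal_apply]
      aesop
  rw [← LinearMap.det_toMatrix b.toBasis, h, Matrix.det_diagonal, Finset.prod_ite]
  simp [Finset.filter_notMem_eq_sdiff, Finset.compl_eq_univ_sdiff]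

theorem lintegral_comp_id_add_smul_coordCoproj {c : ℝ} (hc : 0 < 1 + c) (e : Euc n)
    {g : Euc n → ℝ≥0∞} (hg : Measurable g) :
    ∫⁻ x, g (x + (e + c • coordCoproj b I x)) =
      ENNReal.ofReal (((1 + c) ^ (Iᶜ).card)⁻¹) * ∫⁻ x, g x := by
  set T : Euc n →ₗ[ℝ] Euc n := LinearMap.id + c • (coordCoproj b I).toLinearMap with hT
  have hdet : LinearMap.det T = (1 + c) ^ (Iᶜ).card := det_id_add_smul_coordCoproj b I c
  have hmap := Measure.map_linearMap_addHaar_eq_smul_addHaar (volume : Measure (Euc n)) (f := T)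
    (by rw [hdet]; positivity)
  have hTm : Measurable T := T.continuous_of_finiteDimensional.measurable
  calc ∫⁻ x, g (x + (e + c • coordCoproj b I x)) = ∫⁻ x, g (e + T x) :=
        lintegral_congr fun x => by
          congr 1
          simp only [hT, LinearMap.add_apply, LinearMap.smul_apply, LinearMap.id_apply,
            ContinuousLinearMap.coe_coe]
          abel
    _ = ∫⁻ x, g (e + x) ∂(Measure.map T volume) :=
        (lintegral_map (hg.comp (measurable_const_add e)) hTm).symm
    _ = _ := by
        rw [hmap, lintegral_smul_measure, lintegral_add_left_eq_self, hdet,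
          abs_of_pos (by positivity), smul_eq_mul]

end Projection

/-! ### Comparison of `f` along segments inside a cylinder around the spine. -/

section Cylinder

variable {n : ℕ} (b : OrthonormalBasis (Fin n) ℝ (Euc n)) (I : Finset (Fin n))

/-- The product of the unit ball of the span of `b i`, `i ∈ I`, and of the ball of radius `2` of
the orthogonal complement. -/
def cylinder : Set (Euc n) := {x | ‖coordProj b I x‖ < 1 ∧ ‖coordCoproj b I x‖ < 2}

theorem isOpen_cylinder : IsOpen (cylinder b I) := by
  have h1 : IsOpen {x | ‖coordProj b I x‖ < 1} := isOpen_lt (by fun_prop) continuous_const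
  have h2 : IsOpen {x | ‖coordCoproj b I x‖ < 2} := isOpen_lt (by fun_prop) continuous_const
  exact h1.inter h2

theorem convex_cylinder : Convex ℝ (cylinder b I) := by
  have h1 : Convex ℝ (coordProj b I ⁻¹' ball 0 1) :=
    (convex_ball (0 : Euc n) 1).linear_preimage (coordProj b I).toLinearMap
  have h2 : Convex ℝ (coordCoproj b I ⁻¹' ball 0 2) :=
    (convex_ball (0 : Euc n) 2).linear_preimage (coordCoproj b I).toLinearMap
  have : cylinder b I = coordProj b I ⁻¹' ball 0 1 ∩ coordCoproj b I ⁻¹' ball 0 2 := by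
    ext x
    simp [cylinder]
  rw [this]
  exact h1.inter h2

theorem cylinder_subset_ball : cylinder b I ⊆ ball 0 (5 / 2) := by
  rintro x ⟨h1, h2⟩
  rw [mem_ball_zero_iff]
  have := norm_sq_eq_coordProj b I x
  refine (sq_lt_sq₀ (norm_nonneg _) (by norm_num)).1 ?_
  nlinarith [norm_nonneg (coordProj b I x), norm_nonneg (coordCoproj b I x)]

theorem ball_subset_cylinder : ball 0 1 ⊆ cylinder b I := by
  intro x hx
  rw [mem_ball_zero_iff] at hx
  exact ⟨(norm_coordProj_le b I x).trans_lt hx,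
    (norm_coordCoproj_le b I x).trans_lt (hx.trans one_lt_two)⟩

variable {b I}

theorem segment_mem_cylinder {x a : Euc n} (hx : x ∈ cylinder b I) (hxa : x + a ∈ cylinder b I)
    {t : ℝ} (ht : t ∈ Icc (0 : ℝ) 1) : x + t • a ∈ cylinder b I := by
  have := (convex_cylinder b I).add_smul_sub_mem hx hxa ht
  rwa [add_sub_cancel_left] at this

/-- Convexity keeps the segments in the cylinder. The map `x ↦ x + t(e + βQx)` has Jacobian `(1 +
tβ)^codim`, which is at least `2^(-n)` because `β ≥ -1/2`. -/
theorem isSegmentFamily_cylinder {e : Euc n} {β : ℝ} (hβ : β ∈ Icc (-(1 / 2) : ℝ) 1)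
    {S : Set (Euc n)} (hSm : MeasurableSet S) (hS : S ⊆ cylinder b I)
    (hS' : ∀ x ∈ S, x + (e + β • coordCoproj b I x) ∈ cylinder b I) :
    IsSegmentFamily (fun x => e + β • coordCoproj b I x) S (5 / 2) (2 ^ n) where
  continuous := by fun_prop
  measurableSet := hSm
  bounded := by
    refine ⟨‖e‖ + 2, fun x hx => (norm_add_le _ _).trans ?_⟩
    rw [norm_smul, Real.norm_eq_abs]
    have h1 : |β| ≤ 1 := abs_le.2 ⟨by linarith [hβ.1], hβ.2⟩
    have h2 := (hS hx).2.le
    have h3 : |β| * ‖coordCoproj b I x‖ ≤ 1 * 2 := by gcongr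
    linarith
  ne_top := by finiteness
  lintegral_le := by
    intro t ht g hg
    have hc : (1 / 2 : ℝ) ≤ 1 + t * β := by nlinarith [hβ.1, hβ.2, ht.1, ht.2]
    calc ∫⁻ x in S, g (x + t • (e + β • coordCoproj b I x))
        ≤ ∫⁻ x in S, (ball (0 : Euc n) (5 / 2)).indicator g
            (x + (t • e + (t * β) • coordCoproj b I x)) := by
          refine setLIntegral_mono' hSm fun x hx => ?_
          have h1 := cylinder_subset_ball b I (segment_mem_cylinder (hS hx) (hS' x hx) ht)
          have h2 : x + t • (e + β • coordCoproj b I x) =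
              x + (t • e + (t * β) • coordCoproj b I x) := by rw [smul_add, smul_smul]
          rw [← h2, indicator_of_mem h1]
      _ ≤ ∫⁻ x, (ball (0 : Euc n) (5 / 2)).indicator g
            (x + (t • e + (t * β) • coordCoproj b I x)) := setLIntegral_le_lintegral _ _
      _ = ENNReal.ofReal (((1 + t * β) ^ (Iᶜ).card)⁻¹) * ∫⁻ x in ball 0 (5 / 2), g x := by
          rw [lintegral_comp_id_add_smul_coordCoproj b I (by linarith) _
            (hg.indicator measurableSet_ball), lintegral_indicator measurableSet_ball]
      _ ≤ 2 ^ n * ∫⁻ x in ball 0 (5 / 2), g x := by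
          gcongr
          have : ((1 + t * β) ^ (Iᶜ).card)⁻¹ ≤ (2 : ℝ) ^ n := by
            rw [← inv_pow]
            calc ((1 + t * β)⁻¹) ^ (Iᶜ).card ≤ 2 ^ (Iᶜ).card := by
                  have : (1 + t * β)⁻¹ ≤ 2 := by
                    rw [inv_le_comm₀ (by linarith) two_pos]
                    linarith
                  have : 0 ≤ (1 + t * β)⁻¹ := by positivity
                  gcongr
              _ ≤ 2 ^ n := by
                  refine pow_le_pow_right₀ one_le_two ?_
                  simpa using Finset.card_le_univ (Iᶜ)
          refine (ENNReal.ofReal_le_ofReal this).trans_eq ?_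
          rw [ENNReal.ofReal_pow zero_le_two, ENNReal.ofReal_ofNat]

variable (b I) in
/-- The part of the energy density which comes from the radial direction and from the directions
`b i`, `i ∈ I`. -/
def dirEnergy {L : ℕ} (D : Euc n → Euc n →L[ℝ] Euc L) (z : Euc n) : ℝ :=
  ‖D z z‖ ^ 2 + ∑ i ∈ I, ‖D z (b i)‖ ^ 2

/-- Since `Pe = e`, the vector `e + κQz` equals `κz` plus a combination of the `b i`, `i ∈ I`, so
only the derivatives counted in `dirEnergy` enter. All coefficients are at most 5, and
Cauchy–Schwarz is applied to at most `n + 1` terms. -/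
theorem norm_apply_sq_le_dirEnergy {L : ℕ} (D : Euc n → Euc n →L[ℝ] Euc L) {z e : Euc n}
    (hz : ‖z‖ ≤ 3) (he : ‖e‖ ≤ 2) (hPe : coordProj b I e = e) {κ : ℝ} (hκ : |κ| ≤ 1) :
    ‖D z (e + κ • coordCoproj b I z)‖ ^ 2 ≤ 25 * (n + 1) * dirEnergy b I D z := by
  have hexp : e + κ • coordCoproj b I z = κ • z + ∑ i ∈ I, inner ℝ (b i) (e - κ • z) • b i := by
    rw [← coordProj_apply, map_sub, map_smul, hPe, coordCoproj_apply, smul_sub]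
    abel
  have hcoef : ∀ i ∈ I, |inner ℝ (b i) (e - κ • z)| ≤ 5 := by
    intro i _
    have h1 := abs_real_inner_le_norm (b i) (e - κ • z)
    rw [b.norm_eq_one, one_mul] at h1
    have h2 := norm_sub_le e (κ • z)
    rw [norm_smul, Real.norm_eq_abs] at h2
    have h3 : |κ| * ‖z‖ ≤ 1 * 3 := by gcongr
    linarith
  have h1 : ‖D z (e + κ • coordCoproj b I z)‖ ≤ 5 * (‖D z z‖ + ∑ i ∈ I, ‖D z (b i)‖) := by
    rw [hexp, map_add, map_sum, map_smul, mul_add, Finset.mul_sum]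
    refine (norm_add_le _ _).trans (add_le_add ?_ ((norm_sum_le _ _).trans ?_))
    · rw [norm_smul, Real.norm_eq_abs]
      gcongr
      linarith
    · refine Finset.sum_le_sum fun i hi => ?_
      rw [map_smul, norm_smul, Real.norm_eq_abs]
      gcongr
      exact hcoef i hi
  have h2 : (‖D z z‖ + ∑ i ∈ I, ‖D z (b i)‖) ^ 2 ≤ (n + 1) * dirEnergy b I D z := by
    have h := sq_sum_le_card_mul_sum_sq (s := Finset.insertNone I)
      (f := fun o => Option.elim o ‖D z z‖ fun i => ‖D z (b i)‖)
    simp only [Finset.sum_insertNone, Option.elim_none, Option.elim_some,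
      Finset.card_insertNone] at h
    refine h.trans ?_
    rw [dirEnergy]
    have : (I.card : ℝ) ≤ n := by
      exact_mod_cast (Finset.card_le_univ I).trans_eq (Fintype.card_fin n)
    push_cast
    gcongr
  calc ‖D z (e + κ • coordCoproj b I z)‖ ^ 2
      ≤ (5 * (‖D z z‖ + ∑ i ∈ I, ‖D z (b i)‖)) ^ 2 := by gcongr
    _ = 25 * (‖D z z‖ + ∑ i ∈ I, ‖D z (b i)‖) ^ 2 := by ring
    _ ≤ 25 * ((n + 1) * dirEnergy b I D z) := by gcongr
    _ = _ := by ring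

theorem measurable_dirEnergy {L : ℕ} {D : Euc n → Euc n →L[ℝ] Euc L} (hD : StronglyMeasurable D) :
    Measurable (dirEnergy b I D) := by
  have h1 : Measurable fun z => ‖D z z‖ :=
    (isBoundedBilinearMap_apply.continuous.comp_stronglyMeasurable
      (hD.prodMk stronglyMeasurable_id)).norm.measurable
  have h2 : ∀ i, Measurable fun z => ‖D z (b i)‖ := fun i =>
    (isBoundedBilinearMap_apply.continuous.comp_stronglyMeasurable
      (hD.prodMk stronglyMeasurable_const)).norm.measurable
  exact (h1.pow_const 2).add (Finset.measurable_sum _ fun i _ => (h2 i).pow_const 2)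

variable {m L : ℕ} {N : Type*} [EMetricSpace N] [ChartedSpace (Euc m) N] [IsManifold (𝓡 m) ∞ N]
  [RiemannianBundle (fun p : N => TangentSpace (𝓡 m) p)] [IsRiemannianManifold (𝓡 m) N]
  {ι : N → Euc L} {f : Euc n → N} {D : Euc n → Euc n →L[ℝ] Euc L} {S : Set (Euc n)}

/-- At a point `z` of the segment, `Qz = (1 + tβ)Qx`, so the direction `e + βQx` is `e + κQz` with
`κ = β/(1 + tβ)`; the range of `β` ensures `|κ| ≤ 1`. The factor 100 is the square of the length
constant 2 times 25. -/
theorem lintegral_edist_sq_le_dirEnergy (hι : IsIsometricEmbedding (m := m) ι)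
    (h : IsW12 (ball 0 3) (ι ∘ f) D) (hu : StronglyMeasurable (ι ∘ f))
    (hD : StronglyMeasurable D) {e : Euc n} (he : ‖e‖ ≤ 2) (hPe : coordProj b I e = e)
    {β : ℝ} (hβ : β ∈ Icc (-(1 / 2) : ℝ) 1) (hSm : MeasurableSet S) (hS : S ⊆ cylinder b I)
    (hS' : ∀ x ∈ S, x + (e + β • coordCoproj b I x) ∈ cylinder b I) :
    ∫⁻ x in S, edist (f x) (f (x + (e + β • coordCoproj b I x))) ^ 2 ≤
      100 * (n + 1) * 2 ^ n * ∫⁻ z in ball 0 3, ENNReal.ofReal (dirEnergy b I D z) := by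
  have hA := isSegmentFamily_cylinder hβ hSm hS hS'
  refine (h.lintegral_edist_sq_le hι hu hD (by norm_num) hA).trans ?_
  have hψ := (measurable_dirEnergy (b := b) (I := I) hD).ennreal_ofReal
  have hQe : coordCoproj b I e = 0 := by rw [coordCoproj_apply, hPe, sub_self]
  have key : ∀ t ∈ Icc (0 : ℝ) 1, ∫⁻ x in S, ‖D (x + t • (e + β • coordCoproj b I x))
      (e + β • coordCoproj b I x)‖ₑ ^ 2 ≤
      25 * (n + 1) * (2 ^ n * ∫⁻ z in ball 0 3, ENNReal.ofReal (dirEnergy b I D z)) := by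
    intro t ht
    have hc : (1 / 2 : ℝ) ≤ 1 + t * β := by nlinarith [hβ.1, hβ.2, ht.1, ht.2]
    calc ∫⁻ x in S, ‖D (x + t • (e + β • coordCoproj b I x)) (e + β • coordCoproj b I x)‖ₑ ^ 2
        ≤ ∫⁻ x in S, 25 * (n + 1) * ENNReal.ofReal
            (dirEnergy b I D (x + t • (e + β • coordCoproj b I x))) := by
          refine setLIntegral_mono' hSm fun x hx => ?_
          set z := x + t • (e + β • coordCoproj b I x) with hz
          have hz3 : ‖z‖ ≤ 3 := by
            have := cylinder_subset_ball b I (segment_mem_cylinder (hS hx) (hS' x hx) ht)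
            rw [mem_ball_zero_iff] at this
            linarith
          have hQz : coordCoproj b I z = (1 + t * β) • coordCoproj b I x := by
            rw [hz, map_add, map_smul, map_add, hQe, map_smul, coordCoproj_coordCoproj, zero_add,
              smul_smul, add_smul, one_smul]
          have hκ : |β / (1 + t * β)| ≤ 1 := by
            rw [abs_div, abs_of_pos (show 0 < 1 + t * β by linarith),
              div_le_one (by linarith), abs_le]
            constructor <;> nlinarith [hβ.1, hβ.2, ht.1, ht.2]
          have hβQ : e + β • coordCoproj b I x = e + (β / (1 + t * β)) • coordCoproj b I z := by
            rw [hQz, smul_smul, div_mul_cancel₀ _ (by linarith)]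
          have h1 := norm_apply_sq_le_dirEnergy D hz3 he hPe hκ
          rw [← hβQ] at h1
          rw [← ofReal_norm, ← ENNReal.ofReal_pow (norm_nonneg _)]
          refine (ENNReal.ofReal_le_ofReal h1).trans_eq ?_
          rw [ENNReal.ofReal_mul (by positivity), ENNReal.ofReal_mul (by norm_num),
            ENNReal.ofReal_add (by positivity) zero_le_one]
          simp
      _ = 25 * (n + 1) * ∫⁻ x in S, ENNReal.ofReal
            (dirEnergy b I D (x + t • (e + β • coordCoproj b I x))) := by
          rw [lintegral_const_mul' _ _ (by finiteness)]
      _ ≤ 25 * (n + 1) * (2 ^ n * ∫⁻ z in ball 0 (5 / 2), ENNReal.ofReal (dirEnergy b I D z)) := by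
          gcongr
          exact hA.lintegral_le t ht _ hψ
      _ ≤ _ := by
          gcongr
          norm_num
  calc 4 * ∫⁻ t in Icc (0 : ℝ) 1, ∫⁻ x in S, ‖D (x + t • (e + β • coordCoproj b I x))
        (e + β • coordCoproj b I x)‖ₑ ^ 2
      ≤ 4 * ∫⁻ t in Icc (0 : ℝ) 1,
        25 * (n + 1) * (2 ^ n * ∫⁻ z in ball 0 3, ENNReal.ofReal (dirEnergy b I D z)) := by
        gcongr 4 * ?_
        exact setLIntegral_mono' measurableSet_Icc key
    _ = _ := by
        rw [setLIntegral_const, Real.volume_Icc]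
        simp only [sub_zero, ENNReal.ofReal_one, mul_one]
        ring

end Cylinder

/-! ### Choice of a good slice. -/

section Averaging

/-- Substitute `ρ = t‖w‖`: for `1 ≤ ‖w‖ < 2` the Jacobian is below 3 and `t` stays in `(1/2, 2)`. At
`w = 0` both integrands are constant. -/
theorem lintegral_normalize_le {n : ℕ} {w : Euc n} (hw : w = 0 ∨ 1 ≤ ‖w‖) (hw2 : ‖w‖ < 2)
    {φ : Euc n → ℝ≥0∞} (hφ : Measurable φ) :
    ∫⁻ ρ in Ioo (1 : ℝ) 2, φ ((ρ / ‖w‖) • w) ≤ 3 * ∫⁻ t in Ioo (1 / 2 : ℝ) 2, φ (t • w) := by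
  rcases hw with rfl | hw
  · simp only [smul_zero, lintegral_const, Measure.restrict_apply_univ, Real.volume_Ioo]
    rw [mul_left_comm]
    gcongr
    rw [show (3 : ℝ≥0∞) = ENNReal.ofReal 3 by simp, ← ENNReal.ofReal_mul (by norm_num)]
    exact ENNReal.ofReal_le_ofReal (by norm_num)
  · set a := ‖w‖ with ha
    have ha0 : 0 < a := by linarith
    set F : ℝ → ℝ≥0∞ := (Ioo (1 : ℝ) 2).indicator fun ρ => φ ((ρ / a) • w) with hF
    have hFm : Measurable F := by
      refine Measurable.indicator (hφ.comp ?_) measurableSet_Ioo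
      fun_prop
    have hsub : ∫⁻ t, F (a * t) = ENNReal.ofReal a⁻¹ * ∫⁻ ρ, F ρ := by
      rw [← lintegral_map hFm (measurable_const_mul a), Real.map_volume_mul_left ha0.ne',
        lintegral_smul_measure, abs_of_pos (inv_pos.2 ha0), smul_eq_mul]
    calc ∫⁻ ρ in Ioo (1 : ℝ) 2, φ ((ρ / a) • w) = ∫⁻ ρ, F ρ :=
          (lintegral_indicator measurableSet_Ioo _).symm
      _ = ENNReal.ofReal a * ∫⁻ t, F (a * t) := by
          rw [hsub, ← mul_assoc, ← ENNReal.ofReal_mul ha0.le, mul_inv_cancel₀ ha0.ne',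
            ENNReal.ofReal_one, one_mul]
      _ ≤ 3 * ∫⁻ t, (Ioo (1 / 2 : ℝ) 2).indicator (fun t => φ (t • w)) t := by
          refine mul_le_mul' ?_ (lintegral_mono fun t => ?_)
          · rw [show (3 : ℝ≥0∞) = ENNReal.ofReal 3 by simp]
            exact ENNReal.ofReal_le_ofReal (by linarith)
          · by_cases ht : a * t ∈ Ioo (1 : ℝ) 2
            · have ht0 : 0 < t := by
                by_contra! h
                nlinarith [ht.1]
              have ht' : t ∈ Ioo (1 / 2 : ℝ) 2 := ⟨by nlinarith [ht.1], by nlinarith [ht.2]⟩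
              rw [hF, indicator_of_mem ht, indicator_of_mem ht', mul_div_cancel_left₀ _ ha0.ne']
            · rw [hF, indicator_of_notMem ht]
              exact zero_le
      _ = _ := by rw [lintegral_indicator measurableSet_Ioo]

theorem setLIntegral_ball_le_add {n : ℕ} {x : Euc n} (hx : ‖x‖ < 3) (ψ : Euc n → ℝ≥0∞) :
    ∫⁻ y in ball 0 1, ψ y ≤ ∫⁻ e in ball 0 4, ψ (x + e) := by
  rw [← lintegral_indicator measurableSet_ball, ← lintegral_indicator measurableSet_ball,
    ← lintegral_add_left_eq_self _ x]
  refine lintegral_mono fun e => ?_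
  by_cases he : x + e ∈ ball (0 : Euc n) 1
  · have he' : e ∈ ball (0 : Euc n) 4 := by
      rw [mem_ball_zero_iff] at he ⊢
      have := norm_sub_le (x + e) x
      rw [add_sub_cancel_left] at this
      linarith
    simp [he, he']
  · simp [he]

variable {n : ℕ} (b : OrthonormalBasis (Fin n) ℝ (Euc n)) (I : Finset (Fin n))

/-- The part of the cylinder at distance at least `2⁻ˡ` from the span of `b i`, `i ∈ I`
(all of it if this span is the whole space). -/
def cylinderShell (l : ℕ) : Set (Euc n) :=
  cylinder b I ∩ {x | coordCoproj b I x = 0 ∨ (2⁻¹ : ℝ) ^ l ≤ ‖coordCoproj b I x‖}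

theorem measurableSet_cylinderShell (l : ℕ) : MeasurableSet (cylinderShell b I l) := by
  have h1 : IsClosed {x | coordCoproj b I x = 0} :=
    isClosed_eq (by fun_prop) continuous_const
  have h2 : IsClosed {x | (2⁻¹ : ℝ) ^ l ≤ ‖coordCoproj b I x‖} :=
    isClosed_le continuous_const (by fun_prop)
  exact (isOpen_cylinder b I).measurableSet.inter (h1.union h2).measurableSet

/-- The map which sends `x` to the point of the orbit of `x` under dilations and under translations
by the span of `b i`, `i ∈ I`, which is at distance `ρ` from this span and projects to `v`. -/
def slicePoint (v : Euc n) (ρ : ℝ) (x : Euc n) : Euc n :=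
  v + (ρ / ‖coordCoproj b I x‖) • coordCoproj b I x

theorem measurable_slicePoint :
    Measurable fun q : (Euc n × ℝ) × Euc n => slicePoint b I q.1.1 q.1.2 q.2 := by
  unfold slicePoint
  have : Measurable fun x : Euc n => coordCoproj b I x := (coordCoproj b I).measurable
  fun_prop

/-- Average over all slices `(v, ρ)`. The substitutions `v = x + e` and `ρ = t|Qx|` turn the slice
point into `x + (Pe + (t - 1)Qx)`, a displacement of the type handled by the hypothesis. The
constant collects `3 · 3/2 ≤ 5` and the volume ratio `4^n` of the balls of radii 4 and 1. -/
theorem exists_slice_lintegral_le_of_forall {G : Euc n → Euc n → ℝ≥0∞}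
    (hGm : Measurable fun q : Euc n × Euc n => G q.1 q.2) {K : ℝ≥0∞}
    (hK : ∀ e : Euc n, ∀ t ∈ Ioo (1 / 2 : ℝ) 2, ∫⁻ x in cylinderShell b I 0,
      G x (x + (coordProj b I e + (t - 1) • coordCoproj b I x)) ≤ K) :
    ∃ v ∈ ball (0 : Euc n) 1, ∃ ρ ∈ Ioo (1 : ℝ) 2,
      ∫⁻ x in cylinderShell b I 0, G x (slicePoint b I (coordProj b I v) ρ x) ≤
        5 * 4 ^ n * K := by
  set M := cylinderShell b I 0 with hM
  have hMm : MeasurableSet M := measurableSet_cylinderShell b I 0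
  have hPm : Measurable fun x : Euc n => coordProj b I x := (coordProj b I).measurable
  have hQm : Measurable fun x : Euc n => coordCoproj b I x := (coordCoproj b I).measurable
  set T : Set (Euc n × ℝ) := ball 0 1 ×ˢ Ioo (1 : ℝ) 2 with hT
  have hTm : MeasurableSet T := measurableSet_ball.prod measurableSet_Ioo
  set Φ : Euc n × ℝ → ℝ≥0∞ := fun p => ∫⁻ x in M, G x (slicePoint b I (coordProj b I p.1) p.2 x)
    with hΦ
  have hjoint : Measurable fun q : (Euc n × ℝ) × Euc n =>
      G q.2 (slicePoint b I (coordProj b I q.1.1) q.1.2 q.2) := by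
    have h1 : Measurable fun q : (Euc n × ℝ) × Euc n =>
        ((coordProj b I q.1.1, q.1.2), q.2) := by fun_prop
    exact hGm.comp (measurable_snd.prodMk ((measurable_slicePoint b I).comp h1))
  have hΦm : Measurable Φ := hjoint.lintegral_prod_right'
  have hmain : ∫⁻ p in T, Φ p ≤ 5 * volume (ball (0 : Euc n) 4) * K := by
    set T' : Set (Euc n × ℝ) := ball 0 4 ×ˢ Ioo (1 / 2 : ℝ) 2 with hT'
    have hT'm : MeasurableSet T' := measurableSet_ball.prod measurableSet_Ioo
    have hTr : (volume : Measure (Euc n × ℝ)).restrict T =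
        (volume.restrict (ball 0 1)).prod (volume.restrict (Ioo 1 2)) := by
      rw [hT, Measure.volume_eq_prod, Measure.prod_restrict]
    have hT'r : (volume : Measure (Euc n × ℝ)).restrict T' =
        (volume.restrict (ball 0 4)).prod (volume.restrict (Ioo (1 / 2) 2)) := by
      rw [hT', Measure.volume_eq_prod, Measure.prod_restrict]
    have hA : Measurable fun q : (Euc n × ℝ) × Euc n => q.2 +
        (coordProj b I q.1.1 + (q.1.2 - 1) • coordCoproj b I q.2) := by
      have h1 : Measurable fun q : (Euc n × ℝ) × Euc n => coordProj b I q.1.1 :=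
        hPm.comp (measurable_fst.comp measurable_fst)
      have h2 : Measurable fun q : (Euc n × ℝ) × Euc n => coordCoproj b I q.2 :=
        hQm.comp measurable_snd
      fun_prop
    have hjoint' : Measurable fun q : (Euc n × ℝ) × Euc n => G q.2 (q.2 +
        (coordProj b I q.1.1 + (q.1.2 - 1) • coordCoproj b I q.2)) :=
      hGm.comp (measurable_snd.prodMk hA)
    have hpt : ∀ x ∈ M, ∫⁻ p in T, G x (slicePoint b I (coordProj b I p.1) p.2 x) ≤
        3 * ∫⁻ p in T', G x (x + (coordProj b I p.1 + (p.2 - 1) • coordCoproj b I x)) := by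
      intro x hx
      have hGx : Measurable (G x) := hGm.comp (measurable_const.prodMk measurable_id)
      have hm1 : Measurable fun p : Euc n × ℝ =>
          G x (slicePoint b I (coordProj b I p.1) p.2 x) :=
        hjoint.comp (measurable_id.prodMk measurable_const)
      have hm2 : Measurable fun p : Euc n × ℝ =>
          G x (x + (coordProj b I p.1 + (p.2 - 1) • coordCoproj b I x)) :=
        hjoint'.comp (measurable_id.prodMk measurable_const)
      have hx3 : ‖x‖ < 3 := by
        have := cylinder_subset_ball b I hx.1
        rw [mem_ball_zero_iff] at this
        linarith
      rw [hTr, hT'r, lintegral_prod _ hm1.aemeasurable, lintegral_prod _ hm2.aemeasurable]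
      calc ∫⁻ v in ball 0 1, ∫⁻ ρ in Ioo (1 : ℝ) 2, G x (slicePoint b I (coordProj b I v) ρ x)
          ≤ ∫⁻ v in ball 0 1, 3 * ∫⁻ t in Ioo (1 / 2 : ℝ) 2,
              G x (coordProj b I v + t • coordCoproj b I x) := by
            refine lintegral_mono fun v => ?_
            exact lintegral_normalize_le (φ := fun w => G x (coordProj b I v + w))
              (by simpa using hx.2) hx.1.2 (hGx.comp (measurable_const_add _))
        _ = 3 * ∫⁻ v in ball 0 1, ∫⁻ t in Ioo (1 / 2 : ℝ) 2,
              G x (coordProj b I v + t • coordCoproj b I x) :=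
            lintegral_const_mul' _ _ (by simp)
        _ ≤ 3 * ∫⁻ e in ball 0 4, ∫⁻ t in Ioo (1 / 2 : ℝ) 2,
              G x (coordProj b I (x + e) + t • coordCoproj b I x) := by
            gcongr 3 * ?_
            exact setLIntegral_ball_le_add hx3 fun v => ∫⁻ t in Ioo (1 / 2 : ℝ) 2,
              G x (coordProj b I v + t • coordCoproj b I x)
        _ = _ := by
            congr 1
            refine lintegral_congr fun e => lintegral_congr fun t => ?_
            congr 1
            rw [map_add, sub_smul, one_smul]
            nth_rw 3 [← coordProj_add_coordCoproj b I x]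
            abel
    have hinner : ∀ p ∈ T', ∫⁻ x in M,
        G x (x + (coordProj b I p.1 + (p.2 - 1) • coordCoproj b I x)) ≤ K :=
      fun p hp => hK p.1 p.2 hp.2
    calc ∫⁻ p in T, Φ p
        = ∫⁻ x in M, ∫⁻ p in T, G x (slicePoint b I (coordProj b I p.1) p.2 x) :=
          lintegral_lintegral_swap hjoint.aemeasurable
      _ ≤ ∫⁻ x in M, 3 * ∫⁻ p in T',
            G x (x + (coordProj b I p.1 + (p.2 - 1) • coordCoproj b I x)) :=
          setLIntegral_mono' hMm hpt
      _ = 3 * ∫⁻ x in M, ∫⁻ p in T',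
            G x (x + (coordProj b I p.1 + (p.2 - 1) • coordCoproj b I x)) :=
          lintegral_const_mul' _ _ (by simp)
      _ = 3 * ∫⁻ p in T', ∫⁻ x in M,
            G x (x + (coordProj b I p.1 + (p.2 - 1) • coordCoproj b I x)) :=
          congrArg (3 * ·) (lintegral_lintegral_swap hjoint'.aemeasurable).symm
      _ ≤ 3 * ∫⁻ p in T', K := by
          gcongr 3 * ?_
          exact setLIntegral_mono' hT'm hinner
      _ = (3 * ENNReal.ofReal (2 - 1 / 2)) * volume (ball (0 : Euc n) 4) * K := by
          rw [setLIntegral_const, hT', Measure.volume_eq_prod, Measure.prod_prod, Real.volume_Ioo]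
          ring
      _ ≤ 5 * volume (ball (0 : Euc n) 4) * K := by
          gcongr
          rw [show (3 : ℝ≥0∞) = ENNReal.ofReal 3 by simp, ← ENNReal.ofReal_mul (by norm_num),
            show (5 : ℝ≥0∞) = ENNReal.ofReal 5 by simp]
          exact ENNReal.ofReal_le_ofReal (by norm_num)
  have hTvol : volume T = volume (ball (0 : Euc n) 1) := by
    rw [hT, Measure.volume_eq_prod, Measure.prod_prod, Real.volume_Ioo]
    norm_num
  have hB1 : volume (ball (0 : Euc n) 1) ≠ 0 := (measure_ball_pos _ _ one_pos).ne'
  have hB1' : volume (ball (0 : Euc n) 1) ≠ ⊤ := measure_ball_lt_top.ne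
  obtain ⟨⟨v, ρ⟩, ⟨hv, hρ⟩, hle⟩ := exists_le_setLAverage (μ := volume) (s := T) (f := Φ)
    (by rwa [hTvol]) (by rwa [hTvol]) hΦm.aemeasurable
  refine ⟨v, hv, ρ, hρ, ?_⟩
  have hB4 : volume (ball (0 : Euc n) 4) = 4 ^ n * volume (ball (0 : Euc n) 1) := by
    rw [Measure.addHaar_ball_of_pos volume (0 : Euc n) (by norm_num : (0 : ℝ) < 4),
      finrank_euclideanSpace_fin, ENNReal.ofReal_pow (by norm_num), ENNReal.ofReal_ofNat]
  calc ∫⁻ x in M, G x (slicePoint b I (coordProj b I v) ρ x) = Φ (v, ρ) := rfl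
    _ ≤ ⨍⁻ p in T, Φ p ∂volume := hle
    _ = (volume T)⁻¹ * ∫⁻ p in T, Φ p := by
        rw [setLAverage_eq, ENNReal.div_eq_inv_mul]
    _ ≤ (volume (ball (0 : Euc n) 1))⁻¹ * (5 * (4 ^ n * volume (ball (0 : Euc n) 1)) * K) := by
        rw [hTvol, ← hB4]
        gcongr
    _ = ((volume (ball (0 : Euc n) 1))⁻¹ * volume (ball (0 : Euc n) 1)) * (5 * 4 ^ n * K) := by
        ring
    _ = _ := by rw [ENNReal.inv_mul_cancel hB1 hB1', one_mul]


variable {b I} in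
theorem slicePoint_mem_cylinder {v x : Euc n} (hv : v ∈ ball (0 : Euc n) 1) {ρ : ℝ}
    (hρ : ρ ∈ Ioo (1 : ℝ) 2) : slicePoint b I (coordProj b I v) ρ x ∈ cylinder b I := by
  have hP : coordProj b I (slicePoint b I (coordProj b I v) ρ x) = coordProj b I v := by
    rw [slicePoint, map_add, map_smul, coordProj_coordProj, coordProj_coordCoproj,
      smul_zero, add_zero]
  have hQ : coordCoproj b I (slicePoint b I (coordProj b I v) ρ x) =
      (ρ / ‖coordCoproj b I x‖) • coordCoproj b I x := by
    rw [slicePoint, map_add, map_smul, coordCoproj_coordProj, coordCoproj_coordCoproj,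
      zero_add]
  refine ⟨?_, ?_⟩
  · rw [hP]
    exact (norm_coordProj_le b I v).trans_lt (mem_ball_zero_iff.1 hv)
  · rw [hQ, norm_smul, Real.norm_eq_abs, abs_div, abs_norm,
      abs_of_pos (by linarith [hρ.1])]
    by_cases h0 : ‖coordCoproj b I x‖ = 0
    · rw [h0, mul_zero]
      norm_num
    · rw [div_mul_cancel₀ _ h0]
      exact hρ.2

variable {m L : ℕ} {N : Type*} [EMetricSpace N] [ChartedSpace (Euc m) N] [IsManifold (𝓡 m) ∞ N]
  [RiemannianBundle (fun p : N => TangentSpace (𝓡 m) p)] [IsRiemannianManifold (𝓡 m) N]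
  [MeasurableSpace N] [BorelSpace N] [SecondCountableTopology N]
  {ι : N → Euc L} {f : Euc n → N} {D : Euc n → Euc n →L[ℝ] Euc L}

/-- For a suitable slice, the map `f` is `L²`-close to the map which it induces through this slice,
away from the span of `b i`, `i ∈ I`. -/
theorem exists_slice_lintegral_le (hι : IsIsometricEmbedding (m := m) ι)
    (h : IsW12 (ball 0 3) (ι ∘ f) D) (hf : Measurable f) (hD : StronglyMeasurable D) :
    ∃ v ∈ ball (0 : Euc n) 1, ∃ ρ ∈ Ioo (1 : ℝ) 2,
      ∫⁻ x in cylinderShell b I 0, edist (f x) (f (slicePoint b I (coordProj b I v) ρ x)) ^ 2 ≤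
        5 * 4 ^ n * (100 * (n + 1) * 2 ^ n *
          ∫⁻ z in ball 0 3, ENNReal.ofReal (dirEnergy b I D z)) := by
  have hu : StronglyMeasurable (ι ∘ f) :=
    (hι.isClosedEmbedding.continuous.measurable.comp hf).stronglyMeasurable
  set K := 100 * (n + 1) * 2 ^ n * ∫⁻ z in ball 0 3, ENNReal.ofReal (dirEnergy b I D z) with hK
  have hMm : MeasurableSet (cylinderShell b I 0) := measurableSet_cylinderShell b I 0
  -- The indicator drops displacements that leave the cylinder, where the segment estimate is not
  -- available. Slice points lie in the cylinder, so nothing is lost in the end.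
  set G : Euc n → Euc n → ℝ≥0∞ := fun x y =>
    (cylinder b I).indicator (fun y => edist (f x) (f y) ^ 2) y with hG
  have hGm : Measurable fun q : Euc n × Euc n => G q.1 q.2 := by
    have h1 : Measurable fun q : Euc n × Euc n => edist (f q.1) (f q.2) ^ 2 :=
      ((hf.comp measurable_fst).edist (hf.comp measurable_snd)).pow_const 2
    exact h1.indicator ((isOpen_cylinder b I).measurableSet.preimage measurable_snd)
  have hinner : ∀ e : Euc n, ∀ t ∈ Ioo (1 / 2 : ℝ) 2, ∫⁻ x in cylinderShell b I 0,
      G x (x + (coordProj b I e + (t - 1) • coordCoproj b I x)) ≤ K := by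
    intro e t ht
    set S₀ : Set (Euc n) := {x | x + (coordProj b I e + (t - 1) • coordCoproj b I x) ∈
      cylinder b I} with hS₀
    have hS₀m : MeasurableSet S₀ :=
      ((isOpen_cylinder b I).preimage (by fun_prop)).measurableSet
    have heq : ∀ x, G x (x + (coordProj b I e + (t - 1) • coordCoproj b I x)) =
        S₀.indicator (fun x => edist (f x)
          (f (x + (coordProj b I e + (t - 1) • coordCoproj b I x))) ^ 2) x := by
      intro x
      by_cases hx : x ∈ S₀
      · rw [indicator_of_mem hx]
        exact indicator_of_mem (show _ ∈ cylinder b I from hx) _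
      · rw [indicator_of_notMem hx]
        exact indicator_of_notMem (show _ ∉ cylinder b I from hx) _
    simp_rw [heq]
    rw [lintegral_indicator hS₀m, Measure.restrict_restrict hS₀m]
    -- One point that stays in the cylinder before and after the displacement already forces `‖Pe‖ ≤
    -- 2`.
    rcases (S₀ ∩ cylinderShell b I 0).eq_empty_or_nonempty with hemp | ⟨y, hy, hyM⟩
    · simp [hemp]
    · have hPe : ‖coordProj b I e‖ ≤ 2 := by
        have h1 := hy.1
        rw [map_add, map_add, map_smul, coordProj_coordProj, coordProj_coordCoproj, smul_zero,
          add_zero] at h1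
        have h2 := hyM.1.1
        have h3 := norm_sub_le (coordProj b I y + coordProj b I e) (coordProj b I y)
        rw [add_sub_cancel_left] at h3
        linarith
      exact lintegral_edist_sq_le_dirEnergy hι h hu hD hPe (coordProj_coordProj b I e)
        ⟨by linarith [ht.1], by linarith [ht.2]⟩ (hS₀m.inter hMm)
        (fun x hx => hx.2.1) (fun x hx => hx.1)
  obtain ⟨v, hv, ρ, hρ, hle⟩ := exists_slice_lintegral_le_of_forall b I hGm hinner
  refine ⟨v, hv, ρ, hρ, le_trans (le_of_eq ?_) hle⟩
  refine setLIntegral_congr_fun hMm fun x hx => ?_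
  exact (indicator_of_mem (slicePoint_mem_cylinder hv hρ) (fun y => edist (f x) (f y) ^ 2)).symm

end Averaging

/-! ### Small directional energy implies closeness to a homogeneous map. -/

section Homogeneous

/-- The weight `3/2` on the second term matters: multiplied by the Jacobian factor `1/2` of the
doubling map it gives `3/4 < 1`, whereas the symmetric inequality would give 1 in codimension one.
-/
theorem ennreal_add_sq_le (a c : ℝ≥0∞) : (a + c) ^ 2 ≤ 3 * a ^ 2 + 3 / 2 * c ^ 2 := by
  rcases eq_or_ne a ⊤ with rfl | ha
  · simp
  rcases eq_or_ne c ⊤ with rfl | hc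
  · simp [ENNReal.mul_top]
  lift a to NNReal using ha
  lift c to NNReal using hc
  have : (3 / 2 : ℝ≥0∞) = ((3 / 2 : NNReal) : ℝ≥0∞) := by
    rw [ENNReal.coe_div two_ne_zero]; rfl
  rw [this]
  norm_cast
  rw [← NNReal.coe_le_coe]
  push_cast
  nlinarith [sq_nonneg (2 * (a : ℝ) - c)]

variable {n : ℕ} (b : OrthonormalBasis (Fin n) ℝ (Euc n)) (I : Finset (Fin n))

variable {b I} in
theorem slicePoint_add_smul (v : Euc n) (ρ : ℝ) (x y : Euc n) {c : ℝ} (hc : 0 < c)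
    (hy : coordCoproj b I y = c • coordCoproj b I x) :
    slicePoint b I v ρ y = slicePoint b I v ρ x := by
  rw [slicePoint, slicePoint, hy, norm_smul, Real.norm_eq_abs, abs_of_pos hc, smul_smul]
  congr 2
  field_simp

/-- The slice point sees `x` only through the direction of `Qx`, which neither dilations nor
translations along the spine change. -/
theorem isHomogeneousMap_slice {N : Type*} [EMetricSpace N] [MeasurableSpace N] {f : Euc n → N}
    (hf : Measurable f) (v : Euc n) (ρ : ℝ) :
    IsHomogeneousMap I.card fun x => f (slicePoint b I v ρ x) := by
  refine ⟨hf.comp ((measurable_slicePoint b I).comp (measurable_const (a := (v, ρ)) |>.prodMk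
    measurable_id)), _, finrank_span_basis_image b I, fun c z hc => ?_, fun z w hw => ?_⟩
  · exact congrArg f (slicePoint_add_smul v ρ z (c • z) hc (by rw [map_smul]))
  · exact congrArg f (slicePoint_add_smul v ρ z (z + w) one_pos (by
      rw [map_add, coordCoproj_apply b I w, coordProj_eq_self b I hw, sub_self, add_zero,
        one_smul]))

theorem iUnion_cylinderShell : ⋃ l, cylinderShell b I l = cylinder b I := by
  refine subset_antisymm (iUnion_subset fun l => inter_subset_left) fun x hx => ?_
  rw [mem_iUnion]
  by_cases h0 : coordCoproj b I x = 0
  · exact ⟨0, hx, Or.inl h0⟩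
  · obtain ⟨l, hl⟩ := exists_pow_lt_of_lt_one (norm_pos_iff.2 h0) (by norm_num : (2⁻¹ : ℝ) < 1)
    exact ⟨l, hx, Or.inr hl.le⟩

theorem monotone_cylinderShell : Monotone (cylinderShell b I) := by
  intro l k hlk x hx
  refine ⟨hx.1, hx.2.imp id fun h => le_trans ?_ h⟩
  exact pow_le_pow_of_le_one (by norm_num) (by norm_num) hlk

/-- The map `x ↦ x + Qx` doubles the distance to the spine, sends each new shell into the preceding
ones, and has Jacobian at least 2. So the integral over shell `l + 1` is at most `X + 3K` plus `3/4`
of that over shell `l`. It is applied to `F = dist(f, g)` with `g` invariant under this map. -/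
theorem lintegral_cylinder_le_of_forall {F d : Euc n → ℝ≥0∞} (hF : Measurable F)
    (hd : Measurable d)
    (hFd : ∀ x, F x ≤ d x + F (x + coordCoproj b I x)) {K X : ℝ≥0∞}
    (hK : ∀ S : Set (Euc n), MeasurableSet S → S ⊆ cylinder b I →
      (∀ x ∈ S, x + coordCoproj b I x ∈ cylinder b I) → ∫⁻ x in S, d x ^ 2 ≤ K)
    (hX : ∫⁻ x in cylinderShell b I 0, F x ^ 2 ≤ X) :
    ∫⁻ x in cylinder b I, F x ^ 2 ≤ 4 * (X + 3 * K) := by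
  have hQc : Continuous fun x : Euc n => coordCoproj b I x := (coordCoproj b I).continuous
  have hstep : ∀ l, ∫⁻ x in cylinderShell b I (l + 1), F x ^ 2 ≤
      X + (3 * K + 3 / 4 * ∫⁻ x in cylinderShell b I l, F x ^ 2) := by
    intro l
    set S := cylinderShell b I (l + 1) \ cylinderShell b I 0 with hS
    have hSm : MeasurableSet S :=
      (measurableSet_cylinderShell b I _).diff (measurableSet_cylinderShell b I _)
    have hSQ : ∀ x ∈ S, coordCoproj b I x ≠ 0 ∧ ‖coordCoproj b I x‖ < 1 ∧
        (2⁻¹ : ℝ) ^ (l + 1) ≤ ‖coordCoproj b I x‖ ∧ ‖coordProj b I x‖ < 1 := by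
      rintro x ⟨hx, hx'⟩
      have h1 : ¬ (coordCoproj b I x = 0 ∨ (2⁻¹ : ℝ) ^ 0 ≤ ‖coordCoproj b I x‖) :=
        fun h => hx' ⟨hx.1, h⟩
      push Not at h1
      rw [pow_zero] at h1
      exact ⟨h1.1, h1.2, hx.2.resolve_left h1.1, hx.1.1⟩
    have hSmaps : ∀ x ∈ S, x + coordCoproj b I x ∈ cylinderShell b I l := by
      intro x hx
      obtain ⟨-, h1, h2, h3⟩ := hSQ x hx
      have hP : coordProj b I (x + coordCoproj b I x) = coordProj b I x := by
        rw [map_add, coordProj_coordCoproj, add_zero]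
      have hQ : ‖coordCoproj b I (x + coordCoproj b I x)‖ = 2 * ‖coordCoproj b I x‖ := by
        rw [map_add, coordCoproj_coordCoproj, ← two_smul ℝ, norm_smul]
        norm_num
      refine ⟨⟨by rwa [hP], by rw [hQ]; linarith⟩, Or.inr ?_⟩
      rw [hQ]
      rw [pow_succ] at h2
      linarith
    have hSF : ∫⁻ x in S, F (x + coordCoproj b I x) ^ 2 ≤
        2⁻¹ * ∫⁻ x in cylinderShell b I l, F x ^ 2 := by
      rcases S.eq_empty_or_nonempty with hemp | ⟨y, hy⟩
      · simp [hemp]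
      -- If the spine is the whole space, `Q = 0` and `S` is empty; otherwise the Jacobian `2^codim`
      -- is at least 2.
      have hcard : (Iᶜ).card ≠ 0 := by
        intro h0
        rw [Finset.card_eq_zero, Finset.compl_eq_empty_iff] at h0
        refine (hSQ y hy).1 ?_
        rw [coordCoproj_apply, coordProj_apply, h0, b.sum_repr', sub_self]
      set g := (cylinderShell b I l).indicator fun x => F x ^ 2 with hg
      have hgm : Measurable g := (hF.pow_const 2).indicator (measurableSet_cylinderShell b I l)
      calc ∫⁻ x in S, F (x + coordCoproj b I x) ^ 2
          ≤ ∫⁻ x in S, g (x + (0 + (1 : ℝ) • coordCoproj b I x)) := by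
            refine setLIntegral_mono' hSm fun x hx => ?_
            rw [zero_add, one_smul, hg, indicator_of_mem (hSmaps x hx)]
        _ ≤ ∫⁻ x, g (x + (0 + (1 : ℝ) • coordCoproj b I x)) := setLIntegral_le_lintegral _ _
        _ = ENNReal.ofReal (((1 + 1) ^ (Iᶜ).card)⁻¹) * ∫⁻ x in cylinderShell b I l, F x ^ 2 := by
            rw [lintegral_comp_id_add_smul_coordCoproj b I (by norm_num) 0 hgm,
              lintegral_indicator (measurableSet_cylinderShell b I l)]
        _ ≤ _ := by
            gcongr
            rw [← ENNReal.ofReal_ofNat 2, ← ENNReal.ofReal_inv_of_pos two_pos]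
            refine ENNReal.ofReal_le_ofReal (inv_anti₀ two_pos ?_)
            rw [one_add_one_eq_two]
            exact le_self_pow₀ one_le_two hcard
    have hSF' : Measurable fun x => 3 * d x ^ 2 := (hd.pow_const 2).const_mul 3
    have hsub : cylinderShell b I (l + 1) ⊆ cylinderShell b I 0 ∪ S := by
      rw [hS, union_sdiff_self]
      exact subset_union_right
    calc ∫⁻ x in cylinderShell b I (l + 1), F x ^ 2
        ≤ ∫⁻ x in cylinderShell b I 0 ∪ S, F x ^ 2 := lintegral_mono_set hsub
      _ ≤ (∫⁻ x in cylinderShell b I 0, F x ^ 2) + ∫⁻ x in S, F x ^ 2 :=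
          lintegral_union_le _ _ _
      _ ≤ X + ∫⁻ x in S, (3 * d x ^ 2 + 3 / 2 * F (x + coordCoproj b I x) ^ 2) := by
          gcongr with x
          refine le_trans ?_ (ennreal_add_sq_le _ _)
          gcongr
          exact hFd x
      _ = X + (3 * (∫⁻ x in S, d x ^ 2) +
            3 / 2 * ∫⁻ x in S, F (x + coordCoproj b I x) ^ 2) := by
          have h32 : (3 / 2 : ℝ≥0∞) ≠ ⊤ := by finiteness
          rw [lintegral_add_left hSF', lintegral_const_mul' _ _ (by simp),
            lintegral_const_mul' _ _ h32]
      _ ≤ X + (3 * K + 3 / 2 * (2⁻¹ * ∫⁻ x in cylinderShell b I l, F x ^ 2)) := by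
          gcongr
          exact hK S hSm (fun x hx => hx.1.1) fun x hx => (hSmaps x hx).1
      _ = _ := by
          rw [← mul_assoc (3 / 2 : ℝ≥0∞), div_eq_mul_inv, mul_assoc 3,
            ← ENNReal.mul_inv (by simp) (by simp), div_eq_mul_inv]
          norm_num
  -- `4(X + 3K)` is the fixed point of `t ↦ X + 3K + 3t/4`. The induction starts from the hypothesis
  -- on shell 0, so finiteness need not be known beforehand.
  have hall : ∀ l, ∫⁻ x in cylinderShell b I l, F x ^ 2 ≤ 4 * (X + 3 * K) := by
    intro l
    induction l with
    | zero =>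
      calc _ ≤ X := hX
        _ ≤ 1 * (X + 3 * K) := by rw [one_mul]; exact le_self_add
        _ ≤ 4 * (X + 3 * K) := by gcongr; norm_num
    | succ l ih =>
      calc _ ≤ X + (3 * K + 3 / 4 * ∫⁻ x in cylinderShell b I l, F x ^ 2) := hstep l
        _ ≤ X + (3 * K + 3 / 4 * (4 * (X + 3 * K))) := by gcongr
        _ = 4 * (X + 3 * K) := by
          rw [← mul_assoc (3 / 4 : ℝ≥0∞), ENNReal.div_mul_cancel (by simp) (by simp)]
          ring
  rw [← iUnion_cylinderShell, setLIntegral_iUnion_of_directed _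
    (monotone_cylinderShell b I).directed_le]
  exact iSup_le hall

/-- The constant of `exists_isHomogeneousMap_lintegral_le`. -/
def homConst (n : ℕ) : ℝ := 4 * (5 * 4 ^ n + 3) * (100 * (n + 1) * 2 ^ n)

theorem homConst_pos (n : ℕ) : 0 < homConst n := by
  unfold homConst
  positivity

variable {m L : ℕ} {N : Type*} [EMetricSpace N] [ChartedSpace (Euc m) N] [IsManifold (𝓡 m) ∞ N]
  [RiemannianBundle (fun p : N => TangentSpace (𝓡 m) p)] [IsRiemannianManifold (𝓡 m) N]
  [MeasurableSpace N] [BorelSpace N] [SecondCountableTopology N]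
  {ι : N → Euc L} {f : Euc n → N} {D : Euc n → Euc n →L[ℝ] Euc L}

/-- A map with small energy in the radial direction and along the span of `b i`, `i ∈ I`, is
`L²`-close to a homogeneous map which is invariant under this span. -/
theorem exists_isHomogeneousMap_lintegral_le (hι : IsIsometricEmbedding (m := m) ι)
    (h : IsW12 (ball 0 3) (ι ∘ f) D) (hf : Measurable f) (hD : StronglyMeasurable D) :
    ∃ g : Euc n → N, IsHomogeneousMap I.card g ∧
      ∫⁻ x in ball 0 1, edist (f x) (g x) ^ 2 ≤ ENNReal.ofReal (homConst n) *
        ∫⁻ z in ball 0 3, ENNReal.ofReal (dirEnergy b I D z) := by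
  have hu : StronglyMeasurable (ι ∘ f) :=
    (hι.isClosedEmbedding.continuous.measurable.comp hf).stronglyMeasurable
  obtain ⟨v, -, ρ, -, hle⟩ := exists_slice_lintegral_le b I hι h hf hD
  have hg := isHomogeneousMap_slice b I hf (coordProj b I v) ρ
  refine ⟨_, hg, ?_⟩
  set g : Euc n → N := fun x => f (slicePoint b I (coordProj b I v) ρ x) with hgdef
  have hgQ : ∀ x, g (x + coordCoproj b I x) = g x := fun x =>
    congrArg f (slicePoint_add_smul _ ρ x _ two_pos
      (by rw [map_add, coordCoproj_coordCoproj, two_smul]))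
  have hQm : Measurable fun x : Euc n => x + coordCoproj b I x := by
    have : Continuous fun x : Euc n => x + coordCoproj b I x := by fun_prop
    exact this.measurable
  have := lintegral_cylinder_le_of_forall b I (F := fun x => edist (f x) (g x))
    (d := fun x => edist (f x) (f (x + coordCoproj b I x))) (hf.edist hg.1)
    (hf.edist (hf.comp hQm)) (fun x => by
      rw [hgQ x]
      exact edist_triangle _ _ _)
    (fun S hSm hS hS' => by
      have := lintegral_edist_sq_le_dirEnergy (β := 1) (e := 0) hι h hu hD (by simp) (by simp)
        (by norm_num) hSm hS (by simpa using hS')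
      simpa using this) hle
  refine (lintegral_mono_set (ball_subset_cylinder b I)).trans (this.trans_eq ?_)
  have hc : ENNReal.ofReal (homConst n) =
      4 * (5 * 4 ^ n + 3) * (100 * (n + 1) * 2 ^ n) := by
    have : homConst n = ((4 * (5 * 4 ^ n + 3) * (100 * (n + 1) * 2 ^ n) : ℕ) : ℝ) := by
      unfold homConst
      push_cast
      rfl
    rw [this, ENNReal.ofReal_natCast]
    push_cast
    rfl
  rw [hc]
  ring

end Homogeneous

/-! ### Invariance of the Sobolev class under affine rescaling. -/

section Rescaling

variable {n L : ℕ}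

theorem IsW12.mono {Ω Ω' : Set (Euc n)} {u : Euc n → Euc L} {D : Euc n → Euc n →L[ℝ] Euc L}
    (h : IsW12 Ω u D) (hΩ : MeasurableSet Ω) (hsub : Ω' ⊆ Ω) :
    IsW12 Ω' u D where
  memLp := h.memLp.mono_measure (Measure.restrict_mono hsub le_rfl)
  memLp_deriv v := (h.memLp_deriv v).mono_measure (Measure.restrict_mono hsub le_rfl)
  weak φ h1 h2 h3 v := by
    have := h.weak φ h1 h2 (h3.trans hsub) v
    rwa [setIntegral_eq_of_subset_of_forall_sdiff_eq_zero hΩ hsub,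
      setIntegral_eq_of_subset_of_forall_sdiff_eq_zero hΩ hsub] at this
    · intro x hx
      rw [image_eq_zero_of_notMem_tsupport fun hx' => hx.2 (h3 hx'), zero_smul]
    · intro x hx
      have : fderiv ℝ φ x = 0 := by
        have h4 : x ∉ tsupport (fderiv ℝ φ) := fun hx' => hx.2 (h3 (tsupport_fderiv_subset ℝ hx'))
        exact image_eq_zero_of_notMem_tsupport h4
      rw [this, zero_apply, zero_smul]

/-- The affine map `z ↦ y + s z`. -/
def affineScale (y : Euc n) (s : ℝ) (z : Euc n) : Euc n := y + s • z

variable {y : Euc n} {s : ℝ}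

theorem measurableEmbedding_affineScale (hs : 0 < s) :
    MeasurableEmbedding (affineScale y s) :=
  (measurableEmbedding_addLeft y).comp (measurableEmbedding_const_smul₀ hs.ne')

theorem map_affineScale_restrict (hs : 0 < s) (R : ℝ) :
    Measure.map (affineScale y s) (volume.restrict (ball 0 R)) =
      ENNReal.ofReal ((s ^ n)⁻¹) • volume.restrict (ball y (s * R)) := by
  have hmap : Measure.map (affineScale y s) volume =
      ENNReal.ofReal ((s ^ n)⁻¹) • (volume : Measure (Euc n)) := by
    have h1 : affineScale y s = (y + ·) ∘ (s • ·) := rfl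
    rw [h1, ← Measure.map_map (measurable_const_add y) (measurable_const_smul s),
      Measure.map_addHaar_smul _ hs.ne', Measure.map_smul, map_add_left_eq_self,
      finrank_euclideanSpace_fin, abs_of_pos (by positivity)]
  have hpre : affineScale y s ⁻¹' ball y (s * R) = ball 0 R := by
    ext z
    rw [mem_preimage, mem_ball, mem_ball_zero_iff, dist_eq_norm, affineScale, add_sub_cancel_left,
      norm_smul, Real.norm_eq_abs, abs_of_pos hs, mul_lt_mul_iff_right₀ hs]
  rw [← hpre, ← (measurableEmbedding_affineScale hs).restrict_map, hmap, Measure.restrict_smul]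

theorem setIntegral_affineScale {F : Type*} [NormedAddCommGroup F] [NormedSpace ℝ F] (hs : 0 < s)
    (R : ℝ) (g : Euc n → F) :
    ∫ z in ball 0 R, g (affineScale y s z) = (s ^ n)⁻¹ • ∫ x in ball y (s * R), g x := by
  rw [← (measurableEmbedding_affineScale hs).integral_map, map_affineScale_restrict hs,
    integral_smul_measure, ENNReal.toReal_ofReal (by positivity)]

theorem memLp_comp_affineScale {F : Type*} [NormedAddCommGroup F] (hs : 0 < s) {R : ℝ} {p : ℝ≥0∞}
    {g : Euc n → F} (hg : MemLp g p (volume.restrict (ball y (s * R)))) :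
    MemLp (fun z => g (affineScale y s z)) p (volume.restrict (ball 0 R)) := by
  have h := hg.smul_measure (c := ENNReal.ofReal ((s ^ n)⁻¹)) ENNReal.ofReal_ne_top
  rw [← map_affineScale_restrict hs] at h
  exact (measurableEmbedding_affineScale hs).memLp_map_measure_iff.1 h

theorem ae_comp_affineScale (hs : 0 < s) {R : ℝ} {p : Euc n → Prop}
    (hp : ∀ᵐ x ∂volume.restrict (ball y (s * R)), p x) :
    ∀ᵐ z ∂volume.restrict (ball 0 R), p (affineScale y s z) := by
  rw [← (measurableEmbedding_affineScale hs).ae_map_iff, map_affineScale_restrict hs]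
  exact Measure.ae_smul_measure hp _

theorem IsW12.comp_affineScale {u : Euc n → Euc L} {D : Euc n → Euc n →L[ℝ] Euc L} {R : ℝ}
    (hs : 0 < s) (h : IsW12 (ball y (s * R)) u D) :
    IsW12 (ball 0 R) (fun z => u (affineScale y s z)) (fun z => s • D (affineScale y s z)) where
  memLp := memLp_comp_affineScale hs h.memLp
  memLp_deriv v := by
    have := (memLp_comp_affineScale hs (h.memLp_deriv v)).const_smul s
    exact this
  weak φ h1 h2 h3 v := by
    set B : Euc n → Euc n := fun x => s⁻¹ • (x - y) with hB
    have hBA : ∀ z, B (affineScale y s z) = z := fun z => by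
      simp [hB, affineScale, smul_smul, inv_mul_cancel₀ hs.ne']
    have hBs : ContDiff ℝ ∞ B := by
      rw [hB]
      fun_prop
    set ψ : Euc n → ℝ := φ ∘ B with hψ
    have hψd : ∀ x, fderiv ℝ ψ x v = s⁻¹ * fderiv ℝ φ (B x) v := by
      intro x
      have hBd : HasFDerivAt B (s⁻¹ • ContinuousLinearMap.id ℝ (Euc n)) x :=
        ((hasFDerivAt_id x).sub_const y).const_smul s⁻¹
      have := (((h1.differentiable (by simp)) (B x)).hasFDerivAt.comp x hBd).fderiv
      rw [hψ, this]
      simp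
    let e : Euc n ≃ₜ Euc n :=
      { toFun := B
        invFun := affineScale y s
        left_inv := fun x => by simp [hB, affineScale, smul_smul, mul_inv_cancel₀ hs.ne']
        right_inv := hBA
        continuous_toFun := hBs.continuous
        continuous_invFun := by unfold affineScale; fun_prop }
    have hts : tsupport ψ ⊆ ball y (s * R) := by
      have h4 : tsupport ψ = B ⁻¹' tsupport φ := tsupport_comp_eq_preimage φ e
      rw [h4]
      intro x hx
      have h5 := h3 hx
      rw [mem_ball_zero_iff, hB, norm_smul, Real.norm_eq_abs, abs_of_pos (inv_pos.2 hs),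
        inv_mul_lt_iff₀ hs] at h5
      rwa [mem_ball, dist_eq_norm]
    have hw := h.weak ψ (h1.comp hBs) (h2.comp_homeomorph e) hts v
    have e1 := setIntegral_affineScale (y := y) hs R fun x => fderiv ℝ φ (B x) v • u x
    have e2 := setIntegral_affineScale (y := y) hs R fun x => φ (B x) • s • D x v
    simp only [hBA] at e1 e2
    rw [e1]
    refine Eq.trans ?_ (congrArg Neg.neg e2).symm
    rw [← smul_neg]
    congr 1
    simp_rw [hψd, mul_smul] at hw
    rw [integral_smul] at hw
    simp_rw [smul_comm _ s (D _ v)]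
    rw [integral_smul, ← smul_neg]
    rw [← show ∫ x in ball y (s * R), ψ x • D x v = ∫ x in ball y (s * R), φ (B x) • D x v from rfl,
      ← hw, smul_smul, mul_inv_cancel₀ hs.ne', one_smul]

end Rescaling

/-! ### Diagonalization of the energy form and quantitative cone splitting. -/

section Spectral

variable {n L : ℕ} {D : Euc n → Euc n →L[ℝ] Euc L} {μ : Measure (Euc n)}

theorem memLp_clm_apply (hD : MemLp D 2 μ) (v : Euc n) : MemLp (fun z => D z v) 2 μ :=
  (ContinuousLinearMap.apply ℝ (Euc L) v).comp_memLp' hD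

theorem integrable_inner_apply (hD : MemLp D 2 μ) (v w : Euc n) :
    Integrable (fun z => inner ℝ (D z v) (D z w)) μ := by
  have hv := memLp_clm_apply hD v
  have hw := memLp_clm_apply hD w
  refine Integrable.mono' ((hv.integrable_norm_pow two_ne_zero).add
    (hw.integrable_norm_pow two_ne_zero)) (hv.1.inner hw.1) (.of_forall fun z => ?_)
  refine (norm_inner_le_norm _ _).trans ?_
  simp only [Pi.add_apply]
  nlinarith [sq_nonneg (‖D z v‖ - ‖D z w‖), sq_nonneg (‖D z v‖ + ‖D z w‖)]

/-- The quadratic form `v ↦ ∫ |D v|²` is diagonal in an orthonormal basis. -/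
theorem exists_orthonormalBasis_integral_norm_sq (hD : MemLp D 2 μ) :
    ∃ (b : OrthonormalBasis (Fin n) ℝ (Euc n)) (c : Fin n → ℝ), ∀ v : Euc n,
      ∫ z, ‖D z v‖ ^ 2 ∂μ = ∑ i, c i * inner ℝ (b i) v ^ 2 := by
  -- The symmetric operator of the bilinear form `∫ ⟨D v, D w⟩`; its eigenbasis is the required
  -- basis.
  let T : Euc n →ₗ[ℝ] Euc n :=
    { toFun := fun v => ∑ i, (∫ z, inner ℝ (D z (stdVec i)) (D z v) ∂μ) • stdVec i
      map_add' := fun v w => by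
        simp only [map_add, inner_add_right]
        rw [← Finset.sum_add_distrib]
        refine Finset.sum_congr rfl fun i _ => ?_
        rw [integral_add (integrable_inner_apply hD _ _) (integrable_inner_apply hD _ _), add_smul]
      map_smul' := fun a v => by
        simp only [map_smul, inner_smul_right, integral_const_mul, mul_smul, RingHom.id_apply]
        rw [Finset.smul_sum] }
  have hT : ∀ v w, inner ℝ v (T w) = ∫ z, inner ℝ (D z v) (D z w) ∂μ := by
    intro v w
    have h1 : ∀ i, inner ℝ v (stdVec i) = v i := fun i => by
      simp [stdVec, EuclideanSpace.inner_single_right]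
    have h2 : ∀ z, inner ℝ (D z v) (D z w) =
        ∑ i, v i * inner ℝ (D z (stdVec i)) (D z w) := by
      intro z
      conv_lhs => rw [← sum_coord_smul_stdVec v]
      rw [map_sum, sum_inner]
      refine Finset.sum_congr rfl fun i _ => ?_
      rw [map_smul, inner_smul_left]
      rfl
    simp_rw [h2]
    rw [integral_finsetSum _ fun i _ => (integrable_inner_apply hD _ _).const_mul _]
    simp only [T, LinearMap.coe_mk, AddHom.coe_mk]
    rw [inner_sum]
    refine Finset.sum_congr rfl fun i _ => ?_
    rw [inner_smul_right, h1, integral_const_mul, mul_comm]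
  have hsymm : T.IsSymmetric := by
    intro v w
    rw [real_inner_comm, hT, hT]
    exact integral_congr_ae (.of_forall fun z => real_inner_comm _ _)
  have hn : Module.finrank ℝ (Euc n) = n := finrank_euclideanSpace_fin
  refine ⟨hsymm.eigenvectorBasis hn, hsymm.eigenvalues hn, fun v => ?_⟩
  set b := hsymm.eigenvectorBasis hn with hb
  have h3 : ∫ z, ‖D z v‖ ^ 2 ∂μ = inner ℝ v (T v) := by
    rw [hT]
    exact integral_congr_ae (.of_forall fun z => (real_inner_self_eq_norm_sq _).symm)
  rw [h3, ← b.sum_inner_mul_inner v (T v)]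
  refine Finset.sum_congr rfl fun i _ => ?_
  rw [← hsymm, hsymm.apply_eigenvectorBasis, inner_smul_left, real_inner_comm]
  simp
  ring

variable {m : ℕ} {N : Type*} [EMetricSpace N] [ChartedSpace (Euc m) N] [IsManifold (𝓡 m) ∞ N]
  [RiemannianBundle (fun p : N => TangentSpace (𝓡 m) p)] [IsRiemannianManifold (𝓡 m) N]
  [MeasurableSpace N] [BorelSpace N] [SecondCountableTopology N]
  {ι : N → Euc L} {f : Euc n → N}

theorem integrable_norm_apply_sub_sq {R : ℝ} {y : Euc n} {r : ℝ}
    (hD : MemLp D 2 (volume.restrict (ball y r))) (hr : r ≤ R) (a : Euc n) :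
    IntegrableOn (fun z => ‖D z (z - a)‖ ^ 2) (ball y r) := by
  have hm : AEStronglyMeasurable (fun z => D z (z - a)) (volume.restrict (ball y r)) :=
    isBoundedBilinearMap_apply.continuous.comp_aestronglyMeasurable
      (hD.1.prodMk (by fun_prop))
  have hi : IntegrableOn (fun z => (R + dist y a) ^ 2 * ‖D z‖ ^ 2) (ball y r) :=
    hD.integrable_norm_pow two_ne_zero |>.const_mul _
  refine Integrable.mono' hi (hm.norm.pow 2) ?_
  filter_upwards [ae_restrict_mem measurableSet_ball] with z hz
  rw [Real.norm_eq_abs, abs_of_nonneg (by positivity), ← mul_pow]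
  have h1 : ‖z - a‖ ≤ R + dist y a := by
    rw [← dist_eq_norm]
    have := dist_triangle z y a
    rw [mem_ball] at hz
    linarith
  have h2 := (D z).le_opNorm (z - a)
  gcongr
  calc ‖D z (z - a)‖ ≤ ‖D z‖ * ‖z - a‖ := h2
    _ ≤ ‖D z‖ * (R + dist y a) := by gcongr
    _ = _ := mul_comm _ _

/-- If the points of `Y` have small radial energy and `f` is not close to a `(k+1)`-homogeneous map,
then `Y` is close to a `k`-plane. -/
theorem exists_basis_of_radial_small (hι : IsIsometricEmbedding (m := m) ι)
    (h : IsW12 (ball 0 3) (ι ∘ f) D) (hf : Measurable f) (hD : StronglyMeasurable D)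
    {Y : Set (Euc n)} (h0 : (0 : Euc n) ∈ Y) {δ δ₁ : ℝ} (hδ₁ : 0 < δ₁)
    (hY : ∀ a ∈ Y, ∫ z in ball 0 3, ‖D z (z - a)‖ ^ 2 ≤ δ) {k : ℕ}
    (hk : ∀ g : Euc n → N, IsHomogeneousMap (k + 1) g →
      ENNReal.ofReal (homConst n * (δ + n * δ₁)) < ∫⁻ x in ball 0 1, edist (f x) (g x) ^ 2) :
    ∃ (b : OrthonormalBasis (Fin n) ℝ (Euc n)) (I : Finset (Fin n)), I.card ≤ k ∧
      ∀ a ∈ Y, ∀ i ∉ I, δ₁ * inner ℝ (b i) a ^ 2 ≤ 4 * δ := by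
  have hDL := h.memLp_fun
  obtain ⟨b, c, hc⟩ := exists_orthonormalBasis_integral_norm_sq hDL
  have hcb : ∀ i, ∫ z in ball 0 3, ‖D z (b i)‖ ^ 2 = c i := by
    intro i
    rw [hc]
    simp [orthonormal_iff_ite.1 b.orthonormal]
  have hc0 : ∀ i, 0 ≤ c i := fun i => by
    rw [← hcb]
    exact integral_nonneg fun z => by positivity
  -- `I` collects the directions with small eigenvalue. If there were `k + 1` of them, they would
  -- produce a `(k+1)`-homogeneous map too close to `f`.
  refine ⟨b, Finset.univ.filter fun i => c i ≤ δ₁, ?_, ?_⟩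
  · by_contra! hcard
    obtain ⟨I, hI, hIc⟩ := Finset.exists_subset_card_eq (Nat.succ_le_of_lt hcard)
    obtain ⟨g, hg, hgl⟩ := exists_isHomogeneousMap_lintegral_le b I hι h hf hD
    rw [hIc] at hg
    refine absurd (hk g hg) (not_lt.2 (hgl.trans ?_))
    have hi1 : IntegrableOn (fun z => ‖D z z‖ ^ 2) (ball 0 3) := by
      have := integrable_norm_apply_sub_sq hDL le_rfl 0
      simpa using this
    have hi2 : ∀ i, IntegrableOn (fun z => ‖D z (b i)‖ ^ 2) (ball 0 3) := fun i =>
      (memLp_clm_apply hDL (b i)).integrable_norm_pow two_ne_zero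
    have hdir : ∫ z in ball 0 3, dirEnergy b I D z ≤ δ + n * δ₁ := by
      unfold dirEnergy
      rw [integral_add hi1 (integrable_finsetSum _ fun i _ => hi2 i),
        integral_finsetSum _ fun i _ => hi2 i]
      refine add_le_add (by simpa using hY 0 h0) ?_
      calc ∑ i ∈ I, ∫ z in ball 0 3, ‖D z (b i)‖ ^ 2 ≤ ∑ i ∈ I, δ₁ :=
            Finset.sum_le_sum fun i hiI => by
              rw [hcb]
              exact (Finset.mem_filter.1 (hI hiI)).2
        _ = I.card * δ₁ := by rw [Finset.sum_const, nsmul_eq_mul]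
        _ ≤ n * δ₁ := by
            have : (I.card : ℝ) ≤ n := by
              exact_mod_cast (Finset.card_le_univ I).trans_eq (Fintype.card_fin n)
            gcongr
    rw [ENNReal.ofReal_mul (homConst_pos n).le, ← ofReal_integral_eq_lintegral_ofReal]
    · gcongr
    · exact hi1.add (integrable_finsetSum _ fun i _ => hi2 i)
    · exact .of_forall fun z => by unfold dirEnergy; positivity
  · intro a ha i hi
    have hci : δ₁ ≤ c i := by
      by_contra! hlt
      exact hi (Finset.mem_filter.2 ⟨Finset.mem_univ _, hlt.le⟩)
    calc δ₁ * inner ℝ (b i) a ^ 2 ≤ c i * inner ℝ (b i) a ^ 2 := by gcongr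
      _ ≤ ∑ i, c i * inner ℝ (b i) a ^ 2 :=
        Finset.single_le_sum (f := fun i => c i * inner ℝ (b i) a ^ 2)
          (fun j _ => mul_nonneg (hc0 j) (sq_nonneg _)) (Finset.mem_univ i)
      _ = ∫ z in ball 0 3, ‖D z a‖ ^ 2 := (hc a).symm
      _ ≤ ∫ z in ball 0 3, (2 * ‖D z (z - 0)‖ ^ 2 + 2 * ‖D z (z - a)‖ ^ 2) := by
        refine integral_mono ((memLp_clm_apply hDL a).integrable_norm_pow two_ne_zero)
          (((integrable_norm_apply_sub_sq hDL le_rfl 0).const_mul 2).add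
            ((integrable_norm_apply_sub_sq hDL le_rfl a).const_mul 2)) fun z => ?_
        -- Cone splitting: two radial derivatives with different centers differ by a derivative in a
        -- fixed direction.
        have h1 : D z a = D z (z - 0) - D z (z - a) := by
          rw [← map_sub]
          congr 1
          abel
        have h2 := norm_sub_le (D z (z - 0)) (D z (z - a))
        simp only
        rw [h1]
        nlinarith [sq_nonneg (‖D z (z - 0)‖ - ‖D z (z - a)‖), norm_nonneg (D z (z - 0) - D z (z - a)),
          norm_nonneg (D z (z - 0)), norm_nonneg (D z (z - a))]
      _ = 2 * (∫ z in ball 0 3, ‖D z (z - 0)‖ ^ 2) +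
            2 * ∫ z in ball 0 3, ‖D z (z - a)‖ ^ 2 := by
        rw [integral_add ((integrable_norm_apply_sub_sq hDL le_rfl 0).const_mul 2)
            ((integrable_norm_apply_sub_sq hDL le_rfl a).const_mul 2),
          integral_const_mul, integral_const_mul]
      _ ≤ 4 * δ := by linarith [hY 0 h0, hY a ha]

end Spectral

/-! ### Cone splitting for points of the effective stratum. -/

section Stratum

variable {n m L : ℕ} {N : Type*} [EMetricSpace N] [ChartedSpace (Euc m) N] [IsManifold (𝓡 m) ∞ N]
  [RiemannianBundle (fun p : N => TangentSpace (𝓡 m) p)] [IsRiemannianManifold (𝓡 m) N]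
  [MeasurableSpace N] [BorelSpace N]
  {ι : N → Euc L} {f : Euc n → N} {D : Euc n → Euc n →L[ℝ] Euc L}

/-- Points of the effective stratum lying in a ball of radius `s`, at which the radial energy at
scale `s` is small, are close to a `k`-plane. -/
theorem exists_basis_of_mem_effStratum (hι : IsIsometricEmbedding (m := m) ι)
    (h : IsW12 (ball 0 2) (ι ∘ f) D) {k : ℕ} {η r s δ δ₁ : ℝ} (hs : 0 < s) (hrs : r ≤ s)
    (hs10 : 10 * s ≤ 1) (hδ₁ : 0 < δ₁)
    (hη : homConst n * (δ + n * δ₁) ≤ η * (volume (ball (0 : Euc n) 1)).toReal)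
    {E : Set (Euc n)} (hE : E ⊆ effStratum k η r f ∩ ball 0 1)
    (hrad : ∀ y ∈ E, ∫ x in ball y (5 * s), ‖D x (x - y)‖ ^ 2 ≤ δ * s ^ n)
    {a y₀ : Euc n} (hy₀ : y₀ ∈ E ∩ ball a s) :
    ∃ (b : OrthonormalBasis (Fin n) ℝ (Euc n)) (I : Finset (Fin n)), I.card ≤ k ∧
      ∀ y ∈ E ∩ ball a s, ∀ i ∉ I, δ₁ * inner ℝ (b i) (s⁻¹ • (y - y₀)) ^ 2 ≤ 4 * δ := by
  have hsep : SecondCountableTopology N :=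
    hι.isClosedEmbedding.isEmbedding.secondCountableTopology
  have hy₀1 : ‖y₀‖ < 1 := mem_ball_zero_iff.1 (hE hy₀.1).2
  have hsub3 : ball y₀ (s * 3) ⊆ ball 0 2 :=
    ball_subset_ball' (by rw [dist_zero_right]; linarith)
  -- Only `u` is known to be almost everywhere measurable; the closed embedding transfers this to
  -- `f`. Passing to measurable representatives of `f` and `D` changes no integral.
  have hmeasf : AEMeasurable f (volume.restrict (ball 0 2)) :=
    hι.isClosedEmbedding.measurableEmbedding.aemeasurable_comp_iff.1 h.memLp.1.aemeasurable
  have hDae : AEStronglyMeasurable D (volume.restrict (ball 0 2)) := h.memLp_fun.1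
  set f' := hmeasf.mk f with hf'
  set D' := hDae.mk D with hD'
  have hff : f =ᵐ[volume.restrict (ball 0 2)] f' := hmeasf.ae_eq_mk
  have hDD : D =ᵐ[volume.restrict (ball 0 2)] D' := hDae.ae_eq_mk
  have h' : IsW12 (ball 0 2) (ι ∘ f') D' := h.congr (hff.mono fun x hx => by simp [hx]) hDD
  set g : Euc n → N := fun z => f' (affineScale y₀ s z) with hg
  set G : Euc n → Euc n →L[ℝ] Euc L := fun z => s • D' (affineScale y₀ s z) with hG
  have hW : IsW12 (ball 0 3) (ι ∘ g) G :=
    (h'.mono measurableSet_ball hsub3).comp_affineScale hs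
  have hAm : Measurable (affineScale y₀ s) := (measurableEmbedding_affineScale hs).measurable
  have hgm : Measurable g := hmeasf.measurable_mk.comp hAm
  have hGm : StronglyMeasurable G := (hDae.stronglyMeasurable_mk.comp_measurable hAm).const_smul s
  set Y : Set (Euc n) := (fun y => s⁻¹ • (y - y₀)) '' (E ∩ ball a s) with hYdef
  have hY : ∀ v ∈ Y, ∫ z in ball 0 3, ‖G z (z - v)‖ ^ 2 ≤ δ := by
    rintro _ ⟨y, hy, rfl⟩
    have hy1 : ‖y‖ < 1 := mem_ball_zero_iff.1 (hE hy.1).2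
    have hsub5 : ball y (5 * s) ⊆ ball 0 2 :=
      ball_subset_ball' (by rw [dist_zero_right]; linarith)
    have hdist : dist y₀ y < 2 * s := by
      have := dist_triangle_right y₀ y a
      have h1 := mem_ball.1 hy₀.2
      have h2 := mem_ball.1 hy.2
      linarith
    -- This is why good scales use radius `5s`: `3s` for the rescaled ball of radius 3, plus the
    -- distance `2s` between two points of `ball a s`.
    have hsub35 : ball y₀ (s * 3) ⊆ ball y (5 * s) := ball_subset_ball' (by linarith)
    have heq : ∀ z, ‖G z (z - s⁻¹ • (y - y₀))‖ ^ 2 =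
        ‖D' (affineScale y₀ s z) (affineScale y₀ s z - y)‖ ^ 2 := by
      intro z
      rw [hG]
      simp only [_root_.smul_apply, ← map_smul]
      congr 3
      rw [affineScale, smul_sub, smul_smul, mul_inv_cancel₀ hs.ne', one_smul]
      abel
    have hint : IntegrableOn (fun x => ‖D x (x - y)‖ ^ 2) (ball y (5 * s)) :=
      integrable_norm_apply_sub_sq (h.memLp_fun.mono_measure
        (Measure.restrict_mono hsub5 le_rfl)) le_rfl y
    simp_rw [heq]
    rw [setIntegral_affineScale hs 3 fun x => ‖D' x (x - y)‖ ^ 2, smul_eq_mul,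
      inv_mul_le_iff₀ (by positivity), mul_comm _ δ]
    calc ∫ x in ball y₀ (s * 3), ‖D' x (x - y)‖ ^ 2
        = ∫ x in ball y₀ (s * 3), ‖D x (x - y)‖ ^ 2 := by
          refine integral_congr_ae ?_
          filter_upwards [ae_restrict_of_ae_restrict_of_subset hsub3 hDD] with x hx
          rw [hx]
      _ ≤ ∫ x in ball y (5 * s), ‖D x (x - y)‖ ^ 2 :=
          setIntegral_mono_set hint (.of_forall fun x => by positivity)
            (LE.le.eventuallyLE hsub35)
      _ ≤ δ * s ^ n := hrad y hy.1
  have h0Y : (0 : Euc n) ∈ Y := ⟨y₀, hy₀, by simp⟩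
  have hk : ∀ p : Euc n → N, IsHomogeneousMap (k + 1) p →
      ENNReal.ofReal (homConst n * (δ + n * δ₁)) < ∫⁻ z in ball 0 1, edist (g z) (p z) ^ 2 := by
    intro p hp
    have hlt := (hE hy₀.1).1 s hrs (by linarith) p hp
    by_contra! hle
    refine absurd hlt (not_lt.2 ?_)
    have hvol0 : volume (ball (0 : Euc n) 1) ≠ 0 := (measure_ball_pos _ _ one_pos).ne'
    have hvolT : volume (ball (0 : Euc n) 1) ≠ ⊤ := measure_ball_lt_top.ne
    rw [setLAverage_eq]
    refine ENNReal.div_le_of_le_mul ?_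
    have hae : ∀ᵐ z ∂volume.restrict (ball (0 : Euc n) 1), f (affineScale y₀ s z) = g z :=
      ae_comp_affineScale hs (ae_restrict_of_ae_restrict_of_subset
        ((ball_subset_ball (by linarith)).trans hsub3) hff)
    calc ∫⁻ z in ball 0 1, edist (rescale y₀ s f z) (p z) ^ 2
        = ∫⁻ z in ball 0 1, edist (g z) (p z) ^ 2 :=
          lintegral_congr_ae (hae.mono fun z hz => by
            simp only [rescale]
            rw [← hz, affineScale])
      _ ≤ ENNReal.ofReal (homConst n * (δ + n * δ₁)) := hle
      _ ≤ ENNReal.ofReal (η * (volume (ball (0 : Euc n) 1)).toReal) :=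
          ENNReal.ofReal_le_ofReal hη
      _ = ENNReal.ofReal η * volume (ball (0 : Euc n) 1) := by
          rw [ENNReal.ofReal_mul' ENNReal.toReal_nonneg, ENNReal.ofReal_toReal hvolT]
  obtain ⟨b, I, hI, hb⟩ := exists_basis_of_radial_small hι hW hgm hGm h0Y hδ₁ hY hk
  exact ⟨b, I, hI, fun y hy i hi => hb _ ⟨y, hy, rfl⟩ i hi⟩

end Stratum

/-! ### The inner variation along radial vector fields. -/

section Monotonicity

variable {n L : ℕ} {D : Euc n → Euc n →L[ℝ] Euc L}

theorem energyDensity_nonneg (x : Euc n) : 0 ≤ energyDensity D x :=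
  Finset.sum_nonneg fun _ _ => by positivity

theorem apply_eq_sum_coord (x v : Euc n) : D x v = ∑ i, v i • D x (stdVec i) := by
  conv_lhs => rw [← sum_coord_smul_stdVec v]
  rw [map_sum]
  simp_rw [map_smul]

theorem norm_apply_sq_le_energyDensity (x v : Euc n) :
    ‖D x v‖ ^ 2 ≤ energyDensity D x * ‖v‖ ^ 2 := by
  have h1 : ‖D x v‖ ≤ ∑ i, |v i| * ‖D x (stdVec i)‖ := by
    rw [apply_eq_sum_coord]
    refine (norm_sum_le _ _).trans (Finset.sum_le_sum fun i _ => ?_)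
    rw [norm_smul, Real.norm_eq_abs]
  calc ‖D x v‖ ^ 2 ≤ (∑ i, |v i| * ‖D x (stdVec i)‖) ^ 2 := by gcongr
    _ ≤ (∑ i, |v i| ^ 2) * ∑ i, ‖D x (stdVec i)‖ ^ 2 := Finset.sum_mul_sq_le_sq_mul_sq _ _ _
    _ = energyDensity D x * ‖v‖ ^ 2 := by
      rw [EuclideanSpace.norm_sq_eq, mul_comm, energyDensity]
      simp

theorem IsW12.integrableOn_energyDensity {Ω : Set (Euc n)} {u : Euc n → Euc L}
    (h : IsW12 Ω u D) : IntegrableOn (energyDensity D) Ω :=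
  integrable_finsetSum _ fun i _ => (h.memLp_deriv (stdVec i)).integrable_norm_pow two_ne_zero

theorem integrableOn_ball_continuous_mul {a : Euc n} {R : ℝ} {q F : Euc n → ℝ} (hq : Continuous q)
    (hF : IntegrableOn F (ball a R)) : IntegrableOn (fun x => q x * F x) (ball a R) := by
  obtain ⟨C, hC⟩ := (isCompact_closedBall a R).exists_bound_of_continuousOn hq.continuousOn
  refine hF.bdd_mul (c := C) hq.aestronglyMeasurable ?_
  filter_upwards [ae_restrict_mem measurableSet_ball] with x hx
  exact hC x (ball_subset_closedBall hx)

theorem hasFDerivAt_radialField {g : ℝ → ℝ} {x y : Euc n}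
    (hg : DifferentiableAt ℝ g (‖x - y‖ ^ 2)) :
    HasFDerivAt (fun x => g (‖x - y‖ ^ 2) • (x - y))
      (g (‖x - y‖ ^ 2) • ContinuousLinearMap.id ℝ (Euc n) +
        (deriv g (‖x - y‖ ^ 2) • (2 : ℝ) • innerSL ℝ (x - y)).smulRight (x - y)) x := by
  have h1 : HasFDerivAt (fun x : Euc n => x - y) (ContinuousLinearMap.id ℝ (Euc n)) x :=
    (hasFDerivAt_id x).sub_const y
  have h2 : HasFDerivAt (fun x => ‖x - y‖ ^ 2) ((2 : ℝ) • innerSL ℝ (x - y)) x := by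
    have := h1.norm_sq
    refine this.congr_fderiv ?_
    ext v
    simp [two_smul]
  exact (hg.hasDerivAt.comp_hasFDerivAt x h2).smul h1

variable {m : ℕ} {N : Type*} [EMetricSpace N] [ChartedSpace (Euc m) N]
  {ι : N → Euc L} {f : Euc n → N}

/-- The inner variation formula for the radial vector fields `g(|x - y|²) (x - y)`. -/
theorem IsStationaryHarmonic.radial_variation
    (h : IsStationaryHarmonic (m := m) (ball 0 2) ι f D) {y : Euc n} (hy : y ∈ ball (0 : Euc n) 1)
    {g : ℝ → ℝ} (hg : ∀ t, 0 ≤ t → ContDiffAt ℝ ∞ g t) (hg0 : ∀ t, 9 / 16 ≤ t → g t = 0) :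
    IntegrableOn (fun x => ((n : ℝ) - 2) * g (‖x - y‖ ^ 2) * energyDensity D x +
      2 * deriv g (‖x - y‖ ^ 2) *
        (‖x - y‖ ^ 2 * energyDensity D x - 2 * ‖D x (x - y)‖ ^ 2)) (ball 0 2) ∧
    ∫ x in ball 0 2, (((n : ℝ) - 2) * g (‖x - y‖ ^ 2) * energyDensity D x +
      2 * deriv g (‖x - y‖ ^ 2) *
        (‖x - y‖ ^ 2 * energyDensity D x - 2 * ‖D x (x - y)‖ ^ 2)) = 0 := by
  have hgd : ∀ x : Euc n, DifferentiableAt ℝ g (‖x - y‖ ^ 2) := fun x =>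
    (hg _ (by positivity)).differentiableAt (by simp)
  constructor
  · have hc1 : Continuous fun x : Euc n => ((n : ℝ) - 2) * g (‖x - y‖ ^ 2) +
        2 * deriv g (‖x - y‖ ^ 2) * ‖x - y‖ ^ 2 := by
      refine continuous_iff_continuousAt.2 fun x => ?_
      have e0 : ContinuousAt (fun x : Euc n => ‖x - y‖ ^ 2) x := by fun_prop
      have e1 : ContinuousAt (fun x : Euc n => g (‖x - y‖ ^ 2)) x :=
        ContinuousAt.comp (f := fun x : Euc n => ‖x - y‖ ^ 2) (hgd x).continuousAt e0
      have e2 : ContinuousAt (fun x : Euc n => deriv g (‖x - y‖ ^ 2)) x :=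
        ContinuousAt.comp (f := fun x : Euc n => ‖x - y‖ ^ 2)
          (((hg _ (by positivity)).fderiv_right (m := 0) (by simp)).continuousAt.clm_apply
            continuousAt_const) e0
      exact (continuousAt_const.mul e1).add ((continuousAt_const.mul e2).mul e0)
    have hc2 : Continuous fun x : Euc n => 4 * deriv g (‖x - y‖ ^ 2) := by
      refine continuous_iff_continuousAt.2 fun x => ?_
      have e0 : ContinuousAt (fun x : Euc n => ‖x - y‖ ^ 2) x := by fun_prop
      exact continuousAt_const.mul (ContinuousAt.comp (f := fun x : Euc n => ‖x - y‖ ^ 2)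
          (((hg _ (by positivity)).fderiv_right (m := 0) (by simp)).continuousAt.clm_apply
            continuousAt_const) e0)
    have h1 := integrableOn_ball_continuous_mul hc1 h.isW12.integrableOn_energyDensity
    have h2 := integrableOn_ball_continuous_mul hc2 (integrable_norm_apply_sub_sq h.isW12.memLp_fun le_rfl y)
    refine (h1.sub h2).congr (.of_forall fun x => ?_)
    simp only [Pi.sub_apply]
    ring
  · have hξ : ContDiff ℝ ∞ fun x : Euc n => g (‖x - y‖ ^ 2) • (x - y) := by
      refine contDiff_iff_contDiffAt.2 fun x => ?_
      have e0 : ContDiffAt ℝ ∞ (fun x : Euc n => ‖x - y‖ ^ 2) x :=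
        ((contDiff_id.sub contDiff_const).norm_sq ℝ).contDiffAt
      exact (ContDiffAt.comp (f := fun x : Euc n => ‖x - y‖ ^ 2) x (hg _ (by positivity)) e0).smul
        (contDiffAt_id.sub contDiffAt_const)
    -- Here `9/16 = (3/4)²`, and `1 + 3/4 < 2` keeps the support inside the domain.
    have hsupp : tsupport (fun x : Euc n => g (‖x - y‖ ^ 2) • (x - y)) ⊆
        closedBall y (3 / 4) := by
      refine closure_minimal (fun x hx => ?_) isClosed_closedBall
      rw [mem_closedBall, dist_eq_norm]
      by_contra! hlt
      refine hx ?_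
      simp only
      rw [hg0 _ (by nlinarith), zero_smul]
    have h0 := h.stationary _ hξ (HasCompactSupport.of_support_subset_isCompact
      (isCompact_closedBall y (3 / 4)) (subset_closure.trans hsupp)) (hsupp.trans
        (closedBall_subset_ball' (by
          rw [mem_ball] at hy
          linarith)))
    rw [← h0]
    refine integral_congr_ae (.of_forall fun x => ?_)
    simp only
    rw [(hasFDerivAt_radialField (hgd x)).fderiv]
    set z := x - y with hz
    set a := g (‖z‖ ^ 2)
    set b := deriv g (‖z‖ ^ 2)
    have hin : ∀ i, inner ℝ z (stdVec i) = z i := fun i => by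
      simp [stdVec, EuclideanSpace.inner_single_right]
    have hii : ∀ i : Fin n, (stdVec i : Euc n) i = 1 := fun i => by simp [stdVec]
    have e1 : ∀ i, (a • ContinuousLinearMap.id ℝ (Euc n) +
        (b • (2 : ℝ) • innerSL ℝ z).smulRight z) (stdVec i) = a • stdVec i + (b * (2 * z i)) • z := by
      intro i
      simp only [_root_.add_apply, _root_.smul_apply, ContinuousLinearMap.smulRight_apply,
        innerSL_apply_apply, hin, smul_eq_mul, ContinuousLinearMap.id_apply]
    simp_rw [e1]
    have e2 : ∑ i, (a • stdVec i + (b * (2 * z i)) • z) i = n * a + 2 * b * ‖z‖ ^ 2 := by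
      simp only [PiLp.add_apply, PiLp.smul_apply, hii, smul_eq_mul, mul_one]
      rw [Finset.sum_add_distrib, Finset.sum_const, Finset.card_univ, Fintype.card_fin,
        nsmul_eq_mul, EuclideanSpace.norm_sq_eq, Finset.mul_sum]
      congr 1
      refine Finset.sum_congr rfl fun i _ => ?_
      rw [Real.norm_eq_abs, sq_abs]
      ring
    have e3 : ∑ i, inner ℝ (D x (stdVec i)) (D x (a • stdVec i + (b * (2 * z i)) • z)) =
        a * energyDensity D x + 2 * b * ‖D x z‖ ^ 2 := by
      have e4 : ‖D x z‖ ^ 2 = ∑ i, z i * inner ℝ (D x (stdVec i)) (D x z) := by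
        rw [← real_inner_self_eq_norm_sq]
        nth_rewrite 1 [apply_eq_sum_coord x z]
        rw [sum_inner]
        refine Finset.sum_congr rfl fun i _ => ?_
        rw [inner_smul_left]
        rfl
      rw [e4, energyDensity, Finset.mul_sum, Finset.mul_sum, ← Finset.sum_add_distrib]
      refine Finset.sum_congr rfl fun i _ => ?_
      rw [map_add, map_smul, map_smul, inner_add_right, inner_smul_right, inner_smul_right,
        real_inner_self_eq_norm_sq]
      ring
    rw [e2, e3]
    ring

end Monotonicity

/-! ### The weighted radial energy bound. -/

section Density

/-- A smooth cutoff function. -/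
theorem exists_smooth_cutoff : ∃ (χ : ℝ → ℝ) (C : ℝ), ContDiff ℝ ∞ χ ∧ 0 < C ∧ (∀ t, 0 ≤ χ t) ∧
    (∀ t, t ≤ 1 / 4 → χ t = 1) ∧ (∀ t, 9 / 16 ≤ t → χ t = 0) ∧ (∀ t, |deriv χ t| ≤ C) ∧
    (∀ t, t < 1 / 4 → deriv χ t = 0) ∧ ∀ t, 9 / 16 < t → deriv χ t = 0 := by
  set χ : ℝ → ℝ := fun t => Real.smoothTransition ((9 / 16 - t) * (16 / 5)) with hχ
  have hs : ContDiff ℝ ∞ χ := Real.smoothTransition.contDiff.comp (by fun_prop)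
  have h1 : ∀ t, t ≤ 1 / 4 → χ t = 1 := fun t ht =>
    Real.smoothTransition.one_of_one_le (by linarith)
  have h0 : ∀ t, 9 / 16 ≤ t → χ t = 0 := fun t ht =>
    Real.smoothTransition.zero_of_nonpos (by linarith)
  have hd1 : ∀ t, t < 1 / 4 → deriv χ t = 0 := fun t ht => by
    have : χ =ᶠ[𝓝 t] fun _ => 1 := by
      filter_upwards [Iio_mem_nhds ht] with s hs using h1 s (le_of_lt hs)
    rw [this.deriv_eq, deriv_const]
  have hd0 : ∀ t, 9 / 16 < t → deriv χ t = 0 := fun t ht => by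
    have : χ =ᶠ[𝓝 t] fun _ => 0 := by
      filter_upwards [Ioi_mem_nhds ht] with s hs using h0 s (le_of_lt hs)
    rw [this.deriv_eq, deriv_const]
  obtain ⟨C, hC⟩ := (isCompact_Icc (a := (1 / 4 : ℝ)) (b := 9 / 16)).exists_bound_of_continuousOn
    (hs.continuous_deriv (by simp)).continuousOn
  refine ⟨χ, max C 1, hs, by positivity, fun t => Real.smoothTransition.nonneg _, h1, h0,
    fun t => ?_, hd1, hd0⟩
  rcases lt_or_ge t (1 / 4) with ht | ht
  · rw [hd1 t ht, abs_zero]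
    positivity
  rcases lt_or_ge (9 / 16) t with ht' | ht'
  · rw [hd0 t ht', abs_zero]
    positivity
  exact (hC t ⟨ht, ht'⟩).trans (le_max_left _ _)

variable {n m : ℕ} {N : Type*} [EMetricSpace N] [ChartedSpace (Euc m) N]

theorem continuous_rpow_norm_sub_sq_add {y : Euc n} {ε : ℝ} (hε : 0 < ε) (α : ℝ) :
    Continuous fun x : Euc n => (‖x - y‖ ^ 2 + ε) ^ α :=
  Continuous.rpow_const (by fun_prop) fun x => Or.inl (by positivity)

theorem integrableOn_rpow_mul_radial {L : ℕ} {D : Euc n → Euc n →L[ℝ] Euc L} {u : Euc n → Euc L}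
    (h : IsW12 (ball 0 2) u D) {y : Euc n} {ε : ℝ} (hε : 0 < ε) (α : ℝ) :
    IntegrableOn (fun x => (‖x - y‖ ^ 2 + ε) ^ α * ‖D x (x - y)‖ ^ 2) (ball 0 2) :=
  integrableOn_ball_continuous_mul (continuous_rpow_norm_sub_sq_add hε α)
    (integrable_norm_apply_sub_sq h.memLp_fun le_rfl y)

theorem ball_half_subset {y : Euc n} (hy : y ∈ ball (0 : Euc n) 1) : ball y (1 / 2) ⊆ ball 0 2 :=
  ball_subset_ball' (by
    rw [mem_ball] at hy
    linarith)

/-- In dimension at most 2 the weight is at most `|x - y|^(-2)` on this ball, so the bound is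
pointwise and needs no stationarity. -/
theorem rpow_mul_radial_le_of_le_two {L : ℕ} {D : Euc n → Euc n →L[ℝ] Euc L} (hn : n ≤ 2)
    {x y : Euc n} (hx : x ∈ ball y (1 / 2)) {ε : ℝ} (hε : 0 < ε) :
    (‖x - y‖ ^ 2 + ε) ^ (-((n : ℝ) / 2)) * ‖D x (x - y)‖ ^ 2 ≤ energyDensity D x := by
  rw [mem_ball, dist_eq_norm] at hx
  have hn' : (n : ℝ) / 2 ≤ 1 := by
    have : (n : ℝ) ≤ 2 := by exact_mod_cast hn
    linarith
  rw [Real.rpow_neg (by positivity), inv_mul_le_iff₀ (by positivity), mul_comm]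
  refine (norm_apply_sq_le_energyDensity x _).trans ?_
  refine mul_le_mul_of_nonneg_left ?_ (energyDensity_nonneg x)
  rcases (sq_nonneg ‖x - y‖).eq_or_lt with h0 | h0
  · rw [← h0]
    positivity
  · calc ‖x - y‖ ^ 2 = (‖x - y‖ ^ 2) ^ (1 : ℝ) := (Real.rpow_one _).symm
      _ ≤ (‖x - y‖ ^ 2) ^ ((n : ℝ) / 2) :=
        Real.rpow_le_rpow_of_exponent_ge h0 (by nlinarith [norm_nonneg (x - y)]) hn'
      _ ≤ (‖x - y‖ ^ 2 + ε) ^ ((n : ℝ) / 2) :=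
        Real.rpow_le_rpow h0.le (by linarith) (by positivity)

/-- Here `w` plays the role of `(t + ε)^(-n/2)`. The terms with `ν χ w t e` cancel, leaving the
radial term and the nonnegative remainder `ν χ w ε e`; the only error comes from `χ'`. -/
theorem radial_variation_lower_bound {ν χ χ' w t ε e d M : ℝ} (hν : 0 ≤ ν) (hχ : 0 ≤ χ)
    (hw : 0 ≤ w) (ht : 0 ≤ t) (hε : 0 ≤ ε) (he : 0 ≤ e) (hd : 0 ≤ d) (hde : d ≤ e * t)
    (hM : |χ'| * ((t + ε) * w) * t ≤ M) :
    2 * ν * (χ * w * d) ≤ ν * (χ * ((t + ε) * w)) * e +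
      2 * (χ' * ((t + ε) * w) + χ * (-(ν / 2) * w)) * (t * e - 2 * d) + 2 * M * e := by
  have h1 : |t * e - 2 * d| ≤ t * e := abs_le.2 ⟨by linarith, by linarith⟩
  have h2 : |χ' * ((t + ε) * w) * (t * e - 2 * d)| ≤ M * e := by
    rw [abs_mul, abs_mul, abs_of_nonneg (a := (t + ε) * w) (by positivity)]
    calc |χ'| * ((t + ε) * w) * |t * e - 2 * d| ≤ |χ'| * ((t + ε) * w) * (t * e) := by gcongr
      _ = |χ'| * ((t + ε) * w) * t * e := by ring
      _ ≤ M * e := by gcongr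
  have h3 := (abs_le.1 h2).1
  have h4 : 0 ≤ ν * (χ * w * (ε * e)) := by positivity
  linarith

/-- The monotonicity formula, in the form of a weighted bound for the radial energy. -/
theorem exists_weighted_radial_energy_le (n m : ℕ) (N : Type*) [EMetricSpace N]
    [ChartedSpace (Euc m) N] : ∃ C : ℝ, 0 < C ∧ ∀ (L : ℕ) (ι : N → Euc L) (f : Euc n → N)
      (D : Euc n → Euc n →L[ℝ] Euc L), IsStationaryHarmonic (m := m) (ball 0 2) ι f D →
      ∀ y ∈ ball (0 : Euc n) 1, ∀ ε : ℝ, 0 < ε →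
        ∫ x in ball y (1 / 2), (‖x - y‖ ^ 2 + ε) ^ (-((n : ℝ) / 2)) * ‖D x (x - y)‖ ^ 2 ≤
          C * ∫ x in ball 0 2, energyDensity D x := by
  rcases le_or_gt n 2 with hn | hn
  · refine ⟨1, one_pos, fun L ι f D h y hy ε hε => ?_⟩
    have he := h.isW12.integrableOn_energyDensity
    rw [one_mul]
    calc ∫ x in ball y (1 / 2), (‖x - y‖ ^ 2 + ε) ^ (-((n : ℝ) / 2)) * ‖D x (x - y)‖ ^ 2
        ≤ ∫ x in ball y (1 / 2), energyDensity D x :=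
          setIntegral_mono_on ((integrableOn_rpow_mul_radial h.isW12 hε _).mono_set
            (ball_half_subset hy)) (he.mono_set (ball_half_subset hy)) measurableSet_ball
            fun x hx => rpow_mul_radial_le_of_le_two hn hx hε
      _ ≤ ∫ x in ball 0 2, energyDensity D x :=
          setIntegral_mono_set he (.of_forall fun x => energyDensity_nonneg x)
            (LE.le.eventuallyLE (ball_half_subset hy))
  obtain ⟨χ, C, hχs, hC, hχ0, hχ1, hχz, hχ', hχ1', hχz'⟩ := exists_smooth_cutoff
  set ν : ℝ := (n : ℝ) - 2 with hν
  have hν1 : 1 ≤ ν := by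
    have : (3 : ℝ) ≤ n := by exact_mod_cast hn
    linarith
  -- The derivative of the cutoff is supported in `1/4 ≤ t ≤ 9/16`, where the weight is at most its
  -- value at `1/4`, whatever `ε` is.
  set M : ℝ := C * (1 / 4 : ℝ) ^ (-(ν / 2)) with hM
  have hM0 : 0 < M := by positivity
  refine ⟨M, hM0, fun L ι f D h y hy ε hε => ?_⟩
  have he := h.isW12.integrableOn_energyDensity
  -- The exponent makes the bulk energy terms cancel where `χ = 1`; `ε` keeps the vector field
  -- smooth at `y`.
  set g : ℝ → ℝ := fun t => χ t * (t + ε) ^ (-(ν / 2)) with hg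
  have hgs : ∀ t, 0 ≤ t → ContDiffAt ℝ ∞ g t := fun t ht =>
    hχs.contDiffAt.mul ((contDiffAt_id.add contDiffAt_const).rpow_const_of_ne
      (by simp only [id]; positivity))
  have hgz : ∀ t, 9 / 16 ≤ t → g t = 0 := fun t ht => by
    rw [hg]
    simp only [hχz t ht, zero_mul]
  have hp : ∀ t, 0 ≤ t → (t + ε) ^ (-(ν / 2)) = (t + ε) * (t + ε) ^ (-((n : ℝ) / 2)) := by
    intro t ht
    rw [mul_comm, ← Real.rpow_add_one (by positivity)]
    congr 1
    rw [hν]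
    ring
  have hgd : ∀ t, 0 ≤ t → deriv g t = deriv χ t * ((t + ε) * (t + ε) ^ (-((n : ℝ) / 2))) +
      χ t * (-(ν / 2) * (t + ε) ^ (-((n : ℝ) / 2))) := by
    intro t ht
    have h1 : HasDerivAt χ (deriv χ t) t := (hχs.differentiable (by simp) t).hasDerivAt
    have h2 : HasDerivAt (fun t => (t + ε) ^ (-(ν / 2)))
        (1 * -(ν / 2) * (t + ε) ^ (-(ν / 2) - 1)) t :=
      ((hasDerivAt_id t).add_const ε).rpow_const (Or.inl (by simp only [id]; positivity))
    have h3 : -(ν / 2) - 1 = -((n : ℝ) / 2) := by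
      rw [hν]
      ring
    refine (h1.mul h2).deriv.trans ?_
    simp only [hp t ht, h3, one_mul]
  obtain ⟨hFi, hF0⟩ := h.radial_variation hy hgs hgz
  set F : Euc n → ℝ := fun x => ((n : ℝ) - 2) * g (‖x - y‖ ^ 2) * energyDensity D x +
      2 * deriv g (‖x - y‖ ^ 2) *
        (‖x - y‖ ^ 2 * energyDensity D x - 2 * ‖D x (x - y)‖ ^ 2) with hF
  have hlow : ∀ x, 2 * ν * (χ (‖x - y‖ ^ 2) * (‖x - y‖ ^ 2 + ε) ^ (-((n : ℝ) / 2)) *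
      ‖D x (x - y)‖ ^ 2) ≤ F x + 2 * M * energyDensity D x := by
    intro x
    have ht : 0 ≤ ‖x - y‖ ^ 2 := by positivity
    rw [hF]
    simp only
    rw [hgd _ ht]
    simp only [hg]
    rw [hp _ ht]
    refine radial_variation_lower_bound (by linarith) (hχ0 _) (by positivity) ht hε.le
      (energyDensity_nonneg x) (by positivity) (norm_apply_sq_le_energyDensity x _) ?_
    rw [← hp _ ht]
    generalize ‖x - y‖ ^ 2 = t at ht
    rcases lt_or_ge t (1 / 4) with h4 | h4
    · rw [hχ1' t h4]
      simpa using hM0.le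
    rcases lt_or_ge (9 / 16) t with h9 | h9
    · rw [hχz' t h9]
      simpa using hM0.le
    have h5 : (t + ε) ^ (-(ν / 2)) ≤ (1 / 4 : ℝ) ^ (-(ν / 2)) :=
      Real.rpow_le_rpow_of_nonpos (by norm_num) (by linarith) (by linarith)
    calc |deriv χ t| * (t + ε) ^ (-(ν / 2)) * t ≤ C * (1 / 4 : ℝ) ^ (-(ν / 2)) * 1 := by
          gcongr
          · exact hχ' t
          · linarith
      _ = M := mul_one _
  have hsum : IntegrableOn (fun x => F x + 2 * M * energyDensity D x) (ball 0 2) :=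
    hFi.add (he.const_mul _)
  have hpos : ∀ x, 0 ≤ F x + 2 * M * energyDensity D x := fun x => by
    refine le_trans ?_ (hlow x)
    have := hχ0 (‖x - y‖ ^ 2)
    have : 0 ≤ ν := by linarith
    positivity
  have hw0 : 0 ≤ ∫ x in ball y (1 / 2),
      (‖x - y‖ ^ 2 + ε) ^ (-((n : ℝ) / 2)) * ‖D x (x - y)‖ ^ 2 :=
    integral_nonneg fun x => by positivity
  have hmain : 2 * ν * ∫ x in ball y (1 / 2),
      (‖x - y‖ ^ 2 + ε) ^ (-((n : ℝ) / 2)) * ‖D x (x - y)‖ ^ 2 ≤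
      2 * M * ∫ x in ball 0 2, energyDensity D x := by
    rw [← integral_const_mul]
    calc ∫ x in ball y (1 / 2),
          2 * ν * ((‖x - y‖ ^ 2 + ε) ^ (-((n : ℝ) / 2)) * ‖D x (x - y)‖ ^ 2)
        ≤ ∫ x in ball y (1 / 2), (F x + 2 * M * energyDensity D x) := by
          refine setIntegral_mono_on (((integrableOn_rpow_mul_radial h.isW12 hε _).mono_set
            (ball_half_subset hy)).const_mul _) (hsum.mono_set (ball_half_subset hy))
            measurableSet_ball fun x hx => ?_
          rw [mem_ball, dist_eq_norm] at hx
          have := hlow x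
          rwa [hχ1 _ (by nlinarith [norm_nonneg (x - y)]), one_mul] at this
      _ ≤ ∫ x in ball 0 2, (F x + 2 * M * energyDensity D x) :=
          setIntegral_mono_set hsum (.of_forall hpos) (LE.le.eventuallyLE (ball_half_subset hy))
      _ = 2 * M * ∫ x in ball 0 2, energyDensity D x := by
          rw [integral_add hFi (he.const_mul _), hF0, zero_add, integral_const_mul]
  -- Since `ν ≥ 1` and the weighted integral is nonnegative, the factor `ν` can be dropped.
  nlinarith

end Density

/-! ### All but boundedly many scales are good. -/

section GoodScales

/-- The radial energy of `D` at `y` is small at scale `s`. -/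
def IsGoodScale {n L : ℕ} (D : Euc n → Euc n →L[ℝ] Euc L) (δ : ℝ) (y : Euc n) (s : ℝ) : Prop :=
  10 * s ≤ 1 ∧ ∫ x in ball y (5 * s), ‖D x (x - y)‖ ^ 2 ≤ δ * s ^ n

open Classical in
/-- The indices `i < j` such that `γ ^ i` is not a good scale at `y`. -/
def badIndices {n L : ℕ} (D : Euc n → Euc n →L[ℝ] Euc L) (δ γ : ℝ) (j : ℕ) (y : Euc n) :
    Finset ℕ :=
  (Finset.range j).filter fun i => ¬IsGoodScale D δ y (γ ^ i)

theorem sum_inv_pow_le {a : ℝ} (h0 : 0 < a) (h1 : a < 1) (M : ℕ) :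
    ∑ i ∈ Finset.range (M + 1), (a ^ i)⁻¹ ≤ (1 - a)⁻¹ * (a ^ M)⁻¹ := by
  have h2 : 0 < 1 - a := by linarith
  induction M with
  | zero =>
    simp only [zero_add, Finset.range_one, Finset.sum_singleton, pow_zero, inv_one, mul_one]
    exact (one_le_inv₀ h2).2 (by linarith)
  | succ M ih =>
    rw [Finset.sum_range_succ]
    refine (add_le_add_left ih _).trans_eq ?_
    rw [pow_succ]
    field_simp
    ring

/-- The geometric sum is dominated by its largest admissible index `M`. There `r ≤ 5γ^M` and `γ^j ≤
γ^M`, whence `r² + γ^(2j) ≤ 26 γ^(2M)`. -/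
theorem sum_inv_pow_filter_le {n : ℕ} (hn : n ≠ 0) {γ : ℝ} (hγ0 : 0 < γ) (hγ1 : γ < 1) {j : ℕ}
    {B : Finset ℕ} (hB : B ⊆ Finset.range j) {r : ℝ} (hr : 0 ≤ r) :
    ∑ i ∈ B.filter (fun i => r < 5 * γ ^ i), ((γ ^ i) ^ n)⁻¹ ≤
      (1 - γ ^ n)⁻¹ * 26 ^ ((n : ℝ) / 2) * (r ^ 2 + (γ ^ j) ^ 2) ^ (-((n : ℝ) / 2)) := by
  have ha0 : 0 < γ ^ n := by positivity
  have ha1 : γ ^ n < 1 := pow_lt_one₀ hγ0.le hγ1 hn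
  have h1a : 0 < 1 - γ ^ n := by linarith
  set S := B.filter (fun i => r < 5 * γ ^ i) with hS
  rcases S.eq_empty_or_nonempty with he | hne
  · rw [he, Finset.sum_empty]
    positivity
  have hM := Finset.mem_filter.1 (S.max'_mem hne)
  set M := S.max' hne
  have hMj : M < j := Finset.mem_range.1 (hB hM.1)
  have hsub : S ⊆ Finset.range (M + 1) := fun i hi =>
    Finset.mem_range.2 (Nat.lt_succ_of_le (S.le_max' i hi))
  calc ∑ i ∈ S, ((γ ^ i) ^ n)⁻¹ ≤ ∑ i ∈ Finset.range (M + 1), ((γ ^ i) ^ n)⁻¹ :=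
        Finset.sum_le_sum_of_subset_of_nonneg hsub fun _ _ _ => by positivity
    _ = ∑ i ∈ Finset.range (M + 1), ((γ ^ n) ^ i)⁻¹ :=
        Finset.sum_congr rfl fun i _ => by rw [pow_right_comm]
    _ ≤ (1 - γ ^ n)⁻¹ * ((γ ^ n) ^ M)⁻¹ := sum_inv_pow_le ha0 ha1 M
    _ = (1 - γ ^ n)⁻¹ * 26 ^ ((n : ℝ) / 2) * (26 * (γ ^ M) ^ 2) ^ (-((n : ℝ) / 2)) := by
        rw [mul_assoc]
        congr 1
        have hg : 0 < γ ^ M := by positivity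
        rw [Real.mul_rpow (by norm_num) (by positivity), ← mul_assoc, ← Real.rpow_add (by norm_num),
          add_neg_cancel, Real.rpow_zero, one_mul, ← Real.rpow_natCast (γ ^ M) 2,
          ← Real.rpow_mul hg.le, Nat.cast_ofNat, mul_neg, mul_div_cancel₀ _ two_ne_zero,
          Real.rpow_neg hg.le, Real.rpow_natCast, pow_right_comm]
    _ ≤ _ := by
        refine mul_le_mul_of_nonneg_left ?_ (by positivity)
        refine Real.rpow_le_rpow_of_nonpos (by positivity) ?_ (by
          have : (0 : ℝ) ≤ n := n.cast_nonneg
          linarith)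
        have h5 : (γ ^ j) ≤ γ ^ M := pow_le_pow_of_le_one hγ0.le hγ1.le hMj.le
        have h6 : r ^ 2 ≤ (5 * γ ^ M) ^ 2 := by
          gcongr
          exact hM.2.le
        have h7 : (γ ^ j) ^ 2 ≤ (γ ^ M) ^ 2 := by gcongr
        linarith

variable {n L : ℕ} {D : Euc n → Euc n →L[ℝ] Euc L} {u : Euc n → Euc L}

/-- The number of scales with large radial energy is controlled by the weighted radial energy. -/
theorem card_mul_le_weighted (hn : n ≠ 0) (h : IsW12 (ball 0 2) u D) {γ : ℝ} (hγ0 : 0 < γ)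
    (hγ1 : γ < 1) {δ : ℝ} {j : ℕ} {y : Euc n} (hy : y ∈ ball (0 : Euc n) 1) {B : Finset ℕ}
    (hB : B ⊆ Finset.range j)
    (hBγ : ∀ i ∈ B, 10 * γ ^ i ≤ 1 ∧ δ * (γ ^ i) ^ n < ∫ x in ball y (5 * γ ^ i), ‖D x (x - y)‖ ^ 2) :
    B.card * δ ≤ (1 - γ ^ n)⁻¹ * 26 ^ ((n : ℝ) / 2) *
      ∫ x in ball y (1 / 2), (‖x - y‖ ^ 2 + (γ ^ j) ^ 2) ^ (-((n : ℝ) / 2)) * ‖D x (x - y)‖ ^ 2 := by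
  have hi : IntegrableOn (fun x => ‖D x (x - y)‖ ^ 2) (ball y (1 / 2)) :=
    (integrable_norm_apply_sub_sq h.memLp_fun le_rfl y).mono_set (ball_half_subset hy)
  have hind : ∀ i, IntegrableOn (fun x => (ball y (5 * γ ^ i)).indicator
      (fun x => ((γ ^ i) ^ n)⁻¹ * ‖D x (x - y)‖ ^ 2) x) (ball y (1 / 2)) := fun i =>
    (hi.const_mul _).indicator measurableSet_ball
  calc B.card * δ = ∑ i ∈ B, δ := by rw [Finset.sum_const, nsmul_eq_mul]
    _ ≤ ∑ i ∈ B, ∫ x in ball y (1 / 2), (ball y (5 * γ ^ i)).indicator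
          (fun x => ((γ ^ i) ^ n)⁻¹ * ‖D x (x - y)‖ ^ 2) x := by
        refine Finset.sum_le_sum fun i hi => ?_
        have hg : 0 < (γ ^ i) ^ n := by positivity
        rw [setIntegral_indicator measurableSet_ball, inter_eq_right.2
          (ball_subset_ball (by linarith [(hBγ i hi).1])), integral_const_mul,
          ← div_eq_inv_mul, le_div_iff₀ hg]
        exact (hBγ i hi).2.le
    _ = ∫ x in ball y (1 / 2), ∑ i ∈ B, (ball y (5 * γ ^ i)).indicator
          (fun x => ((γ ^ i) ^ n)⁻¹ * ‖D x (x - y)‖ ^ 2) x :=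
        (integral_finsetSum _ fun i _ => hind i).symm
    -- At a fixed `x` the sum of indicators is the geometric sum with `r = ‖x - y‖`; the
    -- regularization is `ε = γ^(2j)`.
    _ ≤ ∫ x in ball y (1 / 2), (1 - γ ^ n)⁻¹ * 26 ^ ((n : ℝ) / 2) *
          ((‖x - y‖ ^ 2 + (γ ^ j) ^ 2) ^ (-((n : ℝ) / 2)) * ‖D x (x - y)‖ ^ 2) := by
        refine integral_mono (integrable_finsetSum _ fun i _ => hind i)
          (((integrableOn_rpow_mul_radial h (by positivity) _).mono_set
            (ball_half_subset hy)).const_mul _) fun x => ?_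
        simp only
        have := sum_inv_pow_filter_le hn hγ0 hγ1 hB (norm_nonneg (x - y))
        rw [Finset.sum_filter] at this
        calc ∑ i ∈ B, (ball y (5 * γ ^ i)).indicator
              (fun x => ((γ ^ i) ^ n)⁻¹ * ‖D x (x - y)‖ ^ 2) x
            = (∑ i ∈ B, if ‖x - y‖ < 5 * γ ^ i then ((γ ^ i) ^ n)⁻¹ else 0) *
              ‖D x (x - y)‖ ^ 2 := by
              rw [Finset.sum_mul]
              refine Finset.sum_congr rfl fun i _ => ?_
              by_cases hx : x ∈ ball y (5 * γ ^ i)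
              · rw [indicator_of_mem hx, if_pos (by rwa [mem_ball, dist_eq_norm] at hx)]
              · rw [indicator_of_notMem hx, if_neg (by rwa [mem_ball, dist_eq_norm] at hx),
                  zero_mul]
          _ ≤ _ := mul_le_mul_of_nonneg_right this (by positivity)
          _ = _ := mul_assoc _ _ _
    _ = _ := integral_const_mul _ _

/-- The scale 1 is never good, since a good scale `s` satisfies `10s ≤ 1`. Thus every set of bad
indices is nonempty, as the count `j^Q` requires. -/
theorem zero_mem_badIndices {δ γ : ℝ} {j : ℕ} (hj : 1 ≤ j) (y : Euc n) :
    0 ∈ badIndices D δ γ j y := by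
  classical
  refine Finset.mem_filter.2 ⟨Finset.mem_range.2 hj, fun h => ?_⟩
  have := h.1
  norm_num at this

/-- The number of bad scales is bounded. -/
theorem exists_card_badIndices_le (hn : n ≠ 0) (m : ℕ) (N : Type*) [EMetricSpace N]
    [ChartedSpace (Euc m) N] {Λ γ δ : ℝ} (hγ0 : 0 < γ) (hγ1 : γ < 1) (hδ : 0 < δ) :
    ∃ Q : ℕ, 0 < Q ∧ ∀ (L : ℕ) (ι : N → Euc L) (f : Euc n → N)
      (D : Euc n → Euc n →L[ℝ] Euc L), IsStationaryHarmonic (m := m) (ball 0 2) ι f D →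
      ∫ x in ball 0 2, energyDensity D x < Λ →
      ∀ y ∈ ball (0 : Euc n) 1, ∀ j, (badIndices D δ γ j y).card ≤ Q := by
  obtain ⟨C, hC, hCb⟩ := exists_weighted_radial_energy_le n m N
  obtain ⟨i₀, hi₀⟩ := exists_pow_lt_of_lt_one (by norm_num : (0 : ℝ) < 1 / 10) hγ1
  have h1a : 0 < 1 - γ ^ n := by linarith [pow_lt_one₀ hγ0.le hγ1 hn]
  set A : ℝ := (1 - γ ^ n)⁻¹ * 26 ^ ((n : ℝ) / 2) with hA
  have hA0 : 0 < A := by positivity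
  -- `i₀` accounts for the scales larger than `1/10`, the ceiling for those with large radial
  -- energy, and the final 1 makes `Q` positive.
  refine ⟨i₀ + ⌈A * (C * Λ) / δ⌉₊ + 1, by omega, fun L ι f D h hΛ y hy j => ?_⟩
  classical
  set B := (badIndices D δ γ j y).filter fun i => 10 * γ ^ i ≤ 1 with hB
  have hBj : B ⊆ Finset.range j :=
    (Finset.filter_subset _ _).trans (Finset.filter_subset _ _)
  have hsub : badIndices D δ γ j y ⊆ Finset.range i₀ ∪ B := by
    intro i hi
    by_cases h10 : 10 * γ ^ i ≤ 1
    · exact Finset.mem_union_right _ (Finset.mem_filter.2 ⟨hi, h10⟩)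
    · refine Finset.mem_union_left _ (Finset.mem_range.2 ?_)
      by_contra! hle
      have := pow_le_pow_of_le_one hγ0.le hγ1.le hle
      linarith
  have h1 := card_mul_le_weighted hn h.isW12 hγ0 hγ1 (δ := δ) hy hBj fun i hi => by
    have h2 := Finset.mem_filter.1 hi
    refine ⟨h2.2, ?_⟩
    by_contra! hle
    exact (Finset.mem_filter.1 h2.1).2 ⟨h2.2, hle⟩
  have h2 := hCb L ι f D h y hy ((γ ^ j) ^ 2) (by positivity)
  have h3 : (B.card : ℝ) ≤ A * (C * Λ) / δ := by
    rw [le_div_iff₀ hδ]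
    refine h1.trans (mul_le_mul_of_nonneg_left (h2.trans ?_) hA0.le)
    gcongr
  have h4 : B.card ≤ ⌈A * (C * Λ) / δ⌉₊ := by exact_mod_cast h3.trans (Nat.le_ceil _)
  calc (badIndices D δ γ j y).card ≤ (Finset.range i₀ ∪ B).card := Finset.card_le_card hsub
    _ ≤ i₀ + B.card := (Finset.card_union_le _ _).trans_eq (by rw [Finset.card_range])
    _ ≤ _ := by omega

end GoodScales

/-! ### Coverings near a coordinate subspace and their iteration over scales. -/

section Covering

variable {n : ℕ}

theorem abs_inner_orthonormal_le (b : OrthonormalBasis (Fin n) ℝ (Euc n)) (i : Fin n) (v : Euc n) :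
    |inner ℝ (b i) v| ≤ ‖v‖ := by
  simpa using abs_real_inner_le_norm (b i) v

theorem norm_lt_of_forall_abs_inner_le (b : OrthonormalBasis (Fin n) ℝ (Euc n)) {γ : ℝ}
    (hγ : 0 < γ) {v : Euc n} (h : ∀ i, |inner ℝ (b i) v| ≤ γ / (n + 1)) : ‖v‖ < γ := by
  refine lt_of_pow_lt_pow_left₀ 2 hγ.le ?_
  rw [← b.sum_sq_norm_inner_right]
  calc ∑ i, ‖inner ℝ (b i) v‖ ^ 2 ≤ ∑ i : Fin n, (γ / (n + 1)) ^ 2 :=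
        Finset.sum_le_sum fun i _ => by
          rw [Real.norm_eq_abs]
          gcongr
          exact h i
    _ = n * (γ / (n + 1)) ^ 2 := by simp
    _ < γ ^ 2 := by
      have hn : (0 : ℝ) ≤ n := n.cast_nonneg
      rw [div_pow, mul_div_assoc', div_lt_iff₀ (by positivity)]
      have : 0 < γ ^ 2 := by positivity
      nlinarith [mul_nonneg this.le hn, mul_nonneg this.le (sq_nonneg (n : ℝ))]

theorem card_Icc_floor_le {x : ℝ} (hx : 2 ≤ x) :
    ((Finset.Icc ⌊-x⌋ ⌊x⌋).card : ℝ) ≤ 3 * x := by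
  have h1 := Int.floor_le x
  have h2 := Int.lt_floor_add_one (-x)
  have h3 : ⌊-x⌋ ≤ ⌊x⌋ := Int.floor_le_floor (by linarith)
  have h4 : ((Finset.Icc ⌊-x⌋ ⌊x⌋).card : ℤ) = ⌊x⌋ + 1 - ⌊-x⌋ := by
    rw [Int.card_Icc]
    omega
  have h5 : ((Finset.Icc ⌊-x⌋ ⌊x⌋).card : ℝ) = ⌊x⌋ + 1 - ⌊-x⌋ := by exact_mod_cast h4
  rw [h5]
  linarith

/-- A bounded set close to a coordinate subspace is covered by few small balls. -/
theorem exists_cover_of_abs_inner_le (b : OrthonormalBasis (Fin n) ℝ (Euc n)) (I : Finset (Fin n))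
    {Y : Set (Euc n)} {γ : ℝ} (hγ0 : 0 < γ) (hγ1 : γ < 1) (hY : ∀ v ∈ Y, ‖v‖ ≤ 2)
    (hI : ∀ v ∈ Y, ∀ i ∉ I, |inner ℝ (b i) v| ≤ γ / (2 * (n + 1))) :
    ∃ A : Finset (Euc n), (A.card : ℝ) ≤ (6 * (n + 1) / γ) ^ I.card ∧ Y ⊆ ⋃ a ∈ A, ball a γ := by
  classical
  have hn : (0 : ℝ) ≤ n := n.cast_nonneg
  -- Only the coordinates in `I` are discretized, into cells of side `γ/(n + 1)`, and one center is
  -- chosen in each occupied cell. In the other coordinates two points of `Y` differ by at most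
  -- `γ/(n + 1)` anyway.
  set c : Euc n → I → ℤ := fun v i => ⌊inner ℝ (b i) v * ((n + 1) / γ)⌋ with hc
  set x : ℝ := 2 * ((n + 1) / γ) with hx
  have hx2 : 2 ≤ x := by
    have : 1 ≤ (n + 1) / γ := (one_le_div hγ0).2 (by linarith)
    linarith
  set P : Finset (I → ℤ) := Fintype.piFinset fun _ => Finset.Icc ⌊-x⌋ ⌊x⌋ with hP
  have hcP : ∀ v ∈ Y, c v ∈ P := by
    intro v hv
    refine Fintype.mem_piFinset.2 fun i => ?_
    have h1 := abs_le.1 ((abs_inner_orthonormal_le b i v).trans (hY v hv))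
    have h2 : 0 < (n + 1) / γ := by positivity
    exact Finset.mem_Icc.2 ⟨Int.floor_le_floor (by nlinarith), Int.floor_le_floor (by nlinarith)⟩
  obtain ⟨s, hsY, hbij⟩ := exists_subset_bijOn Y c
  have hsf : s.Finite := by
    refine Finite.of_finite_image (f := c) (P.finite_toSet.subset ?_) hbij.injOn
    rintro _ ⟨v, hv, rfl⟩
    exact hcP v (hsY hv)
  refine ⟨hsf.toFinset, ?_, fun v hv => ?_⟩
  · have h1 : hsf.toFinset.card ≤ P.card :=
      Finset.card_le_card_of_injOn c (fun v hv => hcP v (hsY (hsf.mem_toFinset.1 hv)))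
        (by simpa using hbij.injOn)
    have h2 : P.card = (Finset.Icc ⌊-x⌋ ⌊x⌋).card ^ I.card := by
      rw [hP, Fintype.card_piFinset, Finset.prod_const, Finset.card_univ, Fintype.card_coe]
    calc (hsf.toFinset.card : ℝ) ≤ ((Finset.Icc ⌊-x⌋ ⌊x⌋).card : ℝ) ^ I.card := by
          exact_mod_cast h1.trans_eq h2
      _ ≤ (3 * x) ^ I.card := by
          gcongr
          exact card_Icc_floor_le hx2
      _ = (6 * (n + 1) / γ) ^ I.card := by
          rw [hx]
          ring
  · obtain ⟨a, ha, hac⟩ := hbij.surjOn (mem_image_of_mem c hv)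
    refine mem_iUnion₂.2 ⟨a, hsf.mem_toFinset.2 ha, ?_⟩
    rw [mem_ball, dist_eq_norm]
    refine norm_lt_of_forall_abs_inner_le b hγ0 fun i => ?_
    rw [inner_sub_right]
    by_cases hi : i ∈ I
    · have h1 := Int.abs_sub_lt_one_of_floor_eq_floor (congrFun hac ⟨i, hi⟩)
      simp only at h1
      rw [← sub_mul, abs_mul, abs_of_pos (by positivity : 0 < (n + 1) / γ), abs_sub_comm,
        ← lt_div_iff₀ (by positivity), one_div_div] at h1
      exact h1.le
    · have h1 := abs_le.1 (hI v hv i hi)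
      have h2 := abs_le.1 (hI a (hsY ha) i hi)
      have h3 : γ / (n + 1) = γ / (2 * (n + 1)) + γ / (2 * (n + 1)) := by
        field_simp
        ring
      rw [h3]
      exact abs_le.2 ⟨by linarith, by linarith⟩

theorem exists_cover_inter_ball (b : OrthonormalBasis (Fin n) ℝ (Euc n)) (I : Finset (Fin n))
    {E : Set (Euc n)} {γ s : ℝ} (hγ0 : 0 < γ) (hγ1 : γ < 1) (hs : 0 < s) {a y₀ : Euc n}
    (hy₀ : y₀ ∈ ball a s) (hI : ∀ y ∈ E ∩ ball a s, ∀ i ∉ I,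
      |inner ℝ (b i) (s⁻¹ • (y - y₀))| ≤ γ / (2 * (n + 1))) :
    ∃ A : Finset (Euc n), (A.card : ℝ) ≤ (6 * (n + 1) / γ) ^ I.card ∧
      E ∩ ball a s ⊆ ⋃ a ∈ A, ball a (s * γ) := by
  classical
  obtain ⟨A, hA, hcov⟩ := exists_cover_of_abs_inner_le b I
    (Y := (fun y => s⁻¹ • (y - y₀)) '' (E ∩ ball a s)) hγ0 hγ1
    (by
      rintro _ ⟨y, hy, rfl⟩
      have h1 : dist y y₀ < 2 * s := by
        have := dist_triangle_right y y₀ a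
        have := mem_ball.1 hy.2
        have := mem_ball.1 hy₀
        linarith
      rw [norm_smul, norm_inv, Real.norm_of_nonneg hs.le, ← dist_eq_norm, inv_mul_le_iff₀ hs]
      linarith)
    (by
      rintro _ ⟨y, hy, rfl⟩
      exact hI y hy)
  refine ⟨A.image fun v => y₀ + s • v, ?_, fun y hy => ?_⟩
  · exact le_trans (by exact_mod_cast Finset.card_image_le) hA
  · obtain ⟨v, hv, hyv⟩ := mem_iUnion₂.1 (hcov (mem_image_of_mem _ hy))
    refine mem_iUnion₂.2 ⟨_, Finset.mem_image_of_mem _ hv, ?_⟩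
    rw [mem_ball, dist_eq_norm] at hyv ⊢
    have h1 : y - (y₀ + s • v) = s • (s⁻¹ • (y - y₀) - v) := by
      rw [smul_sub, smul_smul, mul_inv_cancel₀ hs.ne', one_smul]
      abel
    rw [h1, norm_smul, Real.norm_of_nonneg hs.le]
    gcongr

/-- Iterating coverings over the scales `γ ^ i`. -/
theorem exists_cover_of_forall_scale {E : Set (Euc n)} {γ : ℝ} (hE : E ⊆ ball 0 1) (M : ℕ → ℝ)
    (hM : ∀ i, 0 ≤ M i) (j : ℕ) (h : ∀ i < j, ∀ a : Euc n, ∃ A : Finset (Euc n),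
      (A.card : ℝ) ≤ M i ∧ E ∩ ball a (γ ^ i) ⊆ ⋃ a ∈ A, ball a (γ ^ (i + 1))) :
    ∃ A : Finset (Euc n), (A.card : ℝ) ≤ ∏ i ∈ Finset.range j, M i ∧
      E ⊆ ⋃ a ∈ A, ball a (γ ^ j) := by
  classical
  induction j with
  | zero => exact ⟨{0}, by simp, by simpa using hE⟩
  | succ j ih =>
    obtain ⟨A, hA, hcov⟩ := ih fun i hi => h i (by omega)
    choose B hB hBcov using h j (by omega)
    refine ⟨A.biUnion B, ?_, fun y hy => ?_⟩
    · calc ((A.biUnion B).card : ℝ) ≤ ∑ a ∈ A, ((B a).card : ℝ) := by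
            exact_mod_cast Finset.card_biUnion_le
        _ ≤ ∑ a ∈ A, M j := Finset.sum_le_sum fun a _ => hB a
        _ = A.card * M j := by rw [Finset.sum_const, nsmul_eq_mul]
        _ ≤ _ := by
            rw [Finset.prod_range_succ]
            exact mul_le_mul_of_nonneg_right hA (hM j)
    · obtain ⟨a, ha, hya⟩ := mem_iUnion₂.1 (hcov hy)
      obtain ⟨c, hc, hyc⟩ := mem_iUnion₂.1 (hBcov a ⟨hy, hya⟩)
      exact mem_iUnion₂.2 ⟨c, Finset.mem_biUnion.2 ⟨a, ha, hc⟩, hyc⟩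

end Covering

/-! ### Counting sets of bad scales and adjusting exponents. -/

section Counting

/-- A nonempty set with at most `Q` elements is the image of a map from `Fin Q`, repetitions being
allowed. -/
theorem card_le_pow_of_forall_subset_range {j Q : ℕ} {S : Finset (Finset ℕ)}
    (hS : ∀ T ∈ S, T ⊆ Finset.range j ∧ T.Nonempty ∧ T.card ≤ Q) : S.card ≤ j ^ Q := by
  have hsub : S ⊆
      Finset.univ.image fun φ : Fin Q → Fin j => Finset.univ.image fun i => (φ i : ℕ) := by
    intro T hT
    obtain ⟨hTj, hne, hcard⟩ := hS T hT
    have : Nonempty T := hne.to_subtype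
    obtain ⟨e⟩ : Nonempty (T ↪ Fin Q) :=
      Function.Embedding.nonempty_of_card_le (by simpa using hcard)
    have hsurj := Function.invFun_surjective e.injective
    have hlt : ∀ t : T, (t : ℕ) < j := fun t =>
      Finset.mem_range.1 (hTj t.2)
    refine Finset.mem_image.2 ⟨fun i => ⟨((Function.invFun e i : T) : ℕ), hlt _⟩, Finset.mem_univ _, ?_⟩
    ext t
    simp only [Finset.mem_image, Finset.mem_univ, true_and]
    refine ⟨fun ⟨i, hi⟩ => hi ▸ (Function.invFun e i).2, fun ht => ?_⟩
    obtain ⟨i, hi⟩ := hsurj ⟨t, ht⟩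
    exact ⟨i, by rw [hi]⟩
  calc _ ≤ _ := Finset.card_le_card hsub
    _ ≤ Fintype.card (Fin Q → Fin j) := Finset.card_image_le
    _ = j ^ Q := by simp

/-- Since `a / b ≥ 1`, the exponent `t` of `a / b` may be raised to `Q`. Real exponents are used
because `j` may be smaller than `Q`. -/
theorem pow_mul_pow_sub_le {a b : ℝ} (hb : 0 < b) (hba : b ≤ a) {t j Q : ℕ} (htQ : t ≤ Q)
    (htj : t ≤ j) : a ^ t * b ^ (j - t) ≤ a ^ (Q : ℝ) * b ^ ((j : ℝ) - Q) := by
  have ha : 0 < a := hb.trans_le hba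
  have h1 : b ^ (j - t) = b ^ j / b ^ t := by
    rw [eq_div_iff (by positivity), ← pow_add, Nat.sub_add_cancel htj]
  rw [Real.rpow_sub hb, Real.rpow_natCast, Real.rpow_natCast, Real.rpow_natCast, h1]
  calc a ^ t * (b ^ j / b ^ t) = (a / b) ^ t * b ^ j := by
        rw [div_pow]
        ring
    _ ≤ (a / b) ^ Q * b ^ j := by
        gcongr
        exact (one_le_div hb).2 hba
    _ = a ^ Q * (b ^ j / b ^ Q) := by
        rw [div_pow]
        ring

end Counting

/-! ### Covering one piece of the stratum. -/

section Decomposition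

variable {n m L : ℕ} {N : Type*} [EMetricSpace N] [ChartedSpace (Euc m) N] [IsManifold (𝓡 m) ∞ N]
  [RiemannianBundle (fun p : N => TangentSpace (𝓡 m) p)] [IsRiemannianManifold (𝓡 m) N]
  [MeasurableSpace N] [BorelSpace N]
  {ι : N → Euc L} {f : Euc n → N} {D : Euc n → Euc n →L[ℝ] Euc L}

/-- The part of the effective stratum with a given set of bad scales. -/
def stratumPiece (k : ℕ) (η γ δ : ℝ) (j : ℕ) (f : Euc n → N) (D : Euc n → Euc n →L[ℝ] Euc L)
    (T : Finset ℕ) : Set (Euc n) :=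
  {y | y ∈ effStratum k η (γ ^ j) f ∩ ball 0 1 ∧ badIndices D δ γ j y = T}

/-- All points of a piece share the bad scales `T`, so at each scale the type of refinement is
uniform: `γ^(-n)` for `i ∈ T`, and cone splitting with `γ^(-k)` for `i ∉ T`. -/
theorem exists_cover_stratumPiece (hι : IsIsometricEmbedding (m := m) ι)
    (h : IsW12 (ball 0 2) (ι ∘ f) D) {k : ℕ} (hkn : k ≤ n) {η γ δ δ₁ : ℝ} (hγ0 : 0 < γ)
    (hγ1 : γ < 1) (hδ₁ : 0 < δ₁)
    (hη : homConst n * (δ + n * δ₁) ≤ η * (volume (ball (0 : Euc n) 1)).toReal)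
    (hδ : 4 * δ ≤ δ₁ * (γ / (2 * (n + 1))) ^ 2) (j : ℕ) {T : Finset ℕ} (hT : T ⊆ Finset.range j) :
    ∃ A : Finset (Euc n),
      (A.card : ℝ) ≤ ((6 * (n + 1)) ^ n * (γ ^ n)⁻¹) ^ T.card *
        ((6 * (n + 1)) ^ n * (γ ^ k)⁻¹) ^ (j - T.card) ∧
      stratumPiece k η γ δ j f D T ⊆ ⋃ a ∈ A, ball a (γ ^ j) := by
  classical
  set c : ℝ := 6 * (n + 1) with hc
  have hn : (0 : ℝ) ≤ n := n.cast_nonneg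
  have hc1 : 1 ≤ c := by linarith
  have hcγ : 1 ≤ c / γ := (one_le_div hγ0).2 (by linarith)
  set E := stratumPiece k η γ δ j f D T with hE
  have hprod : (c ^ n * (γ ^ n)⁻¹) ^ T.card * (c ^ n * (γ ^ k)⁻¹) ^ (j - T.card) =
      ∏ i ∈ Finset.range j, if i ∈ T then c ^ n * (γ ^ n)⁻¹ else c ^ n * (γ ^ k)⁻¹ := by
    rw [Finset.prod_ite, Finset.prod_const, Finset.prod_const, Finset.filter_mem_eq_inter,
      Finset.inter_eq_right.2 hT, ← Finset.sdiff_eq_filter, Finset.card_sdiff_of_subset hT,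
      Finset.card_range]
  rw [hprod]
  refine exists_cover_of_forall_scale (fun y hy => hy.1.2) _ (fun i => by positivity) j
    fun i hi a => ?_
  have hs : 0 < γ ^ i := by positivity
  rw [pow_succ]
  rcases (E ∩ ball a (γ ^ i)).eq_empty_or_nonempty with he | ⟨y₀, hy₀⟩
  · exact ⟨∅, by simp only [Finset.card_empty, Nat.cast_zero]; positivity, by rw [he]; simp⟩
  by_cases hiT : i ∈ T
  -- At a bad scale every coordinate is discretized, and the closeness condition is void.
  · obtain ⟨A, hA, hcov⟩ := exists_cover_inter_ball (EuclideanSpace.basisFun (Fin n) ℝ) Finset.univ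
      (E := E) hγ0 hγ1 hs hy₀.2 fun y _ i hi => absurd (Finset.mem_univ i) hi
    refine ⟨A, hA.trans_eq ?_, hcov⟩
    rw [if_pos hiT, Finset.card_univ, Fintype.card_fin, div_pow, div_eq_mul_inv]
  · have hgood : ∀ y ∈ E, IsGoodScale D δ y (γ ^ i) := by
      intro y hy
      by_contra hbad
      exact hiT (hy.2 ▸ Finset.mem_filter.2 ⟨Finset.mem_range.2 hi, hbad⟩)
    obtain ⟨b, I, hIk, hb⟩ := exists_basis_of_mem_effStratum hι h hs
      (pow_le_pow_of_le_one hγ0.le hγ1.le hi.le) (hgood y₀ hy₀.1).1 hδ₁ hη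
      (E := E) (fun y hy => hy.1) (fun y hy => (hgood y hy).2) hy₀
    obtain ⟨A, hA, hcov⟩ := exists_cover_inter_ball b I (E := E) hγ0 hγ1 hs hy₀.2
      fun y hy i hi => abs_le_of_sq_le_sq (by
        refine le_of_mul_le_mul_left ((hb y hy i hi).trans hδ) hδ₁) (by positivity)
    refine ⟨A, hA.trans ?_, hcov⟩
    rw [if_neg hiT]
    calc (c / γ) ^ I.card ≤ (c / γ) ^ k := pow_le_pow_right₀ hcγ hIk
      _ = c ^ k * (γ ^ k)⁻¹ := by rw [div_pow, div_eq_mul_inv]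
      _ ≤ c ^ n * (γ ^ k)⁻¹ := by
        gcongr

/-- The eigenvalue threshold `δ₁` is fixed first, from `η`. Then `δ` is taken small relative to
`δ₁`, so that points at good scales lie within `γ/(2(n + 1))` of the plane in each remaining
coordinate. -/
theorem exists_small_parameters (n : ℕ) {η γ : ℝ} (hη : 0 < η) (hγ : 0 < γ) :
    ∃ δ δ₁ : ℝ, 0 < δ ∧ 0 < δ₁ ∧
      homConst n * (δ + n * δ₁) ≤ η * (volume (ball (0 : Euc n) 1)).toReal ∧
      4 * δ ≤ δ₁ * (γ / (2 * (n + 1))) ^ 2 := by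
  have hV : 0 < (volume (ball (0 : Euc n) 1)).toReal :=
    ENNReal.toReal_pos (measure_ball_pos _ _ one_pos).ne' measure_ball_lt_top.ne
  have hH := homConst_pos n
  set w := η * (volume (ball (0 : Euc n) 1)).toReal / (2 * homConst n * (n + 1)) with hw
  have hw0 : 0 < w := by positivity
  have hn : (0 : ℝ) ≤ n := n.cast_nonneg
  refine ⟨min w (w * (γ / (2 * (n + 1))) ^ 2 / 4), w, by positivity, hw0, ?_, ?_⟩
  · have h1 : η * (volume (ball (0 : Euc n) 1)).toReal = homConst n * (2 * (n + 1) * w) := by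
      rw [hw]
      field_simp
    rw [h1]
    have h2 := min_le_left w (w * (γ / (2 * (n + 1))) ^ 2 / 4)
    refine mul_le_mul_of_nonneg_left ?_ hH.le
    nlinarith
  · have := min_le_right w (w * (γ / (2 * (n + 1))) ^ 2 / 4)
    linarith

end Decomposition

end HarmonicStrat

end

/-! ### The decomposition. -/

theorem lemma4p1 (n : ℕ) :
    ∃ c₁ c₀ : ℝ, 0 < c₁ ∧ 0 < c₀ ∧
    ∀ (m : ℕ) (N : Type*) [EMetricSpace N] [MeasurableSpace N] [BorelSpace N]
      [ChartedSpace (HarmonicStrat.Euc m) N] [IsManifold (𝓡 m) ∞ N]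
      [RiemannianBundle (fun p : N => TangentSpace (𝓡 m) p)]
      [IsContMDiffRiemannianBundle (𝓡 m) ∞ (HarmonicStrat.Euc m)
        (fun p : N => TangentSpace (𝓡 m) p)]
      [IsRiemannianManifold (𝓡 m) N]
      (Λ η γ : ℝ), 0 < Λ → 0 < η → 0 < γ → γ < 1 →
    ∃ K Q : ℝ, 0 < K ∧ 0 < Q ∧
    ∀ (L : ℕ) (ι : N → HarmonicStrat.Euc L), HarmonicStrat.IsIsometricEmbedding (m := m) ι →
    ∀ (f : HarmonicStrat.Euc n → N)
      (Du : HarmonicStrat.Euc n → HarmonicStrat.Euc n →L[ℝ] HarmonicStrat.Euc L),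
      HarmonicStrat.IsStationaryHarmonic (m := m) (ball 0 2) ι f Du →
      ∫ x in ball 0 2, HarmonicStrat.energyDensity Du x < Λ →
    ∀ k : ℕ, k < n → ∀ j : ℕ, 1 ≤ j →
    ∃ 𝒞 : Finset (Set (HarmonicStrat.Euc n)),
      (𝒞.card : ℝ) ≤ (j : ℝ) ^ K ∧
      HarmonicStrat.effStratum k η (γ ^ j) f ∩ ball 0 1 ⊆ ⋃ C ∈ 𝒞, C ∧
      ∀ C ∈ 𝒞, C.Nonempty ∧
        ∃ A : Finset (HarmonicStrat.Euc n),
          (A.card : ℝ) ≤ (c₁ * (γ ^ n)⁻¹) ^ Q * (c₀ * (γ ^ k)⁻¹) ^ ((j : ℝ) - Q) ∧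
          C = ⋃ a ∈ A, ball a (γ ^ j) := by
  have hn0 : (0 : ℝ) ≤ n := n.cast_nonneg
  have hc1 : (1 : ℝ) ≤ 6 * (n + 1) := by linarith
  refine ⟨(6 * (n + 1)) ^ n, (6 * (n + 1)) ^ n, by positivity, by positivity, ?_⟩
  intro m N _ _ _ _ _ _ _ _ Λ η γ _ hη hγ0 hγ1
  rcases eq_or_ne n 0 with rfl | hn
  · exact ⟨1, 1, one_pos, one_pos, fun L ι _ f D _ _ k hk => absurd hk (Nat.not_lt_zero k)⟩
  obtain ⟨δ, δ₁, hδ, hδ₁, hηδ, hδδ⟩ := HarmonicStrat.exists_small_parameters n hη hγ0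
  obtain ⟨Q, hQ, hbad⟩ :=
    HarmonicStrat.exists_card_badIndices_le (Λ := Λ) hn m N hγ0 hγ1 hδ
  -- The bound on the number of bad scales serves both as `K` and as `Q`.
  refine ⟨Q, Q, by exact_mod_cast hQ, by exact_mod_cast hQ, ?_⟩
  intro L ι hι f D hf hΛ k hk j hj
  classical
  have hcov : ∀ T : Finset ℕ, ∃ A : Finset (HarmonicStrat.Euc n), T ⊆ Finset.range j →
      (A.card : ℝ) ≤ ((6 * (n + 1)) ^ n * (γ ^ n)⁻¹) ^ T.card *
        ((6 * (n + 1)) ^ n * (γ ^ k)⁻¹) ^ (j - T.card) ∧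
      HarmonicStrat.stratumPiece k η γ δ j f D T ⊆ ⋃ a ∈ A, ball a (γ ^ j) := by
    intro T
    by_cases hT : T ⊆ Finset.range j
    · obtain ⟨A, hA⟩ := HarmonicStrat.exists_cover_stratumPiece hι hf.isW12 hk.le hγ0 hγ1 hδ₁
        hηδ hδδ j hT
      exact ⟨A, fun _ => hA⟩
    · exact ⟨∅, fun h => absurd h hT⟩
  choose A hA using hcov
  -- Bad sets with an empty piece are discarded, so that each resulting union of balls is nonempty.
  set 𝒯 : Finset (Finset ℕ) := (Finset.range j).powerset.filter fun T =>
    (T.Nonempty ∧ T.card ≤ Q) ∧ (HarmonicStrat.stratumPiece k η γ δ j f D T).Nonempty with h𝒯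
  -- The sets of the decomposition are the coverings of the pieces rather than the pieces, so they
  -- are exactly unions of balls.
  refine ⟨𝒯.image fun T => ⋃ a ∈ A T, ball a (γ ^ j), ?_, ?_, ?_⟩
  · rw [Real.rpow_natCast]
    norm_cast
    refine Finset.card_image_le.trans (HarmonicStrat.card_le_pow_of_forall_subset_range
      fun T hT => ?_)
    obtain ⟨hTj, hT1, _⟩ := Finset.mem_filter.1 hT
    exact ⟨Finset.mem_powerset.1 hTj, hT1⟩
  · intro y hy
    set T := HarmonicStrat.badIndices D δ γ j y with hT
    have hTj : T ⊆ Finset.range j := Finset.filter_subset _ _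
    have hyT : y ∈ HarmonicStrat.stratumPiece k η γ δ j f D T := ⟨hy, rfl⟩
    exact mem_iUnion₂.2 ⟨_, Finset.mem_image_of_mem _ (Finset.mem_filter.2
      ⟨Finset.mem_powerset.2 hTj, ⟨⟨0, HarmonicStrat.zero_mem_badIndices hj y⟩,
        hbad L ι f D hf hΛ y hy.2 j⟩, ⟨y, hyT⟩⟩), (hA T hTj).2 hyT⟩
  · intro C hC
    obtain ⟨T, hT, rfl⟩ := Finset.mem_image.1 hC
    obtain ⟨hTj, ⟨_, hTQ⟩, hTne⟩ := Finset.mem_filter.1 hT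
    have hTj := Finset.mem_powerset.1 hTj
    refine ⟨hTne.mono (hA T hTj).2, A T, (hA T hTj).1.trans ?_, rfl⟩
    refine HarmonicStrat.pow_mul_pow_sub_le (by positivity) ?_ hTQ
      ((Finset.card_le_card hTj).trans_eq (Finset.card_range j))
    gcongr ?_ * ?_
    exact inv_anti₀ (by positivity) (pow_le_pow_of_le_one hγ0.le hγ1.le hk.le)
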